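/- Let $k$ be a field of characteristic zero. A \emph{triple} $\tau=(\mathfrak g,\mathfrak s,\mathfrak c)$ consists of a Lie algebra $\mathfrak g$ over $k$ (of arbitrary dimension), a subalgebra $\mathfrak s$ and a subspace $\mathfrak c$ with $\mathfrak g=\mathfrak s\oplus\mathfrak c$. A morphism $\tau\to\tau'$ is a Lie algebra homomorphism $\varphi:\mathfrak g\to\mathfrak g'$ with $\varphi(\mathfrak s)\subseteq\mathfrak s'$ and $\varphi(\mathfrak c)\subseteq\mathfrak c'$. Let $\mathfrak g_{\rm inn}$ be the Lie subalgebra generated by $\mathfrak c$, let $\mathfrak s_{\rm inn}=\mathfrak g_{\rm inn}\cap\mathfrak s$, let $\mathfrak k$ be the largest ideal of $\mathfrak g_{\rm inn}$ contained in $\mathfrak s_{\rm inn}$, and let $\tau^{\rm red}=(\mathfrak g_{\rm inn}/\mathfrak k,\ \mathfrak s_{\rm inn}/\mathfrak k,\ \mathfrak c)$, where $\mathfrak c$ is identified with its image. Triples $\tau,\tau'$ are \emph{equivalent} if $\tau^{\rm red}\cong\tau'^{\rm red}$. All bialgebras are coassociative, cocommutative and unital, with a product that need not be associative. A \emph{(non-associative)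 Hopf algebra} is such a bialgebra with bilinear divisions $\backslash$, $/$ satisfying $u_{(1)}\backslash(u_{(2)}v)=\epsilon(u)v=u_{(1)}(u_{(2)}\backslash v)$ and $(uv_{(1)})/v_{(2)}=\epsilon(v)u=(u/v_{(1)})v_{(2)}$. A bialgebra $U$ is \emph{connected} if, as a coalgebra with distinguished element $1$, it is isomorphic to the symmetric algebra $k[V]$ on the space $V$ of its primitive elements. It is \emph{right monoalternative} if $((xy_{(1)})\cdots)y_{(n)}=x((y_{(1)}y_{(2)})\cdots y_{(n)})$ for all $x,y\in U$ and $n\ge 0$. A bialgebra $U$ determines a triple $\mathrm T(U)=(\mathfrak g(U),\mathfrak s(U),\mathfrak c(U))$, where $\mathfrak g(U)=\{f\in\mathrm{End}_k(U)\mid \Delta(f(u))=f(u_{(1)})\otimes u_{(2)}+u_{(1)}\otimes f(u_{(2)})\ \forall u\}$ with the commutator bracket, $\mathfrak s(U)=\{f\in\mathfrak g(U)\mid f(1)=0\}$, and $\mathfrak c(U)=\{R_a\mid a\text{ primitive}\}$ with $R_a(u)=ua$. For a triple $\tau$ let $U_\tau=U(\mathfrak g)/U(\mathfrak g)\mathfrak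 s$, with the coalgebra structure induced from $U(\mathfrak g)$, and write $\bar u$ for the class of $u\in U(\mathfrak g)$. \textbf{Theorem.} Let $\tau=(\mathfrak g,\mathfrak s,\mathfrak c)$ be a triple over $k$. There is exactly one Hopf algebra structure on the coalgebra $U_\tau$ whose product satisfies $$\bar u\Big(\sum_{\sigma\in S_n}\overline{c_{\sigma(1)}\cdots c_{\sigma(n)}}\Big)=\sum_{\sigma\in S_n}\overline{c_{\sigma(n)}\cdots c_{\sigma(1)}u}$$ for all $n\ge 0$, $c_1,\dots,c_n\in\mathfrak c$ and $u\in U(\mathfrak g)$. With this structure: 1. $U_\tau$ is right monoalternative and connected, and $\iota_x(\bar u)=\overline{xu}$ defines a morphism of triples $\iota:\tau\to\mathrm T(U_\tau)$ that restricts to a linear isomorphism of $\mathfrak c$ onto $\mathfrak c(U_\tau)$. 2. For every right monoalternative bialgebra $U'$ over $k$ and every morphism $\iota':\tau\to\mathrm T(U')$ there is a unique homomorphism of unital bialgebras $\psi:U_\tau\to U'$ such that $\iota'_c(1)=\psi(\iota_c(1))$ for all $c\in\mathfrak c$. 3. $\tau$ and $\mathrm T(U_\tau)$ are equivalent. 4.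 For every triple $\tau'$ over $k$, $U_\tau$ and $U_{\tau'}$ are isomorphic as bialgebras if and only if $\tau$ and $\tau'$ are equivalent. -/

import Mathlib

open scoped TensorProduct

/- Associative algebras, in particular endomorphism algebras, are Lie algebras under the
commutator `[f, g] = f * g - g * f`. -/
attribute [local instance 100] LieRing.ofAssociativeRing

noncomputable section

/-! ### The cocommutative bialgebra structure of a universal enveloping algebra -/

namespace UniversalEnvelopingAlgebra

section

variable (k 𝔤 : Type*) [Field k] [LieRing 𝔤] [LieAlgebra k 𝔤]

theorem algHom_ext_ι {k 𝔤 A : Type*} [Field k] [LieRing 𝔤] [LieAlgebra k 𝔤] [Ring A] [Algebra k A]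
    {f f' : UniversalEnvelopingAlgebra k 𝔤 →ₐ[k] A} (h : ∀ x, f (ι k x) = f' (ι k x)) : f = f' :=
  hom_ext k (LieHom.ext h)

/-- The Lie algebra map `x ↦ x ⊗ 1 + 1 ⊗ x`. -/
def primitiveLieHom :
    𝔤 →ₗ⁅k⁆ UniversalEnvelopingAlgebra k 𝔤 ⊗[k] UniversalEnvelopingAlgebra k 𝔤 where
  toFun x := ι k x ⊗ₜ[k] 1 + 1 ⊗ₜ[k] ι k x
  map_add' x y := by
    simp only [map_add, TensorProduct.add_tmul, TensorProduct.tmul_add]; abel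
  map_smul' c x := by
    simp only [map_smul, TensorProduct.smul_tmul', TensorProduct.tmul_smul, smul_add,
      RingHom.id_apply]
  map_lie' {x y} := by
    simp only [LieHom.map_lie, LieRing.of_associative_ring_bracket, mul_add, add_mul,
      Algebra.TensorProduct.tmul_mul_tmul, one_mul, mul_one, TensorProduct.sub_tmul,
      TensorProduct.tmul_sub]
    abel

/-- `U(𝔤)` is a bialgebra in which the elements of `𝔤` are primitive. -/
instance instBialgebraEnv : Bialgebra k (UniversalEnvelopingAlgebra k 𝔤) :=
  .ofAlgHom (lift k (primitiveLieHom k 𝔤)) (lift k (0 : 𝔤 →ₗ⁅k⁆ k))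
    (by
      refine algHom_ext_ι fun x => ?_
      change _ = Algebra.TensorProduct.map _ _ (lift k (primitiveLieHom k 𝔤) (ι k x))
      change Algebra.TensorProduct.assoc k k k _ _ _
        (Algebra.TensorProduct.map _ _ (lift k (primitiveLieHom k 𝔤) (ι k x))) = _
      rw [lift_ι_apply]
      simp only [primitiveLieHom, LieHom.coe_mk, map_add, Algebra.TensorProduct.map_tmul,
        lift_ι_apply, AlgHom.id_apply, map_one, Algebra.TensorProduct.one_def,
        TensorProduct.add_tmul, TensorProduct.tmul_add, Algebra.TensorProduct.assoc_tmul]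
      abel)
    (by
      refine algHom_ext_ι fun x => ?_
      change Algebra.TensorProduct.map _ _ (lift k (primitiveLieHom k 𝔤) (ι k x)) =
        1 ⊗ₜ[k] ι k x
      rw [lift_ι_apply]
      simp only [primitiveLieHom, LieHom.coe_mk, map_add, Algebra.TensorProduct.map_tmul,
        lift_ι_apply, AlgHom.id_apply, map_one, LieHom.zero_apply, TensorProduct.zero_tmul,
        zero_add])
    (by
      refine algHom_ext_ι fun x => ?_
      change Algebra.TensorProduct.map _ _ (lift k (primitiveLieHom k 𝔤) (ι k x)) =
        ι k x ⊗ₜ[k] 1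
      rw [lift_ι_apply]
      simp only [primitiveLieHom, LieHom.coe_mk, map_add, Algebra.TensorProduct.map_tmul,
        lift_ι_apply, AlgHom.id_apply, map_one, LieHom.zero_apply, TensorProduct.tmul_zero,
        add_zero])

variable {k 𝔤}

theorem comul_ι (x : 𝔤) :
    Coalgebra.comul (R := k) (ι k x) = ι k x ⊗ₜ[k] 1 + 1 ⊗ₜ[k] ι k x :=
  lift_ι_apply k (primitiveLieHom k 𝔤) x

theorem counit_ι (x : 𝔤) : Coalgebra.counit (R := k) (ι k x) = 0 :=
  lift_ι_apply k (0 : 𝔤 →ₗ⁅k⁆ k) x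

instance instIsCocommEnv : Coalgebra.IsCocomm k (UniversalEnvelopingAlgebra k 𝔤) where
  comm_comp_comul := by
    have h : (Algebra.TensorProduct.comm k (UniversalEnvelopingAlgebra k 𝔤)
          (UniversalEnvelopingAlgebra k 𝔤)).toAlgHom.comp (Bialgebra.comulAlgHom k _) =
        Bialgebra.comulAlgHom k (UniversalEnvelopingAlgebra k 𝔤) := by
      refine algHom_ext_ι fun x => ?_
      change TensorProduct.comm k _ _ (Coalgebra.comul (R := k) (ι k x)) =
        Coalgebra.comul (R := k) (ι k x)
      rw [comul_ι, map_add, TensorProduct.comm_tmul, TensorProduct.comm_tmul, add_comm]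
    exact congr(($h).toLinearMap)

end

end UniversalEnvelopingAlgebra

/-! ### Triples -/

/-- A triple `(𝔤, 𝔰, 𝔠)`: a subalgebra `𝔰` of the Lie algebra `𝔤` and a subspace `𝔠` with
`𝔤 = 𝔰 ⊕ 𝔠`. -/
structure Triple (k 𝔤 : Type*) [Field k] [LieRing 𝔤] [LieAlgebra k 𝔤] where
  /-- the subalgebra `𝔰` -/
  s : LieSubalgebra k 𝔤
  /-- the complement `𝔠` -/
  c : Submodule k 𝔤
  isCompl : IsCompl s.toSubmodule c

namespace Triple

section

variable {k 𝔤 𝔤' : Type*} [Field k] [LieRing 𝔤] [LieAlgebra k 𝔤] [LieRing 𝔤'] [LieAlgebra k 𝔤']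

/-- Morphisms of triples: Lie algebra homomorphisms with `φ(𝔰) ⊆ 𝔰'` and `φ(𝔠) ⊆ 𝔠'`. -/
structure Hom (τ : Triple k 𝔤) (τ' : Triple k 𝔤') extends 𝔤 →ₗ⁅k⁆ 𝔤' where
  map_s : ∀ x ∈ τ.s, toLieHom x ∈ τ'.s
  map_c : ∀ x ∈ τ.c, toLieHom x ∈ τ'.c

/-- Isomorphisms of triples: morphisms with an inverse that is again a morphism. -/
structure Iso (τ : Triple k 𝔤) (τ' : Triple k 𝔤') extends 𝔤 ≃ₗ⁅k⁆ 𝔤' where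
  mem_s_iff : ∀ x, toLieEquiv x ∈ τ'.s ↔ x ∈ τ.s
  mem_c_iff : ∀ x, toLieEquiv x ∈ τ'.c ↔ x ∈ τ.c

variable (τ : Triple k 𝔤) (τ' : Triple k 𝔤')

/-- `𝔤_inn`, the Lie subalgebra of `𝔤` generated by `𝔠`. -/
abbrev gInn : LieSubalgebra k 𝔤 := LieSubalgebra.lieSpan k 𝔤 (τ.c : Set 𝔤)

/-- `τ_inn = (𝔤_inn, 𝔤_inn ∩ 𝔰, 𝔠)`. -/
def inn : Triple k τ.gInn where
  s := τ.s.comap τ.gInn.incl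
  c := τ.c.comap τ.gInn.toSubmodule.subtype
  isCompl := by
    have hc : ∀ x ∈ τ.c, x ∈ τ.gInn := fun x hx => LieSubalgebra.subset_lieSpan hx
    refine ⟨?_, ?_⟩
    · rw [Submodule.disjoint_def]
      intro x hs hc
      exact Subtype.ext (Submodule.disjoint_def.1 τ.isCompl.disjoint x.1 hs hc)
    · rw [codisjoint_iff, Submodule.eq_top_iff']
      intro x
      obtain ⟨a, ha, b, hb, hab⟩ := Submodule.mem_sup.1
        (τ.isCompl.codisjoint.eq_top ▸ Submodule.mem_top : x.1 ∈ τ.s.toSubmodule ⊔ τ.c)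
      have ha' : a ∈ τ.gInn := by
        have : a = x.1 - b := by rw [← hab]; simp
        rw [this]
        exact sub_mem x.2 (hc b hb)
      exact Submodule.mem_sup.2 ⟨⟨a, ha'⟩, ha, ⟨b, hc b hb⟩, hb, Subtype.ext hab⟩

/-- `core_𝔤(𝔰)`, the largest ideal of `𝔤` contained in `𝔰`. -/
def core : LieIdeal k 𝔤 := sSup {I : LieIdeal k 𝔤 | I.toSubmodule ≤ τ.s.toSubmodule}

theorem isGreatest_core :
    IsGreatest {I : LieIdeal k 𝔤 | I.toSubmodule ≤ τ.s.toSubmodule} τ.core := by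
  refine ⟨?_, fun I hI => le_sSup hI⟩
  change τ.core.toSubmodule ≤ _
  rw [core, LieSubmodule.sSup_toSubmodule_eq_iSup]
  exact iSup₂_le fun I hI => hI

/-- The triple `(𝔤 / core(𝔰), 𝔰 / core(𝔰), 𝔠)`, with `𝔠` identified with its image. -/
def modCore : Triple k (𝔤 ⧸ τ.core) where
  s :=
    { τ.s.toSubmodule.map τ.core.toSubmodule.mkQ with
      lie_mem' := by
        rintro _ _ ⟨x, hx, rfl⟩ ⟨y, hy, rfl⟩
        exact ⟨⁅x, y⁆, τ.s.lie_mem hx hy, rfl⟩ }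
  c := τ.c.map τ.core.toSubmodule.mkQ
  isCompl := by
    change IsCompl (τ.s.toSubmodule.map τ.core.toSubmodule.mkQ)
      (τ.c.map τ.core.toSubmodule.mkQ)
    refine ⟨?_, ?_⟩
    · rw [Submodule.disjoint_def]
      rintro _ ⟨x, hx, rfl⟩ ⟨y, hy, hxy⟩
      have h : y - x ∈ τ.core.toSubmodule := (Submodule.Quotient.eq _).1 hxy
      have hy' : y ∈ τ.s.toSubmodule := by
        have := add_mem (τ.isGreatest_core.1 h) hx
        simpa using this
      have h0 : y = 0 := Submodule.disjoint_def.1 τ.isCompl.disjoint y hy' hy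
      rw [← hxy, h0, map_zero]
    · rw [codisjoint_iff, ← Submodule.map_sup, τ.isCompl.codisjoint.eq_top, Submodule.map_top,
        Submodule.range_mkQ]

/-- `τ_red = (𝔤_inn / core(𝔰_inn), 𝔰_inn / core(𝔰_inn), 𝔠)`. -/
abbrev red : Triple k (τ.gInn ⧸ τ.inn.core) := τ.inn.modCore

/-- Two triples are equivalent if their reduced triples are isomorphic. -/
def Equivalent : Prop := Nonempty (Iso τ.red τ'.red)

end

end Triple

/-! ### Non-associative bialgebras and Hopf algebras -/

/-- A (not necessarily associative) unital bialgebra structure on a coassociative and cocommutative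
coalgebra `U`: a unital bilinear product for which the product and the unit are morphisms of
coalgebras. -/
structure NonAssocBialgebra (k U : Type*) [Field k] [AddCommGroup U] [Module k U]
    [Coalgebra k U] [Coalgebra.IsCocomm k U] where
  /-- the product -/
  mul : U →ₗ[k] U →ₗ[k] U
  /-- the unit element -/
  one : U
  one_mul : ∀ u, mul one u = u
  mul_one : ∀ u, mul u one = u
  /-- `Δ(uv) = u₁v₁ ⊗ u₂v₂` -/
  comul_mul : ∀ u v, Coalgebra.comul (R := k) (mul u v) =
    TensorProduct.map₂ mul mul (Coalgebra.comul u) (Coalgebra.comul v)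
  counit_mul : ∀ u v, Coalgebra.counit (R := k) (mul u v) =
    Coalgebra.counit (R := k) u * Coalgebra.counit (R := k) v
  comul_one : Coalgebra.comul (R := k) one = one ⊗ₜ[k] one
  counit_one : Coalgebra.counit (R := k) one = 1

namespace NonAssocBialgebra

section

variable {k U U' : Type*} [Field k]
  [AddCommGroup U] [Module k U] [Coalgebra k U] [Coalgebra.IsCocomm k U]
  [AddCommGroup U'] [Module k U'] [Coalgebra k U'] [Coalgebra.IsCocomm k U']

/-- Homomorphisms of unital bialgebras. -/
structure Hom (B : NonAssocBialgebra k U) (B' : NonAssocBialgebra k U') extends U →ₗc[k] U' where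
  map_mul : ∀ u v, toCoalgHom (B.mul u v) = B'.mul (toCoalgHom u) (toCoalgHom v)
  map_one : toCoalgHom B.one = B'.one

/-- Isomorphisms of unital bialgebras. -/
structure Iso (B : NonAssocBialgebra k U) (B' : NonAssocBialgebra k U') extends U ≃ₗc[k] U' where
  map_mul : ∀ u v, toCoalgEquiv (B.mul u v) = B'.mul (toCoalgEquiv u) (toCoalgEquiv v)
  map_one : toCoalgEquiv B.one = B'.one

variable (B : NonAssocBialgebra k U)

/-- The space of primitive elements, `Δ(a) = a ⊗ 1 + 1 ⊗ a`. -/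
def prim : Submodule k U where
  carrier := {a | Coalgebra.comul (R := k) a = a ⊗ₜ[k] B.one + B.one ⊗ₜ[k] a}
  add_mem' {a b} ha hb := by
    simp only [Set.mem_ofPred_eq] at *
    rw [map_add, ha, hb, TensorProduct.add_tmul, TensorProduct.tmul_add]; abel
  zero_mem' := by simp
  smul_mem' r a ha := by
    simp only [Set.mem_ofPred_eq] at *
    rw [map_smul, ha, smul_add, TensorProduct.smul_tmul', TensorProduct.tmul_smul]

/-- Right multiplication `R_a : u ↦ u a`. -/
def rightMul (a : U) : Module.End k U := B.mul.flip a

/-- Connectedness: as a coalgebra with a distinguished element `1`, `U` is isomorphic to the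
symmetric algebra `k[V]` on the space `V` of primitive elements. -/
def IsConnected : Prop :=
  ∃ e : SymmetricAlgebra k B.prim ≃ₗc[k] U, e 1 = B.one

/-- The map `y ↦ ((x y₁) y₂ ⋯) y₍ₙ₎`; for `n = 0` it is `y ↦ ε(y) x`. -/
def iterMul (x : U) : ℕ → U →ₗ[k] U
  | 0 => (Coalgebra.counit (R := k) (A := U)).smulRight x
  | n + 1 => TensorProduct.lift (B.mul ∘ₗ iterMul x n) ∘ₗ Coalgebra.comul

/-- Right monoalternativity: `((x y₁) ⋯) y₍ₙ₎ = x ((y₁ y₂) ⋯ y₍ₙ₎)` for all `x`, `y` and `n ≥ 0`. -/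
def RightMonoalternative : Prop :=
  ∀ (n : ℕ) (x y : U), B.iterMul x n y = B.mul x (B.iterMul B.one n y)

/-- `𝔤(U)`: the endomorphisms `f` with `Δ(f(u)) = f(u₁) ⊗ u₂ + u₁ ⊗ f(u₂)`. -/
def g (_B : NonAssocBialgebra k U) : LieSubalgebra k (Module.End k U) where
  carrier := {f | ∀ u, Coalgebra.comul (R := k) (f u) =
    f.rTensor U (Coalgebra.comul u) + f.lTensor U (Coalgebra.comul u)}
  add_mem' {f f'} hf hf' u := by
    simp only [Set.mem_ofPred_eq] at *
    rw [LinearMap.add_apply, map_add, hf, hf', LinearMap.rTensor_add, LinearMap.lTensor_add,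
      LinearMap.add_apply, LinearMap.add_apply]
    abel
  zero_mem' u := by simp
  smul_mem' r f hf u := by
    simp only [Set.mem_ofPred_eq] at *
    rw [LinearMap.smul_apply, map_smul, hf, LinearMap.rTensor_smul, LinearMap.lTensor_smul,
      LinearMap.smul_apply, LinearMap.smul_apply, smul_add]
  lie_mem' {f f'} hf hf' := by
    intro u
    have key : ∀ (p q : Module.End k U) (t : U ⊗[k] U),
        p.rTensor U (q.rTensor U t + q.lTensor U t) + p.lTensor U (q.rTensor U t + q.lTensor U t) -
          (q.rTensor U (p.rTensor U t + p.lTensor U t) +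
            q.lTensor U (p.rTensor U t + p.lTensor U t)) =
        (p * q - q * p).rTensor U t + (p * q - q * p).lTensor U t := by
      intro p q t
      induction t with
      | zero => simp
      | tmul a b =>
        simp only [map_add, LinearMap.rTensor_tmul, LinearMap.lTensor_tmul, LinearMap.sub_apply,
          Module.End.mul_apply, TensorProduct.sub_tmul, TensorProduct.tmul_sub]
        abel
      | add a b ha hb =>
        have := congrArg₂ (· + ·) ha hb
        simp only [map_add] at this ⊢
        rw [← sub_eq_zero] at this ⊢
        rw [← this]
        abel
    rw [LieRing.of_associative_ring_bracket, ← key f f', LinearMap.sub_apply, map_sub,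
      Module.End.mul_apply, Module.End.mul_apply, hf, hf', hf', hf]

theorem mem_g {f : Module.End k U} : f ∈ B.g ↔ ∀ u, Coalgebra.comul (R := k) (f u) =
    f.rTensor U (Coalgebra.comul u) + f.lTensor U (Coalgebra.comul u) := Iff.rfl

theorem rightMul_mem_g {a : U} (ha : a ∈ B.prim) : B.rightMul a ∈ B.g := by
  intro u
  have ha' : Coalgebra.comul (R := k) a = a ⊗ₜ[k] B.one + B.one ⊗ₜ[k] a := ha
  change Coalgebra.comul (R := k) (B.mul u a) = _
  rw [B.comul_mul, ha', map_add]
  generalize Coalgebra.comul (R := k) u = t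
  induction t with
  | zero => simp
  | tmul x y => simp [rightMul, B.mul_one]
  | add x y hx hy =>
    have := congrArg₂ (· + ·) hx hy
    simp only [map_add, LinearMap.add_apply] at this ⊢
    rw [← sub_eq_zero] at this ⊢
    rw [← this]
    abel

theorem apply_one_mem_prim {f : Module.End k U} (hf : f ∈ B.g) : f B.one ∈ B.prim := by
  have := hf B.one
  rw [B.comul_one] at this
  exact this

/-- The triple `T(U) = (𝔤(U), 𝔰(U), 𝔠(U))` with `𝔰(U) = {f ∈ 𝔤(U) | f(1) = 0}` and
`𝔠(U) = {R_a | a primitive}`. -/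
def triple : Triple k B.g where
  s :=
    { carrier := {f | f.1 B.one = 0}
      add_mem' := fun {f f'} hf hf' => by
        simp only [Set.mem_ofPred_eq] at *
        simp [hf, hf']
      zero_mem' := by simp
      smul_mem' := fun r f hf => by
        simp only [Set.mem_ofPred_eq] at *
        simp [hf]
      lie_mem' := fun {f f'} hf hf' => by
        change f.1 B.one = 0 at hf
        change f'.1 B.one = 0 at hf'
        change f.1 (f'.1 B.one) - f'.1 (f.1 B.one) = 0
        simp [hf, hf'] }
  c :=
    { carrier := {f | ∃ a ∈ B.prim, f.1 = B.rightMul a}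
      add_mem' := by
        rintro f f' ⟨a, ha, hf⟩ ⟨a', ha', hf'⟩
        exact ⟨a + a', add_mem ha ha', by simp [hf, hf', rightMul]⟩
      zero_mem' := ⟨0, zero_mem _, by simp [rightMul]⟩
      smul_mem' := by
        rintro r f ⟨a, ha, hf⟩
        exact ⟨r • a, B.prim.smul_mem r ha, by simp [hf, rightMul]⟩ }
  isCompl := by
    refine ⟨?_, ?_⟩
    · rw [Submodule.disjoint_def]
      rintro f hs ⟨a, ha, hf⟩
      change f.1 B.one = 0 at hs
      rw [hf] at hs
      have h0 : a = 0 := by simpa [rightMul, B.one_mul] using hs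
      apply Subtype.ext
      rw [hf, h0]
      simp [rightMul]
    · rw [codisjoint_iff, Submodule.eq_top_iff']
      intro f
      have hp := B.apply_one_mem_prim f.2
      let r : B.g := ⟨B.rightMul (f.1 B.one), B.rightMul_mem_g hp⟩
      refine Submodule.mem_sup.2 ⟨f - r, ?_, r, ⟨_, hp, rfl⟩, by simp⟩
      change f.1 B.one - B.mul B.one (f.1 B.one) = 0
      rw [B.one_mul, sub_self]

end

end NonAssocBialgebra

/-- A non-associative Hopf algebra structure on a (coassociative, cocommutative) coalgebra: a unital
bialgebra with a left division `u \ v = ldiv u v` and a right division `u / v = rdiv u v`. -/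
structure NonAssocHopfAlgebra (k U : Type*) [Field k] [AddCommGroup U] [Module k U]
    [Coalgebra k U] [Coalgebra.IsCocomm k U] extends NonAssocBialgebra k U where
  /-- the left division -/
  ldiv : U →ₗ[k] U →ₗ[k] U
  /-- the right division -/
  rdiv : U →ₗ[k] U →ₗ[k] U
  /-- `u₁ \ (u₂ v) = ε(u) v` -/
  ldiv_mul : ∀ u v, TensorProduct.lift (ldiv.compl₂ (mul.flip v)) (Coalgebra.comul (R := k) u) =
    Coalgebra.counit (R := k) u • v
  /-- `u₁ (u₂ \ v) = ε(u) v` -/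
  mul_ldiv : ∀ u v, TensorProduct.lift (mul.compl₂ (ldiv.flip v)) (Coalgebra.comul (R := k) u) =
    Coalgebra.counit (R := k) u • v
  /-- `(u v₁) / v₂ = ε(v) u` -/
  mul_rdiv : ∀ u v, TensorProduct.lift (rdiv ∘ₗ mul u) (Coalgebra.comul (R := k) v) =
    Coalgebra.counit (R := k) v • u
  /-- `(u / v₁) v₂ = ε(v) u` -/
  rdiv_mul : ∀ u v, TensorProduct.lift (mul ∘ₗ rdiv u) (Coalgebra.comul (R := k) v) =
    Coalgebra.counit (R := k) v • u

/-! ### The coalgebra `U(𝔤) / U(𝔤)𝔰` -/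

namespace Triple

section

variable {k 𝔤 : Type*} [Field k] [LieRing 𝔤] [LieAlgebra k 𝔤] (τ : Triple k 𝔤)

/-- The left ideal `U(𝔤)𝔰` of `U(𝔤)`. -/
def leftIdeal : Submodule (UniversalEnvelopingAlgebra k 𝔤) (UniversalEnvelopingAlgebra k 𝔤) :=
  Submodule.span _ (UniversalEnvelopingAlgebra.ι k '' (τ.s : Set 𝔤))

instance isCoideal_leftIdeal : (τ.leftIdeal.restrictScalars k).IsCoideal where
  counit_eq_zero x hx := by
    rw [Submodule.restrictScalars_mem, leftIdeal] at hx
    induction hx using Submodule.span_induction with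
    | mem x h =>
      obtain ⟨d, -, rfl⟩ := h
      exact UniversalEnvelopingAlgebra.counit_ι d
    | zero => simp
    | add x y _ _ hx hy => simp [hx, hy]
    | smul a x _ hx => simp [hx]
  map_mkQ_comul_eq_zero x hx := by
    rw [Submodule.restrictScalars_mem, leftIdeal] at hx
    set π := (τ.leftIdeal.restrictScalars k).mkQ with hπ
    have mul_zero' : ∀ d ∈ τ.s, ∀ a, π (a * UniversalEnvelopingAlgebra.ι k d) = 0 := by
      intro d hd a
      rw [hπ, Submodule.mkQ_apply, Submodule.Quotient.mk_eq_zero, Submodule.restrictScalars_mem]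
      exact τ.leftIdeal.smul_mem a (Submodule.subset_span ⟨d, hd, rfl⟩)
    suffices H : ∀ a, TensorProduct.map π π (Coalgebra.comul (R := k) (a * x)) = 0 by
      simpa using H 1
    induction hx using Submodule.span_induction with
    | mem x h =>
      obtain ⟨d, hd, rfl⟩ := h
      intro a
      rw [Bialgebra.comul_mul, UniversalEnvelopingAlgebra.comul_ι]
      generalize Coalgebra.comul (R := k) a = t
      induction t with
      | zero => simp
      | tmul p q =>
        simp only [mul_add, Algebra.TensorProduct.tmul_mul_tmul, map_add, TensorProduct.map_tmul,
          mul_zero' d hd, TensorProduct.zero_tmul, TensorProduct.tmul_zero, add_zero]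
      | add p q hp hq => rw [add_mul, map_add, hp, hq, add_zero]
    | zero => simp
    | add x y _ _ hx hy => intro a; rw [mul_add, map_add, map_add, hx, hy, add_zero]
    | smul b x _ hx => intro a; rw [smul_eq_mul, ← mul_assoc]; exact hx _

/-- The left `U(𝔤)`-module `U_τ = U(𝔤) / U(𝔤)𝔰`. -/
abbrev Env : Type _ := UniversalEnvelopingAlgebra k 𝔤 ⧸ τ.leftIdeal

/-- The quotient coalgebra structure on `U_τ`. -/
instance instCoalgebraEnv : Coalgebra k τ.Env :=
  inferInstanceAs (Coalgebra k (UniversalEnvelopingAlgebra k 𝔤 ⧸ τ.leftIdeal.restrictScalars k))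

/-- The class `ū` in `U_τ` of an element `u` of `U(𝔤)`. -/
def cls : UniversalEnvelopingAlgebra k 𝔤 →ₗ[k] τ.Env := (τ.leftIdeal.mkQ).restrictScalars k

theorem counit_cls (u : UniversalEnvelopingAlgebra k 𝔤) :
    Coalgebra.counit (R := k) (τ.cls u) = Coalgebra.counit (R := k) u := rfl

theorem comul_cls (u : UniversalEnvelopingAlgebra k 𝔤) :
    Coalgebra.comul (R := k) (τ.cls u) = TensorProduct.map τ.cls τ.cls (Coalgebra.comul u) := rfl

instance instIsCocommEnv : Coalgebra.IsCocomm k τ.Env where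
  comm_comp_comul := by
    refine LinearMap.ext fun x => ?_
    obtain ⟨u, rfl⟩ := Submodule.Quotient.mk_surjective _ x
    change TensorProduct.comm k _ _ (Coalgebra.comul (R := k) (τ.cls u)) =
      Coalgebra.comul (R := k) (τ.cls u)
    rw [comul_cls, ← TensorProduct.map_comm, Coalgebra.comm_comul]

/-- The product on `U_τ`:
`ū · ∑_σ [c_{σ(1)} ⋯ c_{σ(n)}] = ∑_σ [c_{σ(n)} ⋯ c_{σ(1)} u]` for all `n ≥ 0`, all
`c₁, …, cₙ ∈ 𝔠` and all `u ∈ U(𝔤)`, where `[·]` denotes the class in `U_τ` and `σ` runs over the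
permutations of the `n` indices. -/
def IsProduct (μ : τ.Env →ₗ[k] τ.Env →ₗ[k] τ.Env) : Prop :=
  ∀ (n : ℕ) (c : Fin n → τ.c) (u : UniversalEnvelopingAlgebra k 𝔤),
    μ (τ.cls u) (∑ σ : Equiv.Perm (Fin n),
        τ.cls (List.ofFn fun i => UniversalEnvelopingAlgebra.ι k (c (σ i) : 𝔤)).prod) =
      ∑ σ : Equiv.Perm (Fin n),
        τ.cls ((List.ofFn fun i => UniversalEnvelopingAlgebra.ι k (c (σ i) : 𝔤)).reverse.prod * u)

end

end Triple

end

/-! Everything rests on one isomorphism of coalgebras, the symmetrization `k[𝔠] → U_τ` that sends `c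
^ n` to the class `[c ^ n]` (`cls_symmetrize_bijective`, `envEquiv`). Its bijectivity is the
Poincaré–Birkhoff–Witt theorem relative to `𝔰`: `𝔤` acts on polynomials in an ordered basis of `𝔠`,
with `𝔰` killing `1` and each basis element multiplying a monomial by its variable whenever that
variable is least. This action makes `pbwCoord` and `orderedCls` mutually inverse, and
symmetrization differs from the ordered basis only in lower degree.

In characteristic zero, polarization shows that the classes `[c ^ n]` span `U_τ`, so linear
identities are checked on them alone. The product formula amounts to `ū [c ^ n] = [c ^ n u]`: right
multiplication by `[c ^ n]` is the `n`-th power of the left action of `c`. This determines the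
product. As the left action of `𝔤` consists of coderivations, both `n ↦ [c ^ n]` and these powers
obey the binomial coproduct rule, which gives the bialgebra axioms. The divisions are the inverses
of left and right multiplication in the convolution algebra `Hom(U_τ, End U_τ)`; they exist as
locally finite geometric series because multiplication by the grouplike element `1` is the identity
(`isUnit_conv_of_isBinomial`).

For the universal property, a morphism `τ → T(U')` is a representation of `𝔤` on `U'` in which `𝔰`
kills `1`, hence a map `U_τ → U'`. It is multiplicative because right monoalternativity forces `x ·
R_a ^ n (1) = R_a ^ n (x)` for primitive `a` (`RightMonoalternative.pow_rightMul_apply`).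

For the classification, the key notion is a morphism bijective on `𝔠`. Such a morphism yields both
an equivalence of triples (`Hom.BijectiveOnC.equivalent`) and an isomorphism of bialgebras
(`Hom.BijectiveOnC.nonempty_iso`). The maps `τ_inn → τ`, `τ_inn → τ_red` and `ι : τ → T(U_τ)` are
all of this kind. -/

noncomputable section


/-! ### Polarization -/

/-- The polarization identity in a (possibly noncommutative) ring. -/
theorem sum_perm_prod_ofFn {A : Type*} [Ring A] {n : ℕ} (c : Fin n → A) :
    ∑ σ : Equiv.Perm (Fin n), (List.ofFn fun i => c (σ i)).prod =
      ∑ T : Finset (Fin n), (-1 : ℤ) ^ T.card • (∑ i ∈ Tᶜ, c i) ^ n := by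
  -- The condition on `r` says that its values avoid `T`. Stated as `T ⊆ (image r)ᶜ`, it turns the
  -- exchanged sum into an alternating sum over the subsets of `(image r)ᶜ`, which vanishes unless
  -- `r` is surjective.
  have hpow : ∀ T : Finset (Fin n), (∑ i ∈ Tᶜ, c i) ^ n =
      ∑ r : Fin n → Fin n, if T ⊆ (Finset.univ.image r)ᶜ then
        (List.ofFn fun i => c (r i)).prod else 0 := by
    intro T
    have h := (MultilinearMap.mkPiAlgebraFin ℤ n A).map_sum_finset (fun _ i => c i) (fun _ => Tᶜ)
    simp only [MultilinearMap.mkPiAlgebraFin_apply] at h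
    rw [List.ofFn_const, List.prod_replicate] at h
    rw [h, ← Finset.sum_filter]
    refine Finset.sum_congr ?_ fun _ _ => rfl
    ext r
    simp only [Fintype.mem_piFinset, Finset.mem_compl, Finset.mem_filter, Finset.mem_univ, true_and,
      Finset.subset_iff, Finset.mem_image, not_exists]
    exact ⟨fun h x hx a ha => h a (ha ▸ hx), fun h a ha => h ha a rfl⟩
  simp only [hpow, Finset.smul_sum, smul_ite, smul_zero]
  rw [Finset.sum_comm]
  have hinner : ∀ r : Fin n → Fin n,
      (∑ T : Finset (Fin n), if T ⊆ (Finset.univ.image r)ᶜ then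
        (-1 : ℤ) ^ T.card • (List.ofFn fun i => c (r i)).prod else 0) =
      if Function.Bijective r then (List.ofFn fun i => c (r i)).prod else 0 := by
    intro r
    rw [← Finset.sum_filter, ← Finset.sum_smul]
    have : (Finset.univ.filter fun T => T ⊆ (Finset.univ.image r)ᶜ) =
        ((Finset.univ.image r)ᶜ).powerset := by ext; simp
    rw [this, Finset.sum_powerset_neg_one_pow_card]
    have hiff : (Finset.univ.image r)ᶜ = ∅ ↔ Function.Bijective r := by
      rw [Finset.compl_eq_empty_iff, ← Finite.surjective_iff_bijective, ← Finset.coe_inj]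
      simp [Set.range_eq_univ]
    simp only [hiff]
    split_ifs <;> simp
  simp only [hinner]
  rw [← Finset.sum_filter]
  refine Finset.sum_bij (fun σ _ => ⇑σ) (fun σ _ => Finset.mem_filter.2 ⟨Finset.mem_univ _, σ.bijective⟩)
    (fun σ _ σ' _ h => DFunLike.coe_injective h) (fun r hr => ?_) fun _ _ => rfl
  exact ⟨Equiv.ofBijective r (by simpa using hr), Finset.mem_univ _, rfl⟩

/-- In a commutative algebra over a field of characteristic zero, a product of `n` elements of a
subspace is a linear combination of `n`-th powers of elements of this subspace. -/
theorem prod_mem_span_pow {k A : Type*} [Field k] [CharZero k] [CommRing A] [Algebra k A]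
    (V : Submodule k A) {n : ℕ} (c : Fin n → A) (hc : ∀ i, c i ∈ V) :
    ∏ i, c i ∈ Submodule.span k ((· ^ n) '' (V : Set A)) := by
  have h := sum_perm_prod_ofFn c
  -- By commutativity all `n!` permuted products agree, and `n!` is invertible.
  have hl : ∀ σ : Equiv.Perm (Fin n), (List.ofFn fun i => c (σ i)).prod = ∏ i, c i := by
    intro σ
    rw [List.prod_ofFn, Equiv.prod_comp σ c]
  simp only [hl, Finset.sum_const, Finset.card_univ, Fintype.card_perm, Fintype.card_fin] at h
  have hn : (n.factorial : k) ≠ 0 := Nat.cast_ne_zero.2 n.factorial_ne_zero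
  rw [← Nat.cast_smul_eq_nsmul k] at h
  rw [← inv_smul_smul₀ hn (∏ i, c i), h]
  refine Submodule.smul_mem _ _ (Submodule.sum_mem _ fun T _ => zsmul_mem ?_ _)
  exact Submodule.subset_span ⟨_, Submodule.sum_mem _ fun i _ => hc i, rfl⟩

/-! ### Coderivations and sequences of binomial type -/

namespace Coalgebra

section

variable {k C D A : Type*} [Field k] [AddCommGroup C] [Module k C] [Coalgebra k C]
  [AddCommGroup D] [Module k D] [Coalgebra k D] [Ring A] [Algebra k A]

/-- Coderivations of a coalgebra: `Δ(f(u)) = f(u₁) ⊗ u₂ + u₁ ⊗ f(u₂)`. -/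
def IsCoderivation (f : Module.End k C) : Prop :=
  ∀ u, comul (R := k) (f u) = f.rTensor C (comul u) + f.lTensor C (comul u)

/-- Applying `id ⊗ ε` to the coderivation identity leaves `u₁ ⊗ ε(f(u₂)) = 0`; then `ε` on the first
factor gives the claim. -/
theorem IsCoderivation.counit_apply {f : Module.End k C} (hf : IsCoderivation f) (u : C) :
    counit (R := k) (f u) = 0 := by
  have h := congrArg ((counit (R := k) (A := C)).lTensor C) (hf u)
  have hcomm : ∀ (a : C →ₗ[k] k) (b : Module.End k C) (t : C ⊗[k] C),
      a.lTensor C (b.rTensor C t) = b.rTensor k (a.lTensor C t) := fun a b t => by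
    rw [← LinearMap.comp_apply, ← LinearMap.comp_apply, LinearMap.lTensor_comp_rTensor,
      LinearMap.rTensor_comp_lTensor]
  rw [map_add, lTensor_counit_comul, hcomm, lTensor_counit_comul, LinearMap.rTensor_tmul,
    left_eq_add] at h
  have h2 := congrArg ((counit (R := k) (A := C)).rTensor k) h
  rw [map_zero, ← LinearMap.lTensor_comp_apply, ← LinearMap.comp_apply,
    LinearMap.rTensor_comp_lTensor, ← LinearMap.lTensor_comp_rTensor, LinearMap.comp_apply,
    rTensor_counit_comul, LinearMap.lTensor_tmul] at h2
  simpa using congrArg (TensorProduct.lid k k) h2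

/-- Sequences of binomial type, `Δ(pₙ) = ∑ binom(n, i) pᵢ ⊗ pₙ₋ᵢ`. -/
structure IsBinomial (p : ℕ → C) : Prop where
  comul_apply : ∀ n, comul (R := k) (p n) =
    ∑ ij ∈ Finset.HasAntidiagonal.antidiagonal n, n.choose ij.1 • p ij.1 ⊗ₜ[k] p ij.2
  counit_apply : ∀ n, counit (R := k) (p n) = if n = 0 then 1 else 0

/-- The operators `f ⊗ 1` and `1 ⊗ f` commute, so the binomial theorem applies to the powers of
their sum. -/
theorem IsCoderivation.comul_pow {f : Module.End k C} (hf : IsCoderivation f) (n : ℕ) (x : C) :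
    comul (R := k) ((f ^ n) x) = ∑ ij ∈ Finset.HasAntidiagonal.antidiagonal n,
      n.choose ij.1 • _root_.TensorProduct.map (f ^ ij.1) (f ^ ij.2) (comul x) := by
  have hcomm : Commute (f.rTensor C : Module.End k (C ⊗[k] C)) (f.lTensor C) := by
    change _ ∘ₗ _ = _ ∘ₗ _
    rw [LinearMap.lTensor_comp_rTensor, LinearMap.rTensor_comp_lTensor]
  have hpow : ∀ m, comul (R := k) ((f ^ m) x) =
      ((f.rTensor C + f.lTensor C : Module.End k (C ⊗[k] C)) ^ m) (comul x) := by
    intro m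
    induction m with
    | zero => simp
    | succ m ih =>
      rw [pow_succ', pow_succ', Module.End.mul_apply, Module.End.mul_apply, hf, ih]
      rfl
  rw [hpow, hcomm.add_pow', LinearMap.sum_apply]
  refine Finset.sum_congr rfl fun ij _ => ?_
  rw [LinearMap.smul_apply, Module.End.mul_apply, LinearMap.lTensor_pow, LinearMap.rTensor_pow,
    ← LinearMap.comp_apply, LinearMap.rTensor_comp_lTensor]

theorem IsCoderivation.comul_pow_apply {f : Module.End k C} (hf : IsCoderivation f) {c : C}
    (hc : comul (R := k) c = c ⊗ₜ[k] c) (n : ℕ) : comul (R := k) ((f ^ n) c) =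
    ∑ ij ∈ Finset.HasAntidiagonal.antidiagonal n,
      n.choose ij.1 • (f ^ ij.1) c ⊗ₜ[k] (f ^ ij.2) c := by
  simp only [hf.comul_pow, hc, _root_.TensorProduct.map_tmul]

theorem IsCoderivation.isBinomial {f : Module.End k C} (hf : IsCoderivation f) {c : C}
    (hc : comul (R := k) c = c ⊗ₜ[k] c) (hc' : counit (R := k) c = 1) :
    IsBinomial (k := k) fun n => (f ^ n) c where
  comul_apply := hf.comul_pow_apply hc
  counit_apply
    | 0 => by simpa
    | n + 1 => by rw [pow_succ', Module.End.mul_apply, hf.counit_apply, if_neg n.succ_ne_zero]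

/-- Linear maps that match spanning families of sequences of binomial type are morphisms of
coalgebras. -/
def coalgHomOfIsBinomial {I : Type*} (p : I → ℕ → C) (q : I → ℕ → D)
    (hp : ∀ i, IsBinomial (k := k) (p i)) (hq : ∀ i, IsBinomial (k := k) (q i))
    (hspan : Submodule.span k (Set.range fun x : I × ℕ => p x.1 x.2) = ⊤)
    (φ : C →ₗ[k] D) (hφ : ∀ i n, φ (p i n) = q i n) : C →ₗc[k] D :=
  { φ with
    counit_comp := LinearMap.ext_on hspan (by
      rintro _ ⟨⟨i, n⟩, rfl⟩
      rw [LinearMap.comp_apply, hφ, (hp i).counit_apply, (hq i).counit_apply])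
    map_comp_comul := LinearMap.ext_on hspan (by
      rintro _ ⟨⟨i, n⟩, rfl⟩
      rw [LinearMap.comp_apply, LinearMap.comp_apply, hφ, (hp i).comul_apply, (hq i).comul_apply,
        map_sum]
      exact Finset.sum_congr rfl fun ij _ => by rw [map_nsmul, _root_.TensorProduct.map_tmul, hφ, hφ]) }

/-! ### Exponentials and inverses in convolution algebras -/

open WithConv in
theorem IsBinomial.conv_mul_apply {p : ℕ → C} (hp : IsBinomial (k := k) p)
    (f g : WithConv (C →ₗ[k] A)) (n : ℕ) :
    (f * g) (p n) = ∑ ij ∈ Finset.HasAntidiagonal.antidiagonal n, n.choose ij.1 • (f (p ij.1) * g (p ij.2)) := by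
  rw [LinearMap.convMul_apply, hp.comul_apply, map_sum, map_sum]
  exact Finset.sum_congr rfl fun ij _ => by
    rw [map_nsmul, map_nsmul, _root_.TensorProduct.map_tmul, LinearMap.mul'_apply]

/-- When `m < n` is split into `n` indices, one of them is `0`, and `f` kills `p 0`. -/
theorem IsBinomial.conv_pow_apply_eq_zero {p : ℕ → C} (hp : IsBinomial (k := k) p)
    {f : WithConv (C →ₗ[k] A)} (hf : f (p 0) = 0) {m n : ℕ} (h : m < n) : (f ^ n) (p m) = 0 := by
  induction n generalizing m with
  | zero => omega
  | succ n ih =>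
    rw [pow_succ', hp.conv_mul_apply]
    refine Finset.sum_eq_zero fun ij hij => ?_
    rw [Finset.HasAntidiagonal.mem_antidiagonal] at hij
    rcases Nat.eq_zero_or_pos ij.1 with h0 | h0
    · rw [h0, hf, zero_mul, smul_zero]
    · rw [ih (by omega), mul_zero, smul_zero]

/-- A pointwise finite sum of linear maps. -/
theorem _root_.LinearMap.exists_eq_finsum {M N : Type*} [AddCommGroup M] [Module k M]
    [AddCommGroup N] [Module k N] (h : ℕ → M →ₗ[k] N) (s : Set M) (hs : Submodule.span k s = ⊤)
    (hfin : ∀ x ∈ s, (Function.support fun n => h n x).Finite) :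
    ∃ g : M →ₗ[k] N, ∀ x, g x = ∑ᶠ n, h n x := by
  have hall : ∀ x, (Function.support fun n => h n x).Finite := by
    intro x
    have hx : x ∈ Submodule.span k s := hs ▸ Submodule.mem_top
    induction hx using Submodule.span_induction with
    | mem x hx => exact hfin x hx
    | zero => simp
    | add x y _ _ hx hy =>
      refine (hx.union hy).subset fun n hn => ?_
      by_contra hcon
      simp only [Set.mem_union, Function.mem_support, not_or, not_not] at hcon hn
      exact hn (by rw [map_add, hcon.1, hcon.2, add_zero])
    | smul a x _ hx =>
      refine hx.subset fun n hn hcon => hn ?_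
      change h n (a • x) = 0
      rw [map_smul, show h n x = 0 from hcon, smul_zero]
  refine ⟨⟨⟨fun x => ∑ᶠ n, h n x, fun x y => ?_⟩, fun a x => ?_⟩, fun x => rfl⟩
  · simp only [map_add]
    exact finsum_add_distrib (hall x) (hall y)
  · simp only [map_smul, RingHom.id_apply]
    exact (smul_finsum a _).symm

/-- The convolution exponential of a linear map that only sees the first terms of sequences of
binomial type. -/
theorem exists_linearMap_apply_eq_pow [CharZero k] {I : Type*} (p : I → ℕ → C)
    (hp : ∀ i, IsBinomial (k := k) (p i))
    (hspan : Submodule.span k (Set.range fun x : I × ℕ => p x.1 x.2) = ⊤)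
    (f : C →ₗ[k] A) (hf : ∀ i n, n ≠ 1 → f (p i n) = 0) :
    ∃ g : C →ₗ[k] A, ∀ i n, g (p i n) = f (p i 1) ^ n := by
  have hpow : ∀ i m n, (WithConv.toConv f ^ m) (p i n) =
      if n = m then (m.factorial : k) • f (p i 1) ^ n else 0 := by
    intro i m
    induction m with
    | zero =>
      intro n
      rw [pow_zero, LinearMap.convOne_apply, (hp i).counit_apply]
      by_cases h : n = 0 <;> simp [h]
    | succ m ih =>
      intro n
      rw [pow_succ', (hp i).conv_mul_apply]
      rcases n with _ | n
      · rw [Finset.Nat.antidiagonal_zero, Finset.sum_singleton]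
        change _ • (f (p i 0) * _) = _
        rw [hf i 0 zero_ne_one, zero_mul, smul_zero, if_neg m.succ_ne_zero.symm]
      -- Only the term with `p i 1` in the first factor survives; its coefficient `n + 1` turns `m!`
      -- into `(m + 1)!` when `n = m`.
      · rw [Finset.sum_eq_single (1, n)]
        · rw [ih]
          change _ • (f (p i 1) * _) = _
          by_cases h : n = m
          · subst h
            rw [if_pos rfl, if_pos rfl, pow_succ', Nat.choose_one_right, Nat.factorial_succ,
              mul_smul_comm, ← Nat.cast_smul_eq_nsmul k, smul_smul, Nat.cast_mul]
          · rw [if_neg h, if_neg (by omega), mul_zero, smul_zero]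
        · rintro ⟨a, b⟩ hab hne
          rw [Finset.HasAntidiagonal.mem_antidiagonal] at hab
          change _ • (f (p i a) * _) = _
          rw [hf i a (fun h => hne (by simp only [Prod.mk.injEq]; omega)), zero_mul, smul_zero]
        · intro h
          exact absurd (Finset.HasAntidiagonal.mem_antidiagonal.2 (add_comm 1 n)) h
  -- This is the exponential series `∑ f ^ m / m!`; on `p i n` only the term `m = n` is nonzero.
  obtain ⟨g, hg⟩ := LinearMap.exists_eq_finsum
    (fun m => (m.factorial : k)⁻¹ • (WithConv.toConv f ^ m).ofConv) _ hspan (by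
      rintro _ ⟨⟨i, n⟩, rfl⟩
      refine (Set.finite_singleton n).subset fun m hm => ?_
      by_contra hne
      refine hm ?_
      change ((m.factorial : k)⁻¹ • (WithConv.toConv f ^ m).ofConv) (p i n) = 0
      rw [LinearMap.smul_apply]
      change _ • (WithConv.toConv f ^ m) (p i n) = 0
      rw [hpow, if_neg (fun h => hne h.symm), smul_zero])
  refine ⟨g, fun i n => ?_⟩
  rw [hg, finsum_eq_single _ n]
  · rw [LinearMap.smul_apply]
    change _ • (WithConv.toConv f ^ n) (p i n) = _
    rw [hpow, if_pos rfl, inv_smul_smul₀ (Nat.cast_ne_zero.2 n.factorial_ne_zero)]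
  · intro m hm
    rw [LinearMap.smul_apply]
    change _ • (WithConv.toConv f ^ m) (p i n) = 0
    rw [hpow, if_neg hm.symm, smul_zero]

/-- With `h = 1 - f`, the geometric series `∑ h ^ m` is pointwise finite because `h` kills every `p
i 0`. The algebra `A` may be noncommutative, so both one-sided inverse laws are checked. -/
theorem isUnit_conv_of_isBinomial {I : Type*} (p : I → ℕ → C)
    (hp : ∀ i, IsBinomial (k := k) (p i))
    (hspan : Submodule.span k (Set.range fun x : I × ℕ => p x.1 x.2) = ⊤)
    (f : WithConv (C →ₗ[k] A)) (hf : ∀ i, f (p i 0) = 1) : IsUnit f := by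
  set h := 1 - f with hh
  have h0 : ∀ i, h (p i 0) = 0 := by
    intro i
    change (1 : WithConv (C →ₗ[k] A)) (p i 0) - f (p i 0) = 0
    rw [hf, LinearMap.convOne_apply, (hp i).counit_apply, if_pos rfl, map_one, sub_self]
  obtain ⟨g, hg⟩ := LinearMap.exists_eq_finsum (fun m => (h ^ m).ofConv) _ hspan (by
      rintro _ ⟨⟨i, n⟩, rfl⟩
      refine (Set.finite_Iic n).subset fun m hm => ?_
      by_contra hne
      exact hm ((hp i).conv_pow_apply_eq_zero (h0 i) (not_le.1 hne)))
  -- Up to index `n` the series equals its partial sum of length `n + 1`, and the finite geometric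
  -- identity leaves only the error `h ^ (n + 1)`, which vanishes on `p i n`.
  have hgp : ∀ i N n, n < N → g (p i n) = (∑ m ∈ Finset.range N, h ^ m) (p i n) := by
    intro i N n hn
    have hsum : ∀ N, (∑ m ∈ Finset.range N, h ^ m) (p i n) =
        ∑ m ∈ Finset.range N, (h ^ m) (p i n) := by
      intro N
      induction N with
      | zero => rfl
      | succ N ih =>
        rw [Finset.sum_range_succ, Finset.sum_range_succ, ← ih]
        rfl
    rw [hg, finsum_eq_sum_of_support_subset (s := Finset.range N)]
    · exact (hsum N).symm
    · intro m hm
      by_contra hne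
      refine hm ((hp i).conv_pow_apply_eq_zero (h0 i) ?_)
      simp only [Finset.coe_range, Set.mem_Iio, not_lt] at hne
      omega
  have hf' : f = 1 - h := by rw [hh, sub_sub_cancel]
  have key : ∀ i n, (1 : WithConv (C →ₗ[k] A)) (p i n) =
      (1 - h ^ (n + 1)) (p i n) := by
    intro i n
    change _ = (1 : WithConv (C →ₗ[k] A)) (p i n) - (h ^ (n + 1)) (p i n)
    rw [(hp i).conv_pow_apply_eq_zero (h0 i) n.lt_succ_self, sub_zero]
  refine ⟨⟨f, WithConv.toConv g, ?_, ?_⟩, rfl⟩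
  · refine WithConv.ofConv_injective (LinearMap.ext_on hspan ?_)
    rintro _ ⟨⟨i, n⟩, rfl⟩
    refine Eq.trans ?_ (key i n).symm
    rw [← mul_neg_geom_sum, ← hf']
    change (f * _) (p i n) = _
    rw [(hp i).conv_mul_apply, (hp i).conv_mul_apply]
    refine Finset.sum_congr rfl fun ij hij => ?_
    rw [← hgp i (n + 1) ij.2 (by rw [Finset.HasAntidiagonal.mem_antidiagonal] at hij; omega)]
  · refine WithConv.ofConv_injective (LinearMap.ext_on hspan ?_)
    rintro _ ⟨⟨i, n⟩, rfl⟩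
    refine Eq.trans ?_ (key i n).symm
    rw [← geom_sum_mul_neg, ← hf']
    change (_ * f) (p i n) = _
    rw [(hp i).conv_mul_apply, (hp i).conv_mul_apply]
    refine Finset.sum_congr rfl fun ij hij => ?_
    rw [← hgp i (n + 1) ij.1 (by rw [Finset.HasAntidiagonal.mem_antidiagonal] at hij; omega)]

end

end Coalgebra


namespace Coalgebra

/-- Powers of a primitive element of a bialgebra are of binomial type. -/
theorem isBinomial_pow {k A : Type*} [Field k] [Ring A] [Bialgebra k A] {x : A}
    (hx : comul (R := k) x = x ⊗ₜ[k] 1 + 1 ⊗ₜ[k] x) : IsBinomial (k := k) fun n => x ^ n := by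
  have hf : IsCoderivation (k := k) (LinearMap.mulLeft k x) := by
    intro u
    rw [LinearMap.mulLeft_apply, Bialgebra.comul_mul, hx]
    generalize comul (R := k) u = t
    induction t with
    | zero => simp
    | tmul a b => simp [add_mul]
    | add a b ha hb =>
      rw [mul_add, ha, hb, map_add, map_add]
      abel
  have h := hf.isBinomial (c := 1) (by rw [Bialgebra.comul_one, Algebra.TensorProduct.one_def])
    Bialgebra.counit_one
  have hpow : ∀ n, ((LinearMap.mulLeft k x) ^ n) 1 = x ^ n := by
    intro n
    rw [LinearMap.pow_mulLeft, LinearMap.mulLeft_apply, mul_one]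
  simpa only [hpow] using h

end Coalgebra

/-! ### Symmetric algebras in characteristic zero -/

namespace SymmetricAlgebra

section

variable {k V : Type*} [Field k] [AddCommGroup V] [Module k V]

theorem adjoin_range_ι : Algebra.adjoin k (Set.range (ι k V)) = ⊤ := by
  rw [eq_top_iff]
  rintro x -
  induction x using SymmetricAlgebra.induction with
  | algebraMap r => exact Subalgebra.algebraMap_mem _ r
  | ι x => exact Algebra.subset_adjoin ⟨x, rfl⟩
  | mul a b ha hb => exact mul_mem ha hb
  | add a b ha hb => exact add_mem ha hb

theorem isBinomial_ι_pow (v : V) : Coalgebra.IsBinomial (k := k) fun n => ι k V v ^ n :=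
  Coalgebra.isBinomial_pow (comul_ι k V v)

/-- Words in generators span, and polarization rewrites a word of length `n` through `n`-th powers.
-/
theorem span_ι_pow [CharZero k] :
    Submodule.span k (Set.range fun x : V × ℕ => ι k V x.1 ^ x.2) = ⊤ := by
  have h : Subalgebra.toSubmodule (Algebra.adjoin k (Set.range (ι k V))) = ⊤ := by
    rw [adjoin_range_ι, Algebra.top_toSubmodule]
  rw [Algebra.adjoin_eq_span] at h
  rw [eq_top_iff, ← h, Submodule.span_le]
  intro x hx
  obtain ⟨l, hl, rfl⟩ := Submonoid.exists_list_of_mem_closure hx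
  have hmem := prod_mem_span_pow (LinearMap.range (ι k V)) (fun i : Fin l.length => l.get i)
    (fun i => hl _ (l.get_mem i))
  rw [← List.prod_ofFn, List.ofFn_get] at hmem
  refine Submodule.span_mono ?_ hmem
  rintro _ ⟨_, ⟨v, rfl⟩, rfl⟩
  exact ⟨(v, _), rfl⟩

theorem linearMap_ext_pow [CharZero k] {M : Type*} [AddCommGroup M] [Module k M]
    {f g : SymmetricAlgebra k V →ₗ[k] M} (h : ∀ v n, f (ι k V v ^ n) = g (ι k V v ^ n)) : f = g :=
  LinearMap.ext_on span_ι_pow (by rintro _ ⟨⟨v, n⟩, rfl⟩; exact h v n)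

/-- The projection onto degree one is read off the algebra map to the square-zero extension `k ⊕ V`,
where all products of two elements of `V` vanish. -/
theorem exists_projection : ∃ π : SymmetricAlgebra k V →ₗ[k] V,
    ∀ v n, π (ι k V v ^ n) = if n = 1 then v else 0 := by
  -- The square-zero extension needs a right action of `k`; commutativity allows the left one to
  -- serve.
  let _ : Module kᵐᵒᵖ V := Module.compHom V ((RingHom.id k).fromOpposite mul_comm)
  have _ : IsCentralScalar k V := ⟨fun m x => rfl⟩
  refine ⟨TrivSqZeroExt.sndHom k V ∘ₗ (lift (TrivSqZeroExt.inrHom k V)).toLinearMap,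
    fun v n => ?_⟩
  have h : (lift (TrivSqZeroExt.inrHom k V)) (ι k V v ^ n) = TrivSqZeroExt.inr v ^ n := by
    rw [map_pow, lift_ι_apply]
    rfl
  rw [LinearMap.comp_apply, AlgHom.toLinearMap_apply, h]
  rcases n with _ | _ | n
  · simp
  · simp
  · rw [pow_succ, pow_succ, mul_assoc, TrivSqZeroExt.inr_mul_inr, mul_zero]
    simp

/-- The operator `δ` (coproduct followed by product) scales `v ^ n` by `2 ^ n` and a primitive
element by `2`. In characteristic zero `2 ^ n = 2` forces `n = 1`. -/
theorem mem_range_ι_of_comul_eq [CharZero k] {p : SymmetricAlgebra k V}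
    (hp : Coalgebra.comul (R := k) p = p ⊗ₜ[k] 1 + 1 ⊗ₜ[k] p) : p ∈ LinearMap.range (ι k V) := by
  let δ : Module.End k (SymmetricAlgebra k V) :=
    ((Algebra.TensorProduct.lmul' k).comp (Bialgebra.comulAlgHom k _)).toLinearMap
  have hδ : ∀ v n, δ (ι k V v ^ n) = (2 : k) ^ n • ι k V v ^ n := by
    intro v n
    change ((Algebra.TensorProduct.lmul' k).comp (Bialgebra.comulAlgHom k _)) _ = _
    rw [map_pow, ← smul_pow]
    congr 1
    change Algebra.TensorProduct.lmul' k (Coalgebra.comul (R := k) (ι k V v)) = _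
    rw [comul_ι, map_add, Algebra.TensorProduct.lmul'_apply_tmul,
      Algebra.TensorProduct.lmul'_apply_tmul, mul_one, one_mul, two_smul]
  have hδp : δ p = (2 : k) • p := by
    change Algebra.TensorProduct.lmul' k (Coalgebra.comul (R := k) p) = _
    rw [hp, map_add, Algebra.TensorProduct.lmul'_apply_tmul,
      Algebra.TensorProduct.lmul'_apply_tmul, mul_one, one_mul, two_smul]
  have hmem : p ∈ LinearMap.range (ι k V) ⊔ ⨆ μ ≠ (2 : k), δ.eigenspace μ := by
    have hle : Submodule.span k (Set.range fun x : V × ℕ => ι k V x.1 ^ x.2) ≤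
        LinearMap.range (ι k V) ⊔ ⨆ μ ≠ (2 : k), δ.eigenspace μ := by
      rw [Submodule.span_le]
      rintro _ ⟨⟨v, n⟩, rfl⟩
      by_cases hn : n = 1
      · subst hn
        exact Submodule.mem_sup_left ⟨v, (pow_one _).symm⟩
      · refine Submodule.mem_sup_right ?_
        have h2 : (2 : k) ^ n ≠ 2 := by
          intro h
          have h' : (2 : ℕ) ^ n = 2 ^ 1 := by exact_mod_cast h
          exact hn (Nat.pow_right_injective le_rfl h')
        exact Submodule.mem_iSup_of_mem _ (Submodule.mem_iSup_of_mem h2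
          (Module.End.mem_eigenspace_iff.2 (hδ v n)))
    exact hle (span_ι_pow (k := k) (V := V) ▸ Submodule.mem_top)
  -- Subtracting the linear part leaves a remainder `r` with eigenvalue `2` that is also a sum of
  -- eigenvectors for other eigenvalues, hence zero.
  obtain ⟨_, ⟨v, rfl⟩, r, hr, hvr⟩ := Submodule.mem_sup.1 hmem
  have hr2 : r ∈ δ.eigenspace 2 := by
    rw [Module.End.mem_eigenspace_iff, eq_sub_of_add_eq' hvr, map_sub, hδp, smul_sub]
    congr 1
    simpa using hδ v 1
  have hr0 : r = 0 :=
    Submodule.disjoint_def.1 ((Module.End.eigenspaces_iSupIndep δ) 2) r hr2 hr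
  exact ⟨v, by rw [← hvr, hr0, add_zero]⟩

end

end SymmetricAlgebra


/-! ### A Poincaré–Birkhoff–Witt action on polynomials -/

namespace Finsupp

/-- Every nonconstant monomial is the product of its least variable and a monomial. -/
theorem exists_eq_single_add {C : Type*} [LinearOrder C] {M : C →₀ ℕ} (hM : M ≠ 0) :
    ∃ (μ : C) (N : C →₀ ℕ), M = single μ 1 + N ∧ ∀ j ∈ N.support, μ ≤ j := by
  have hne : M.support.Nonempty := support_nonempty_iff.2 hM
  refine ⟨M.support.min' hne, M - single (M.support.min' hne) 1, ?_, fun j hj => ?_⟩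
  · rw [add_tsub_cancel_of_le]
    rw [single_le_iff]
    exact Nat.one_le_iff_ne_zero.2 (mem_support_iff.1 (Finset.min'_mem _ hne))
  · exact Finset.min'_le _ _ (support_tsub hj)

theorem degree_single_add {C : Type*} (μ : C) (N : C →₀ ℕ) :
    (single μ 1 + N).degree = N.degree + 1 := by
  rw [map_add, degree_single, add_comm]

theorem le_of_mem_support_single_add {C : Type*} [LinearOrder C] {i μ : C} {N : C →₀ ℕ}
    (hi : i ≤ μ) (hN : ∀ j ∈ N.support, i ≤ j) : ∀ j ∈ (single μ 1 + N).support, i ≤ j := by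
  intro j hj
  rcases Finset.mem_union.1 (support_add hj) with h | h
  · rwa [Finset.mem_singleton.1 (support_single_subset h)]
  · exact hN j h

end Finsupp

namespace MvPolynomial

section

variable (k C : Type*) [Field k]

/-- Polynomials of total degree less than `n`. -/
def degreeLT (n : ℕ) : Submodule k (MvPolynomial C k) :=
  Submodule.span k {p | ∃ M : C →₀ ℕ, M.degree < n ∧ p = monomial M 1}

variable {k C}

theorem monomial_mem_degreeLT {M : C →₀ ℕ} {n : ℕ} (h : M.degree < n) :
    monomial M (1 : k) ∈ degreeLT k C n := Submodule.subset_span ⟨M, h, rfl⟩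

theorem degreeLT_mono {m n : ℕ} (h : m ≤ n) : degreeLT k C m ≤ degreeLT k C n :=
  Submodule.span_mono fun _ ⟨M, hM, hp⟩ => ⟨M, hM.trans_le h, hp⟩

theorem degreeLT_zero : degreeLT k C 0 = ⊥ := by
  rw [degreeLT, Submodule.span_eq_bot]
  rintro _ ⟨M, hM, -⟩
  omega

theorem X_mul_monomial_one (μ : C) (N : C →₀ ℕ) :
    X μ * monomial N (1 : k) = monomial (Finsupp.single μ 1 + N) 1 := by
  rw [X, monomial_mul, one_mul]

theorem exists_mem_degreeLT (p : MvPolynomial C k) : ∃ n, p ∈ degreeLT k C n := by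
  induction p using MvPolynomial.induction_on' with
  | monomial M a =>
    refine ⟨M.degree + 1, ?_⟩
    have h := (degreeLT k C _).smul_mem a (monomial_mem_degreeLT M.degree.lt_succ_self)
    rwa [smul_monomial, smul_eq_mul, mul_one] at h
  | add p q hp hq =>
    obtain ⟨m, hm⟩ := hp
    obtain ⟨n, hn⟩ := hq
    exact ⟨max m n, add_mem (degreeLT_mono (le_max_left _ _) hm)
      (degreeLT_mono (le_max_right _ _) hn)⟩

theorem X_mul_mem_degreeLT (i : C) {p : MvPolynomial C k} {n : ℕ} (hp : p ∈ degreeLT k C n) :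
    X i * p ∈ degreeLT k C (n + 1) := by
  induction hp using Submodule.span_induction with
  | mem p hp =>
    obtain ⟨M, hM, rfl⟩ := hp
    rw [X, monomial_mul, mul_one]
    refine monomial_mem_degreeLT ?_
    rw [map_add, Finsupp.degree_single]
    omega
  | zero => rw [mul_zero]; exact zero_mem _
  | add p q _ _ hp hq => rw [mul_add]; exact add_mem hp hq
  | smul a p _ hp => rw [mul_smul_comm]; exact Submodule.smul_mem _ a hp

/-- Linear endomorphisms that are unitriangular with respect to the degree are bijective. -/
theorem bijective_of_sub_mem_degreeLT (F : MvPolynomial C k →ₗ[k] MvPolynomial C k)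
    (hF : ∀ M : C →₀ ℕ, F (monomial M 1) - monomial M 1 ∈ degreeLT k C M.degree) :
    Function.Bijective F := by
  have hlt : ∀ n, ∀ p ∈ degreeLT k C (n + 1), F p - p ∈ degreeLT k C n := by
    intro n p hp
    induction hp using Submodule.span_induction with
    | mem p hp =>
      obtain ⟨M, hM, rfl⟩ := hp
      exact degreeLT_mono (Nat.lt_succ_iff.1 hM) (hF M)
    | zero => rw [map_zero, sub_zero]; exact zero_mem _
    | add p q _ _ hp hq => rw [map_add, add_sub_add_comm]; exact add_mem hp hq
    | smul a p _ hp => rw [map_smul, ← smul_sub]; exact Submodule.smul_mem _ a hp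
  constructor
  · rw [← LinearMap.ker_eq_bot, Submodule.eq_bot_iff]
    intro p hp
    obtain ⟨n, hn⟩ := exists_mem_degreeLT p
    induction n with
    | zero => rwa [degreeLT_zero, Submodule.mem_bot] at hn
    | succ n ih =>
      have h := hlt n p hn
      rw [LinearMap.mem_ker.1 hp, zero_sub] at h
      exact ih (neg_mem_iff.1 h)
  · have hle : ∀ n, degreeLT k C n ≤ LinearMap.range F := by
      intro n
      induction n with
      | zero => rw [degreeLT_zero]; exact bot_le
      | succ n ih =>
        intro p hp
        have h := sub_mem (LinearMap.mem_range_self F p) (ih (hlt n p hp))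
        rwa [sub_sub_cancel] at h
    intro p
    obtain ⟨n, hn⟩ := exists_mem_degreeLT p
    exact hle n hn

end

end MvPolynomial

namespace Triple

open MvPolynomial

section

variable {k 𝔤 : Type*} [Field k] [LieRing 𝔤] [LieAlgebra k 𝔤] (τ : Triple k 𝔤)

/-- The projection of `𝔤` onto `𝔠` along `𝔰`. -/
def projC : 𝔤 →ₗ[k] τ.c := τ.c.projectionOnto τ.s.toSubmodule τ.isCompl.symm

theorem projC_of_mem_s {x : 𝔤} (hx : x ∈ τ.s) : τ.projC x = 0 :=
  Submodule.projectionOnto_apply_of_mem_right _ hx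

theorem projC_coe (x : τ.c) : τ.projC x = x :=
  Submodule.projectionOnto_apply_left _ x

theorem induction_on {P : 𝔤 → Prop} (x : 𝔤) (hs : ∀ x ∈ τ.s, P x) (hc : ∀ x ∈ τ.c, P x)
    (hadd : ∀ x y, P x → P y → P (x + y)) : P x := by
  obtain ⟨y, hy, z, hz, rfl⟩ := Submodule.mem_sup.1
    (τ.isCompl.codisjoint.eq_top ▸ Submodule.mem_top : x ∈ τ.s.toSubmodule ⊔ τ.c)
  exact hadd _ _ (hs y hy) (hc z hz)

variable {C : Type*} (b : Module.Basis C k τ.c)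

theorem induction_basis {P : 𝔤 → Prop} (x : 𝔤) (hs : ∀ x ∈ τ.s, P x) (hb : ∀ i, P (b i))
    (hadd : ∀ x y, P x → P y → P (x + y)) (hsmul : ∀ (a : k) x, P x → P (a • x)) : P x := by
  refine τ.induction_on x hs (fun x hx => ?_) hadd
  have h : (⟨x, hx⟩ : τ.c) ∈ Submodule.span k (Set.range b) := b.span_eq ▸ Submodule.mem_top
  suffices ∀ y ∈ Submodule.span k (Set.range b), P (y : 𝔤) from this _ h
  intro y hy
  induction hy using Submodule.span_induction with
  | mem y hy => obtain ⟨i, rfl⟩ := hy; exact hb i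
  | zero => exact hs 0 (zero_mem _)
  | add y z _ _ hy hz => exact hadd _ _ hy hz
  | smul a y _ hy => exact hsmul a _ hy

/-- The linear form in the variables attached to an element of `𝔤`; it vanishes on `𝔰`. -/
def symbol : 𝔤 →ₗ[k] MvPolynomial C k := b.constr k (fun i => (X i : MvPolynomial C k)) ∘ₗ τ.projC

theorem symbol_of_mem_s {x : 𝔤} (hx : x ∈ τ.s) : τ.symbol b x = 0 := by
  rw [symbol, LinearMap.comp_apply, τ.projC_of_mem_s hx, map_zero]

theorem symbol_basis (i : C) : τ.symbol b (b i) = X i := by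
  rw [symbol, LinearMap.comp_apply, τ.projC_coe, Module.Basis.constr_basis]

theorem symbol_mul_mem_degreeLT (x : 𝔤) {p : MvPolynomial C k} {n : ℕ}
    (hp : p ∈ degreeLT k C n) : τ.symbol b x * p ∈ degreeLT k C (n + 1) := by
  have h : τ.symbol b x ∈ Submodule.span k (Set.range (X : C → MvPolynomial C k)) := by
    rw [symbol, LinearMap.comp_apply, Module.Basis.constr_apply]
    exact Submodule.sum_mem _ fun i _ => Submodule.smul_mem _ _ (Submodule.subset_span ⟨i, rfl⟩)
  generalize τ.symbol b x = q at h
  induction h using Submodule.span_induction with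
  | mem q hq =>
    obtain ⟨i, rfl⟩ := hq
    exact X_mul_mem_degreeLT i hp
  | zero => rw [zero_mul]; exact zero_mem _
  | add p q _ _ hp hq => rw [add_mul]; exact add_mem hp hq
  | smul a p _ hp => rw [smul_mul_assoc]; exact Submodule.smul_mem _ a hp

/-- The value of `x · z_M`, given the action `f` in lower degrees, if `x · z_M` has to be reordered
with respect to the least variable `z_μ` of `z_M`. -/
def pbwReorder (f : 𝔤 →ₗ[k] Module.End k (MvPolynomial C k)) (μ : C) (M : C →₀ ℕ) :
    𝔤 →ₗ[k] MvPolynomial C k where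
  -- With `z_M = z_μ z_N`, this is the rule `x z_μ z_N = z_μ (x z_N) + [x, z_μ] z_N`. The top part
  -- `σ(x) z_N` of `x z_N` is split off and its product with `z_μ` prescribed as `σ(x) z_M`, so that
  -- `f` is consulted only in degrees up to that of `z_N`.
  toFun x := τ.symbol b x * monomial M 1 +
    f (b μ) (f x (monomial (M - Finsupp.single μ 1) 1) -
      τ.symbol b x * monomial (M - Finsupp.single μ 1) 1) +
    f ⁅x, (b μ : 𝔤)⁆ (monomial (M - Finsupp.single μ 1) 1)
  map_add' x y := by
    simp only [map_add, add_mul, add_lie, LinearMap.add_apply, map_sub]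
    abel
  map_smul' a x := by
    simp only [map_smul, smul_mul_assoc, smul_lie, LinearMap.smul_apply, map_sub, smul_add,
      smul_sub, RingHom.id_apply]

theorem pbwReorder_apply (f : 𝔤 →ₗ[k] Module.End k (MvPolynomial C k)) (μ : C) (M : C →₀ ℕ)
    (x : 𝔤) : τ.pbwReorder b f μ M x = τ.symbol b x * monomial M 1 +
      f (b μ) (f x (monomial (M - Finsupp.single μ 1) 1) -
        τ.symbol b x * monomial (M - Finsupp.single μ 1) 1) +
      f ⁅x, (b μ : 𝔤)⁆ (monomial (M - Finsupp.single μ 1) 1) := rfl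

variable [LinearOrder C]

/-- One step of the recursive construction of the action of `𝔤` on polynomials. -/
def pbwStepMonomial (f : 𝔤 →ₗ[k] Module.End k (MvPolynomial C k)) (M : C →₀ ℕ) :
    𝔤 →ₗ[k] MvPolynomial C k :=
  if h : M.support.Nonempty then
    -- The second summand corrects the reordering rule on basis elements with index at most the
    -- least variable, so that they act by plain multiplication. It factors through the projection
    -- to `𝔠` and so does not affect `𝔰`.
    τ.pbwReorder b f (M.support.min' h) M + b.constr k (fun i =>
      if i ≤ M.support.min' h then X i * monomial M 1 -
        τ.pbwReorder b f (M.support.min' h) M (b i) else 0) ∘ₗ τ.projC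
  else τ.symbol b

/-- One step of the recursive construction of the action of `𝔤` on polynomials. -/
def pbwStep (f : 𝔤 →ₗ[k] Module.End k (MvPolynomial C k)) :
    𝔤 →ₗ[k] Module.End k (MvPolynomial C k) :=
  ((basisMonomials C k).constr k (τ.pbwStepMonomial b f)).flip

/-- The approximations to the action of `𝔤` on polynomials: the `n`-th is correct in degrees at
most `n`. -/
def pbwApprox : ℕ → 𝔤 →ₗ[k] Module.End k (MvPolynomial C k)
  -- On the constant monomial the step does not consult its argument, so the starting value `0` is
  -- harmless.
  | 0 => τ.pbwStep b 0
  | n + 1 => τ.pbwStep b (pbwApprox n)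

/-- The action of `𝔤` on polynomials. -/
def pbwAction : 𝔤 →ₗ[k] Module.End k (MvPolynomial C k) :=
  ((basisMonomials C k).constr k fun M =>
    (τ.pbwApprox b M.degree).flip (monomial M 1)).flip

theorem pbwStep_monomial (f : 𝔤 →ₗ[k] Module.End k (MvPolynomial C k)) (x : 𝔤) (M : C →₀ ℕ) :
    τ.pbwStep b f x (monomial M 1) = τ.pbwStepMonomial b f M x := by
  have h := (basisMonomials C k).constr_basis k (τ.pbwStepMonomial b f) M
  rw [coe_basisMonomials] at h
  rw [pbwStep, LinearMap.flip_apply, h]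

theorem pbwAction_monomial (x : 𝔤) (M : C →₀ ℕ) :
    τ.pbwAction b x (monomial M 1) = τ.pbwApprox b M.degree x (monomial M 1) := by
  have h := (basisMonomials C k).constr_basis k
    (fun M => (τ.pbwApprox b M.degree).flip (monomial M 1)) M
  rw [coe_basisMonomials] at h
  rw [pbwAction, LinearMap.flip_apply, h, LinearMap.flip_apply]

theorem pbwStep_one (f : 𝔤 →ₗ[k] Module.End k (MvPolynomial C k)) (x : 𝔤) :
    τ.pbwStep b f x 1 = τ.symbol b x := by
  have h := τ.pbwStep_monomial b f x 0
  rw [monomial_zero', C_1] at h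
  rw [h, pbwStepMonomial, dif_neg (by simp)]

/-- Multiplication by a variable that is not larger than the others. -/
theorem pbwStep_of_le (f : 𝔤 →ₗ[k] Module.End k (MvPolynomial C k)) {i : C} {M : C →₀ ℕ}
    (hi : ∀ j ∈ M.support, i ≤ j) :
    τ.pbwStep b f (b i) (monomial M 1) = X i * monomial M 1 := by
  rw [pbwStep_monomial, pbwStepMonomial]
  split_ifs with h
  · rw [LinearMap.add_apply, LinearMap.comp_apply, τ.projC_coe, Module.Basis.constr_basis,
      if_pos (hi _ (Finset.min'_mem _ h)), add_sub_cancel]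
  · rw [Finset.not_nonempty_iff_eq_empty, Finsupp.support_eq_empty] at h
    rw [h, symbol_basis, monomial_zero', C_1, mul_one]

/-- The elements of `𝔰` and the elements of the basis with index at least `μ`. -/
def IsBasicGE (μ : C) (x : 𝔤) : Prop := x ∈ τ.s ∨ ∃ i, μ ≤ i ∧ x = b i

theorem pbwStep_of_lt (f : 𝔤 →ₗ[k] Module.End k (MvPolynomial C k)) {μ : C} {N : C →₀ ℕ}
    (hμ : ∀ j ∈ N.support, μ ≤ j) {x : 𝔤} (hx : x ∈ τ.s ∨ ∃ i, μ < i ∧ x = b i) :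
    τ.pbwStep b f x (monomial (Finsupp.single μ 1 + N) 1) =
      τ.symbol b x * monomial (Finsupp.single μ 1 + N) 1 +
      f (b μ) (f x (monomial N 1) - τ.symbol b x * monomial N 1) +
      f ⁅x, (b μ : 𝔤)⁆ (monomial N 1) := by
  have hmem : μ ∈ (Finsupp.single μ 1 + N).support := by simp
  have hne : (Finsupp.single μ 1 + N).support.Nonempty := ⟨μ, hmem⟩
  have hmin : (Finsupp.single μ 1 + N).support.min' hne = μ := by
    refine le_antisymm (Finset.min'_le _ _ hmem) (Finset.le_min' _ _ _ fun j hj => ?_)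
    rcases Finset.mem_union.1 (Finsupp.support_add hj) with h | h
    · rw [Finset.mem_singleton.1 (Finsupp.support_single_subset h)]
    · exact hμ j h
  have hcorr : b.constr k (fun i => if i ≤ μ then X i * monomial (Finsupp.single μ 1 + N) 1 -
      τ.pbwReorder b f μ (Finsupp.single μ 1 + N) (b i) else 0) (τ.projC x) = 0 := by
    rcases hx with hx | ⟨i, hi, rfl⟩
    · rw [τ.projC_of_mem_s hx, map_zero]
    · rw [τ.projC_coe, Module.Basis.constr_basis, if_neg (not_le.2 hi)]
  rw [pbwStep_monomial, pbwStepMonomial, dif_pos hne, hmin, LinearMap.add_apply,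
    LinearMap.comp_apply, hcorr, add_zero]
  rw [pbwReorder_apply, add_tsub_cancel_left]

/-- The two claims need each other's company: the leading term `σ(x) z_M` bounds the degrees of the
arguments handed to the previous approximation, and this bound is what makes the next approximation
agree with the current one. -/
theorem pbwApprox_aux (n : ℕ) : (∀ M : C →₀ ℕ, M.degree ≤ n → ∀ x : 𝔤,
      τ.pbwApprox b n x (monomial M 1) - τ.symbol b x * monomial M 1 ∈
        degreeLT k C (M.degree + 1)) ∧
    ∀ M : C →₀ ℕ, M.degree ≤ n → ∀ x : 𝔤,
      τ.pbwApprox b (n + 1) x (monomial M 1) = τ.pbwApprox b n x (monomial M 1) := by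
  have hstep : ∀ m, ∃ f, τ.pbwApprox b m = τ.pbwStep b f := by
    rintro (_ | m)
    · exact ⟨_, rfl⟩
    · exact ⟨_, rfl⟩
  have hone : ∀ m x, τ.pbwApprox b m x 1 = τ.symbol b x := by
    intro m x
    obtain ⟨f, hf⟩ := hstep m
    rw [hf, pbwStep_one]
  have hle : ∀ m (i : C) (M : C →₀ ℕ), (∀ j ∈ M.support, i ≤ j) →
      τ.pbwApprox b m (b i) (monomial M 1) = X i * monomial M 1 := by
    intro m i M hi
    obtain ⟨f, hf⟩ := hstep m
    rw [hf, pbwStep_of_le _ _ _ hi]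
  induction n with
  | zero =>
    constructor
    · intro M hM x
      have h0 : M = 0 := (Finsupp.degree_eq_zero_iff M).1 (by omega)
      subst h0
      rw [monomial_zero', C_1, hone, mul_one, sub_self]
      exact zero_mem _
    · intro M hM x
      have h0 : M = 0 := (Finsupp.degree_eq_zero_iff M).1 (by omega)
      subst h0
      rw [monomial_zero', C_1, hone, hone]
  | succ n ih =>
    obtain ⟨ihB, ihS⟩ := ih
    have ihB' : ∀ m, m ≤ n + 1 → ∀ x, ∀ p ∈ degreeLT k C m,
        τ.pbwApprox b n x p - τ.symbol b x * p ∈ degreeLT k C m := by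
      intro m hm x p hp
      induction hp using Submodule.span_induction with
      | mem p hp =>
        obtain ⟨M, hM, rfl⟩ := hp
        exact degreeLT_mono hM (ihB M (by omega) x)
      | zero => rw [map_zero, mul_zero, sub_zero]; exact zero_mem _
      | add p q _ _ hp hq => rw [map_add, mul_add, add_sub_add_comm]; exact add_mem hp hq
      | smul a p _ hp =>
        rw [map_smul, mul_smul_comm, ← smul_sub]; exact Submodule.smul_mem _ a hp
    have ihS' : ∀ p ∈ degreeLT k C (n + 1), ∀ x,
        τ.pbwApprox b (n + 1) x p = τ.pbwApprox b n x p := by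
      intro p hp x
      induction hp using Submodule.span_induction with
      | mem p hp =>
        obtain ⟨M, hM, rfl⟩ := hp
        exact ihS M (by omega) x
      | zero => rw [map_zero, map_zero]
      | add p q _ _ hp hq => rw [map_add, map_add, hp, hq]
      | smul a p _ hp => rw [map_smul, map_smul, hp]
    constructor
    · intro M hM x
      rcases eq_or_ne M 0 with rfl | h0
      · rw [monomial_zero', C_1, hone, mul_one, sub_self]
        exact zero_mem _
      obtain ⟨μ, N, rfl, hμ⟩ := Finsupp.exists_eq_single_add h0
      rw [Finsupp.degree_single_add] at hM ⊢
      have hre : ∀ x, (x ∈ τ.s ∨ ∃ i, μ < i ∧ x = b i) →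
          τ.pbwApprox b (n + 1) x (monomial (Finsupp.single μ 1 + N) 1) -
            τ.symbol b x * monomial (Finsupp.single μ 1 + N) 1 ∈
          degreeLT k C (N.degree + 1 + 1) := by
        intro x hx
        rw [pbwApprox, pbwStep_of_lt _ _ _ hμ hx, add_assoc (τ.symbol b x * _), add_sub_cancel_left]
        -- The remainder `x z_N - σ(x) z_N` has degree at most that of `z_N`; acting by `b μ` raises
        -- the degree by at most one, to the degree of `z_μ z_N`.
        have hw := ihB' (N.degree + 1) (by omega) x _ (monomial_mem_degreeLT N.degree.lt_succ_self)
        refine add_mem ?_ ?_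
        · have h1 := ihB' _ (by omega) (b μ) _ hw
          have h2 := τ.symbol_mul_mem_degreeLT b (b μ) hw
          have h3 := add_mem (degreeLT_mono (Nat.le_succ _) h1) h2
          rwa [sub_add_cancel] at h3
        · have h1 := ihB' _ (by omega) ⁅x, (b μ : 𝔤)⁆ _
            (monomial_mem_degreeLT N.degree.lt_succ_self)
          have h2 := τ.symbol_mul_mem_degreeLT b ⁅x, (b μ : 𝔤)⁆
            (monomial_mem_degreeLT N.degree.lt_succ_self)
          have h3 := add_mem (degreeLT_mono (Nat.le_succ _) h1) h2
          rwa [sub_add_cancel] at h3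
      refine τ.induction_basis b x (fun x hx => hre x (Or.inl hx)) (fun i => ?_)
        (fun x y hx hy => ?_) (fun a x hx => ?_)
      · rcases le_or_gt i μ with h | h
        · rw [hle _ _ _ (Finsupp.le_of_mem_support_single_add h fun j hj => h.trans (hμ j hj)), symbol_basis, sub_self]
          exact zero_mem _
        · exact hre _ (Or.inr ⟨i, h, rfl⟩)
      · rw [map_add, map_add, LinearMap.add_apply, add_mul, add_sub_add_comm]
        exact add_mem hx hy
      · rw [map_smul, map_smul, LinearMap.smul_apply, smul_mul_assoc, ← smul_sub]
        exact Submodule.smul_mem _ a hx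
    · intro M hM x
      rcases eq_or_ne M 0 with rfl | h0
      · rw [monomial_zero', C_1, hone, hone]
      obtain ⟨μ, N, rfl, hμ⟩ := Finsupp.exists_eq_single_add h0
      rw [Finsupp.degree_single_add] at hM
      have hN := monomial_mem_degreeLT (k := k) (N.degree.lt_succ_self.trans_le hM)
      have hre : ∀ x, (x ∈ τ.s ∨ ∃ i, μ < i ∧ x = b i) →
          τ.pbwApprox b (n + 1 + 1) x (monomial (Finsupp.single μ 1 + N) 1) =
          τ.pbwApprox b (n + 1) x (monomial (Finsupp.single μ 1 + N) 1) := by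
        intro x hx
        have hw := degreeLT_mono hM
          (ihB' (N.degree + 1) (by omega) x _ (monomial_mem_degreeLT N.degree.lt_succ_self))
        rw [pbwApprox, pbwStep_of_lt _ _ _ hμ hx, ihS' _ hN, ihS' _ hN, ihS' _ hw, pbwApprox,
          pbwStep_of_lt _ _ _ hμ hx]
      refine τ.induction_basis b x (fun x hx => hre x (Or.inl hx)) (fun i => ?_)
        (fun x y hx hy => ?_) (fun a x hx => ?_)
      · rcases le_or_gt i μ with h | h
        · rw [hle _ _ _ (Finsupp.le_of_mem_support_single_add h fun j hj => h.trans (hμ j hj)), hle _ _ _ (Finsupp.le_of_mem_support_single_add h fun j hj => h.trans (hμ j hj))]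
        · exact hre _ (Or.inr ⟨i, h, rfl⟩)
      · rw [map_add, map_add, LinearMap.add_apply, LinearMap.add_apply, hx, hy]
      · rw [map_smul, map_smul, LinearMap.smul_apply, LinearMap.smul_apply, hx]

theorem pbwAction_eq_pbwApprox {n : ℕ} {p : MvPolynomial C k} (hp : p ∈ degreeLT k C (n + 1))
    (x : 𝔤) : τ.pbwAction b x p = τ.pbwApprox b n x p := by
  have hmon : ∀ (M : C →₀ ℕ) m, τ.pbwApprox b (M.degree + m) x (monomial M 1) =
      τ.pbwApprox b M.degree x (monomial M 1) := by
    intro M m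
    induction m with
    | zero => rfl
    | succ m ih =>
      rw [← ih]
      exact (τ.pbwApprox_aux b (M.degree + m)).2 M (Nat.le_add_right _ _) x
  induction hp using Submodule.span_induction with
  | mem p hp =>
    obtain ⟨M, hM, rfl⟩ := hp
    obtain ⟨m, rfl⟩ := Nat.exists_eq_add_of_le (Nat.lt_succ_iff.1 hM)
    rw [pbwAction_monomial, hmon]
  | zero => rw [map_zero, map_zero]
  | add p q _ _ hp hq => rw [map_add, map_add, hp, hq]
  | smul a p _ hp => rw [map_smul, map_smul, hp]

theorem pbwAction_sub_mem_degreeLT (x : 𝔤) {n : ℕ} {p : MvPolynomial C k}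
    (hp : p ∈ degreeLT k C n) : τ.pbwAction b x p - τ.symbol b x * p ∈ degreeLT k C n := by
  induction hp using Submodule.span_induction with
  | mem p hp =>
    obtain ⟨M, hM, rfl⟩ := hp
    rw [pbwAction_monomial]
    exact degreeLT_mono hM ((τ.pbwApprox_aux b M.degree).1 M le_rfl x)
  | zero => rw [map_zero, mul_zero, sub_zero]; exact zero_mem _
  | add p q _ _ hp hq => rw [map_add, mul_add, add_sub_add_comm]; exact add_mem hp hq
  | smul a p _ hp => rw [map_smul, mul_smul_comm, ← smul_sub]; exact Submodule.smul_mem _ a hp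

theorem exists_pbwApprox_eq (n : ℕ) : ∃ f, τ.pbwApprox b n = τ.pbwStep b f := by
  rcases n with _ | n
  · exact ⟨_, rfl⟩
  · exact ⟨_, rfl⟩

theorem pbwAction_of_le {i : C} {M : C →₀ ℕ} (hi : ∀ j ∈ M.support, i ≤ j) :
    τ.pbwAction b (b i) (monomial M 1) = X i * monomial M 1 := by
  obtain ⟨f, hf⟩ := τ.exists_pbwApprox_eq b M.degree
  rw [pbwAction_monomial, hf, pbwStep_of_le _ _ _ hi]

theorem pbwAction_one (x : 𝔤) : τ.pbwAction b x 1 = τ.symbol b x := by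
  obtain ⟨f, hf⟩ := τ.exists_pbwApprox_eq b 0
  have h := τ.pbwAction_monomial b x 0
  rwa [map_zero, hf, monomial_zero', C_1, pbwStep_one] at h

theorem pbwAction_symbol_mul {μ : C} {N : C →₀ ℕ} (hμ : ∀ j ∈ N.support, μ ≤ j) {x : 𝔤}
    (hx : τ.IsBasicGE b μ x) : τ.pbwAction b (b μ) (τ.symbol b x * monomial N 1) =
      X μ * (τ.symbol b x * monomial N 1) := by
  rcases hx with hx | ⟨i, hi, rfl⟩
  · rw [τ.symbol_of_mem_s b hx, zero_mul, map_zero, mul_zero]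
  · rw [symbol_basis, X, monomial_mul, one_mul]
    exact τ.pbwAction_of_le b (Finsupp.le_of_mem_support_single_add hi hμ)

/-- The reordering rule with the approximations eliminated: the top part that was split off
recombines with the remainder because `b μ` multiplies `σ(x) z_N` by `z_μ`. -/
theorem pbwAction_X_mul {μ : C} {N : C →₀ ℕ} (hμ : ∀ j ∈ N.support, μ ≤ j) {x : 𝔤}
    (hx : τ.IsBasicGE b μ x) : τ.pbwAction b x (X μ * monomial N 1) =
      τ.pbwAction b (b μ) (τ.pbwAction b x (monomial N 1)) +
        τ.pbwAction b ⁅x, (b μ : 𝔤)⁆ (monomial N 1) := by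
  by_cases hxμ : x = b μ
  · rw [hxμ, lie_self, map_zero, LinearMap.zero_apply, add_zero, τ.pbwAction_of_le b hμ]
  have hx' : x ∈ τ.s ∨ ∃ i, μ < i ∧ x = b i := by
    rcases hx with hx | ⟨i, hi, rfl⟩
    · exact Or.inl hx
    · exact Or.inr ⟨i, lt_of_le_of_ne hi (fun h => hxμ (by rw [h])), rfl⟩
  have hN := monomial_mem_degreeLT (k := k) N.degree.lt_succ_self
  have hw := τ.pbwAction_sub_mem_degreeLT b x hN
  have hsplit : τ.pbwAction b (b μ) (τ.pbwAction b x (monomial N 1)) =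
      τ.pbwAction b (b μ) (τ.pbwAction b x (monomial N 1) - τ.symbol b x * monomial N 1) +
        X μ * (τ.symbol b x * monomial N 1) := by
    rw [← τ.pbwAction_symbol_mul b hμ hx, ← map_add, sub_add_cancel]
  rw [X_mul_monomial_one, pbwAction_monomial, Finsupp.degree_single_add, pbwApprox,
    pbwStep_of_lt _ _ _ hμ hx', hsplit, τ.pbwAction_eq_pbwApprox b hw,
    τ.pbwAction_eq_pbwApprox b hN, τ.pbwAction_eq_pbwApprox b hN, ← X_mul_monomial_one,
    mul_left_comm (τ.symbol b x), add_comm (X μ * _)]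

theorem pbwAction_lie_X_mul {μ : C} {N : C →₀ ℕ} (hμ : ∀ j ∈ N.support, μ ≤ j) {x : 𝔤}
    (hx : τ.IsBasicGE b μ x) : τ.pbwAction b ⁅x, (b μ : 𝔤)⁆ (monomial N 1) =
      τ.pbwAction b x (τ.pbwAction b (b μ) (monomial N 1)) -
      τ.pbwAction b (b μ) (τ.pbwAction b x (monomial N 1)) := by
  rw [τ.pbwAction_of_le b hμ, τ.pbwAction_X_mul b hμ hx, add_sub_cancel_left]

/-- Induction on the degree. Write `z_M = z_μ z_N` with `z_μ` least. If one of the two elements is a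
basis element of index at most `μ`, the relation is the reordering rule itself. Otherwise both can
be moved past `z_μ`, and the relation follows from the Jacobi identity and the relations on `z_N`.
-/
theorem pbwAction_lie_aux (n : ℕ) : ∀ p ∈ degreeLT k C n, ∀ x y : 𝔤,
    τ.pbwAction b ⁅x, y⁆ p = τ.pbwAction b x (τ.pbwAction b y p) -
      τ.pbwAction b y (τ.pbwAction b x p) := by
  induction n with
  | zero =>
    intro p hp x y
    rw [degreeLT_zero, Submodule.mem_bot] at hp
    simp only [hp, map_zero, sub_self]
  | succ n ih =>
    have hswap : ∀ p (x y : 𝔤), τ.pbwAction b ⁅y, x⁆ p =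
        τ.pbwAction b y (τ.pbwAction b x p) - τ.pbwAction b x (τ.pbwAction b y p) →
        τ.pbwAction b ⁅x, y⁆ p = τ.pbwAction b x (τ.pbwAction b y p) -
          τ.pbwAction b y (τ.pbwAction b x p) := by
      intro p x y h
      rw [← lie_skew, map_neg, LinearMap.neg_apply, h, neg_sub]
    -- Both elements can be moved past the least variable.
    have hge : ∀ (μ : C) (N : C →₀ ℕ), (∀ j ∈ N.support, μ ≤ j) → N.degree < n → ∀ x y : 𝔤,
        τ.IsBasicGE b μ x → τ.IsBasicGE b μ y →
        τ.pbwAction b ⁅x, y⁆ (X μ * monomial N 1) =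
          τ.pbwAction b x (τ.pbwAction b y (X μ * monomial N 1)) -
          τ.pbwAction b y (τ.pbwAction b x (X μ * monomial N 1)) := by
      intro μ N hμ hN x y hx hy
      have hNmem := monomial_mem_degreeLT (k := k) hN
      -- The product `y z_N` can exceed the degrees covered by induction. Only its remainder below
      -- `σ(y) z_N` is covered; for `σ(y) z_N` itself, `μ` is still least and the reordering rule
      -- applies.
      have hmove : ∀ x y : 𝔤, τ.IsBasicGE b μ x → τ.IsBasicGE b μ y →
          τ.pbwAction b ⁅x, (b μ : 𝔤)⁆ (τ.pbwAction b y (monomial N 1)) =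
            τ.pbwAction b x (τ.pbwAction b (b μ) (τ.pbwAction b y (monomial N 1))) -
            τ.pbwAction b (b μ) (τ.pbwAction b x (τ.pbwAction b y (monomial N 1))) := by
        intro x y hx hy
        have hw := ih _ (τ.pbwAction_sub_mem_degreeLT b y hNmem) x (b μ)
        have hsym : τ.pbwAction b ⁅x, (b μ : 𝔤)⁆ (τ.symbol b y * monomial N 1) =
            τ.pbwAction b x (τ.pbwAction b (b μ) (τ.symbol b y * monomial N 1)) -
            τ.pbwAction b (b μ) (τ.pbwAction b x (τ.symbol b y * monomial N 1)) := by
          rcases hy with hy | ⟨i, hi, rfl⟩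
          · simp only [τ.symbol_of_mem_s b hy, zero_mul, map_zero, sub_self]
          · rw [symbol_basis, X_mul_monomial_one]
            exact τ.pbwAction_lie_X_mul b (Finsupp.le_of_mem_support_single_add hi hμ) hx
        have h := congrArg₂ (· + ·) hw hsym
        simp only [map_sub] at h
        rw [← sub_eq_zero] at h ⊢
        rw [← h]
        abel
      have hexp : ∀ x y : 𝔤, τ.IsBasicGE b μ x → τ.IsBasicGE b μ y →
          τ.pbwAction b x (τ.pbwAction b y (X μ * monomial N 1)) =
            τ.pbwAction b (b μ) (τ.pbwAction b x (τ.pbwAction b y (monomial N 1))) +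
            τ.pbwAction b ⁅x, (b μ : 𝔤)⁆ (τ.pbwAction b y (monomial N 1)) +
            τ.pbwAction b ⁅y, (b μ : 𝔤)⁆ (τ.pbwAction b x (monomial N 1)) +
            τ.pbwAction b ⁅x, ⁅y, (b μ : 𝔤)⁆⁆ (monomial N 1) := by
        intro x y hx hy
        rw [τ.pbwAction_X_mul b hμ hy, map_add, hmove x y hx hy, ih _ hNmem x ⁅y, (b μ : 𝔤)⁆]
        abel
      -- In the difference of the two expansions the mixed terms, symmetric in `x` and `y`, cancel;
      -- the Jacobi identity collects the double brackets.
      have hjac : ⁅⁅x, y⁆, (b μ : 𝔤)⁆ = ⁅x, ⁅y, (b μ : 𝔤)⁆⁆ - ⁅y, ⁅x, (b μ : 𝔤)⁆⁆ :=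
        lie_lie x y _
      rw [hexp x y hx hy, hexp y x hy hx, ← τ.pbwAction_of_le b hμ]
      have h1 := ih _ hNmem ⁅x, y⁆ (b μ)
      rw [hjac, map_sub, LinearMap.sub_apply, ih _ hNmem x y, map_sub] at h1
      rw [← sub_eq_zero] at h1 ⊢
      rw [← neg_eq_zero, ← h1]
      abel
    intro p hp
    induction hp using Submodule.span_induction with
    | mem p hp =>
      obtain ⟨M, hM, rfl⟩ := hp
      have hbasic : ∀ x y : 𝔤, (x ∈ τ.s ∨ ∃ i, x = b i) → (y ∈ τ.s ∨ ∃ i, y = b i) →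
          τ.pbwAction b ⁅x, y⁆ (monomial M 1) =
            τ.pbwAction b x (τ.pbwAction b y (monomial M 1)) -
            τ.pbwAction b y (τ.pbwAction b x (monomial M 1)) := by
        -- One of the elements multiplies by a least variable.
        have hleast : ∀ x μ, (∀ j ∈ M.support, μ ≤ j) → (x ∈ τ.s ∨ ∃ i, x = b i) →
            τ.pbwAction b ⁅x, (b μ : 𝔤)⁆ (monomial M 1) =
              τ.pbwAction b x (τ.pbwAction b (b μ) (monomial M 1)) -
              τ.pbwAction b (b μ) (τ.pbwAction b x (monomial M 1)) := by
          rintro x μ hμ (hx | ⟨i, rfl⟩)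
          · exact τ.pbwAction_lie_X_mul b hμ (Or.inl hx)
          · rcases le_total μ i with h | h
            · exact τ.pbwAction_lie_X_mul b hμ (Or.inr ⟨i, h, rfl⟩)
            · exact hswap _ _ _ (τ.pbwAction_lie_X_mul b (fun j hj => h.trans (hμ j hj))
                (Or.inr ⟨μ, h, rfl⟩))
        intro x y hx hy
        rcases eq_or_ne M 0 with rfl | h0
        · rcases hx with hx | ⟨i, rfl⟩
          · rcases hy with hy | ⟨i, rfl⟩
            · rw [monomial_zero', C_1, pbwAction_one, pbwAction_one, pbwAction_one,
                τ.symbol_of_mem_s b hx, τ.symbol_of_mem_s b hy,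
                τ.symbol_of_mem_s b (τ.s.lie_mem hx hy), map_zero, map_zero, sub_zero]
            · exact hleast x i (by simp) (Or.inl hx)
          · exact hswap _ _ _ (hleast y i (by simp) hy)
        · obtain ⟨μ, N, rfl, hμ⟩ := Finsupp.exists_eq_single_add h0
          rw [Finsupp.degree_single_add] at hM
          by_cases hxμ : τ.IsBasicGE b μ x
          · by_cases hyμ : τ.IsBasicGE b μ y
            · have h := hge μ N hμ (by omega) x y hxμ hyμ
              rwa [X_mul_monomial_one] at h
            · rcases hy with hy | ⟨i, rfl⟩
              · exact absurd (Or.inl hy) hyμ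
              · rcases le_total μ i with h | h
                · exact absurd (Or.inr ⟨i, h, rfl⟩) hyμ
                · exact hleast x i (Finsupp.le_of_mem_support_single_add h fun j hj => h.trans (hμ j hj)) hx
          · rcases hx with hx | ⟨i, rfl⟩
            · exact absurd (Or.inl hx) hxμ
            · rcases le_total μ i with h | h
              · exact absurd (Or.inr ⟨i, h, rfl⟩) hxμ
              · exact hswap _ _ _ (hleast y i (Finsupp.le_of_mem_support_single_add h fun j hj => h.trans (hμ j hj)) hy)
      have hright : ∀ x y : 𝔤, (x ∈ τ.s ∨ ∃ i, x = b i) →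
          τ.pbwAction b ⁅x, y⁆ (monomial M 1) =
            τ.pbwAction b x (τ.pbwAction b y (monomial M 1)) -
            τ.pbwAction b y (τ.pbwAction b x (monomial M 1)) := by
        intro x y hx
        refine τ.induction_basis b y (fun y hy => hbasic x y hx (Or.inl hy))
          (fun i => hbasic x _ hx (Or.inr ⟨i, rfl⟩)) (fun y z hy hz => ?_) fun a y hy => ?_
        · rw [lie_add, map_add, map_add, LinearMap.add_apply, LinearMap.add_apply,
            LinearMap.add_apply, hy, hz, map_add]
          abel
        · rw [lie_smul, map_smul, map_smul, LinearMap.smul_apply, LinearMap.smul_apply,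
            LinearMap.smul_apply, hy, map_smul, smul_sub]
      intro x y
      refine τ.induction_basis b x (fun x hx => hright x y (Or.inl hx))
        (fun i => hright _ y (Or.inr ⟨i, rfl⟩)) (fun x z hx hz => ?_) fun a x hx => ?_
      · rw [add_lie, map_add, map_add, LinearMap.add_apply, LinearMap.add_apply,
          LinearMap.add_apply, hx, hz, map_add]
        abel
      · rw [smul_lie, map_smul, map_smul, LinearMap.smul_apply, LinearMap.smul_apply,
          LinearMap.smul_apply, hx, map_smul, smul_sub]
    | zero => intro x y; simp only [map_zero, sub_self]
    | add p q _ _ hp hq =>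
      intro x y
      simp only [map_add, hp x y, hq x y]
      abel
    | smul a p _ hp =>
      intro x y
      simp only [map_smul, hp x y, smul_sub]

/-- The action of `𝔤` on polynomials, as a representation. -/
def pbwHom : 𝔤 →ₗ⁅k⁆ Module.End k (MvPolynomial C k) where
  __ := τ.pbwAction b
  map_lie' {x y} := by
    refine LinearMap.ext fun p => ?_
    obtain ⟨n, hn⟩ := exists_mem_degreeLT p
    exact τ.pbwAction_lie_aux b n p hn x y

theorem pbwHom_apply (x : 𝔤) : τ.pbwHom b x = τ.pbwAction b x := rfl

end

end Triple


/-! ### The Poincaré–Birkhoff–Witt basis of `U(𝔤) / U(𝔤)𝔰` -/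

namespace UniversalEnvelopingAlgebra

section

variable {k 𝔤 : Type*} [Field k] [LieRing 𝔤] [LieAlgebra k 𝔤]

/-- The universal property gives a map into `S`, and its composite with the inclusion fixes the
generators, hence is the identity. -/
theorem subalgebra_eq_top (S : Subalgebra k (UniversalEnvelopingAlgebra k 𝔤))
    (hS : ∀ x, ι k x ∈ S) : S = ⊤ := by
  let f : 𝔤 →ₗ⁅k⁆ S :=
    { toFun := fun x => ⟨ι k x, hS x⟩
      map_add' := fun x y => Subtype.ext (map_add _ _ _)
      map_smul' := fun a x => Subtype.ext (map_smul _ _ _)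
      map_lie' := fun {x y} => Subtype.ext (LieHom.map_lie _ _ _) }
  have h : S.val.comp (lift k f) = AlgHom.id k _ := algHom_ext_ι fun x => by
    rw [AlgHom.comp_apply, lift_ι_apply]
    rfl
  rw [eq_top_iff]
  intro u _
  have hu := congr($h u)
  rw [AlgHom.comp_apply, AlgHom.id_apply] at hu
  rw [← hu]
  exact (lift k f u).2

/-- The elements whose left multiplication preserves `P` form a subalgebra containing `𝔤`, so all of
`U(𝔤)` preserves `P`, starting from `1`. -/
theorem induction {P : UniversalEnvelopingAlgebra k 𝔤 → Prop}
    (hone : P 1) (hι : ∀ x u, P u → P (ι k x * u)) (hadd : ∀ u v, P u → P v → P (u + v))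
    (hsmul : ∀ (a : k) u, P u → P (a • u)) (u : UniversalEnvelopingAlgebra k 𝔤) : P u := by
  let W : Submodule k (UniversalEnvelopingAlgebra k 𝔤) :=
    { carrier := {u | P u}
      add_mem' := fun {u v} hu hv => hadd u v hu hv
      zero_mem' := by
        have := hsmul 0 1 hone
        rwa [zero_smul] at this
      smul_mem' := fun a u hu => hsmul a u hu }
  let S : Subalgebra k (UniversalEnvelopingAlgebra k 𝔤) :=
    { carrier := {w | ∀ u ∈ W, w * u ∈ W}
      add_mem' := fun {v w} hv hw u hu => by rw [add_mul]; exact W.add_mem (hv u hu) (hw u hu)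
      mul_mem' := fun {v w} hv hw u hu => by rw [mul_assoc]; exact hv _ (hw u hu)
      algebraMap_mem' := fun a u hu => by
        rw [← Algebra.smul_def]
        exact W.smul_mem a hu }
  have hS := subalgebra_eq_top S hι
  have hu : u ∈ S := hS ▸ Algebra.mem_top
  have h := hu 1 hone
  rwa [mul_one] at h

end

end UniversalEnvelopingAlgebra

namespace Triple

open MvPolynomial

section

variable {k 𝔤 : Type*} [Field k] [LieRing 𝔤] [LieAlgebra k 𝔤] (τ : Triple k 𝔤)

theorem smul_cls (u v : UniversalEnvelopingAlgebra k 𝔤) : u • τ.cls v = τ.cls (u * v) := rfl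

theorem cls_surjective : Function.Surjective τ.cls := Submodule.Quotient.mk_surjective _

theorem cls_ι_of_mem_s {x : 𝔤} (hx : x ∈ τ.s) :
    τ.cls (UniversalEnvelopingAlgebra.ι k x) = 0 :=
  (Submodule.Quotient.mk_eq_zero _).2 (Submodule.subset_span ⟨x, hx, rfl⟩)

/-- A representation with a vector killed by `𝔰` induces a map on `U(𝔤) / U(𝔤)𝔰`. -/
def envLift {M : Type*} [AddCommGroup M] [Module k M] (ρ : 𝔤 →ₗ⁅k⁆ Module.End k M) (m : M)
    (hm : ∀ x ∈ τ.s, ρ x m = 0) : τ.Env →ₗ[k] M :=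
  (τ.leftIdeal.restrictScalars k).liftQ
    ((LinearMap.applyₗ m).comp (UniversalEnvelopingAlgebra.lift k ρ).toLinearMap) (by
    intro u hu
    rw [Submodule.restrictScalars_mem, leftIdeal] at hu
    change UniversalEnvelopingAlgebra.lift k ρ u m = 0
    induction hu using Submodule.span_induction with
    | mem u hu =>
      obtain ⟨x, hx, rfl⟩ := hu
      rw [UniversalEnvelopingAlgebra.lift_ι_apply]
      exact hm x hx
    | zero => rw [map_zero, LinearMap.zero_apply]
    | add u v _ _ hu hv => rw [map_add, LinearMap.add_apply, hu, hv, add_zero]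
    | smul w u _ hu => rw [smul_eq_mul, map_mul, Module.End.mul_apply, hu, map_zero])

theorem envLift_cls {M : Type*} [AddCommGroup M] [Module k M] (ρ : 𝔤 →ₗ⁅k⁆ Module.End k M) (m : M)
    (hm : ∀ x ∈ τ.s, ρ x m = 0) (u : UniversalEnvelopingAlgebra k 𝔤) :
    τ.envLift ρ m hm (τ.cls u) = UniversalEnvelopingAlgebra.lift k ρ u m := rfl

theorem envLift_smul {M : Type*} [AddCommGroup M] [Module k M] (ρ : 𝔤 →ₗ⁅k⁆ Module.End k M) (m : M)
    (hm : ∀ x ∈ τ.s, ρ x m = 0) (x : 𝔤) (n : ℕ) (e : τ.Env) :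
    τ.envLift ρ m hm (UniversalEnvelopingAlgebra.ι k x ^ n • e) = (ρ x ^ n) (τ.envLift ρ m hm e) := by
  obtain ⟨u, rfl⟩ := τ.cls_surjective e
  rw [smul_cls, envLift_cls, envLift_cls, map_mul, map_pow, UniversalEnvelopingAlgebra.lift_ι_apply]
  rfl

theorem envLift_cls_pow {M : Type*} [AddCommGroup M] [Module k M] (ρ : 𝔤 →ₗ⁅k⁆ Module.End k M)
    (m : M) (hm : ∀ x ∈ τ.s, ρ x m = 0) (x : 𝔤) (n : ℕ) :
    τ.envLift ρ m hm (τ.cls (UniversalEnvelopingAlgebra.ι k x ^ n)) = (ρ x ^ n) m := by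
  rw [envLift_cls, map_pow, UniversalEnvelopingAlgebra.lift_ι_apply]

variable {C : Type*} (b : Module.Basis C k τ.c) [LinearOrder C]

/-- The map sending a monomial to the class of the ordered product of its variables. -/
def orderedCls : MvPolynomial C k →ₗ[k] τ.Env :=
  (basisMonomials C k).constr k fun M => τ.cls
    ((Finsupp.toMultiset M).sort.map fun i => UniversalEnvelopingAlgebra.ι k (b i : 𝔤)).prod

theorem orderedCls_monomial (M : C →₀ ℕ) : τ.orderedCls b (monomial M 1) = τ.cls
    ((Finsupp.toMultiset M).sort.map fun i => UniversalEnvelopingAlgebra.ι k (b i : 𝔤)).prod := by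
  have h := (basisMonomials C k).constr_basis k (fun M => τ.cls
    ((Finsupp.toMultiset M).sort.map fun i => UniversalEnvelopingAlgebra.ι k (b i : 𝔤)).prod) M
  rwa [coe_basisMonomials] at h

theorem orderedCls_one : τ.orderedCls b 1 = τ.cls 1 := by
  rw [← C_1, ← monomial_zero', orderedCls_monomial]
  simp

theorem orderedCls_X_mul {i : C} {M : C →₀ ℕ} (hi : ∀ j ∈ M.support, i ≤ j) :
    τ.orderedCls b (X i * monomial M 1) =
      UniversalEnvelopingAlgebra.ι k (b i : 𝔤) • τ.orderedCls b (monomial M 1) := by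
  rw [X_mul_monomial_one, orderedCls_monomial, orderedCls_monomial, map_add,
    Finsupp.toMultiset_single, one_smul, Multiset.singleton_add, Multiset.sort_cons, List.map_cons,
    List.prod_cons, smul_cls]
  intro j hj
  exact hi j ((Finsupp.mem_toMultiset M j).1 hj)

/-- The recursion for the action mirrors the relation `x b_μ = b_μ x + [x, b_μ]` of `U(𝔤)`, so
induction on the degree shows that ordered products intertwine the two actions. As before, the top
part `σ(x) z_N` lies outside the induction and is handled separately. -/
theorem orderedCls_pbwAction_aux (n : ℕ) : ∀ p ∈ degreeLT k C n, ∀ x : 𝔤,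
    τ.orderedCls b (τ.pbwAction b x p) =
      UniversalEnvelopingAlgebra.ι k x • τ.orderedCls b p := by
  induction n with
  | zero =>
    intro p hp x
    rw [degreeLT_zero, Submodule.mem_bot] at hp
    simp only [hp, map_zero, smul_zero]
  | succ n ih =>
    intro p hp
    induction hp using Submodule.span_induction with
    | mem p hp =>
      obtain ⟨M, hM, rfl⟩ := hp
      have hle : ∀ i : C, (∀ j ∈ M.support, i ≤ j) →
          τ.orderedCls b (τ.pbwAction b (b i) (monomial M 1)) =
            UniversalEnvelopingAlgebra.ι k (b i : 𝔤) • τ.orderedCls b (monomial M 1) := by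
        intro i hi
        rw [τ.pbwAction_of_le b hi, τ.orderedCls_X_mul b hi]
      have hs : ∀ x, (x ∈ τ.s ∨ ∃ i, x = b i) →
          τ.orderedCls b (τ.pbwAction b x (monomial M 1)) =
            UniversalEnvelopingAlgebra.ι k x • τ.orderedCls b (monomial M 1) := by
        intro x hx
        rcases eq_or_ne M 0 with rfl | h0
        · rcases hx with hx | ⟨i, rfl⟩
          · rw [monomial_zero', C_1, pbwAction_one, τ.symbol_of_mem_s b hx, map_zero,
              orderedCls_one, smul_cls, mul_one, τ.cls_ι_of_mem_s hx]
          · exact hle i (by simp)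
        obtain ⟨μ, N, rfl, hμ⟩ := Finsupp.exists_eq_single_add h0
        rw [Finsupp.degree_single_add] at hM
        by_cases hxμ : τ.IsBasicGE b μ x
        · have hN := monomial_mem_degreeLT (k := k) (Nat.lt_of_succ_lt_succ hM)
          have hsym : τ.orderedCls b (τ.pbwAction b (b μ) (τ.symbol b x * monomial N 1)) =
              UniversalEnvelopingAlgebra.ι k (b μ : 𝔤) •
                τ.orderedCls b (τ.symbol b x * monomial N 1) := by
            rw [τ.pbwAction_symbol_mul b hμ hxμ]
            rcases hxμ with hx | ⟨i, hi, rfl⟩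
            · simp only [τ.symbol_of_mem_s b hx, zero_mul, mul_zero, map_zero, smul_zero]
            · rw [symbol_basis, X_mul_monomial_one]
              exact τ.orderedCls_X_mul b (Finsupp.le_of_mem_support_single_add hi hμ)
          have hw := ih _ (τ.pbwAction_sub_mem_degreeLT b x hN) (b μ)
          have h := congrArg₂ (· + ·) hw hsym
          simp only [← map_add, ← smul_add, sub_add_cancel] at h
          rw [← X_mul_monomial_one, τ.pbwAction_X_mul b hμ hxμ, map_add, h, ih _ hN, ih _ hN,
            τ.orderedCls_X_mul b hμ, LieHom.map_lie, LieRing.of_associative_ring_bracket, sub_smul,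
            mul_smul, mul_smul, add_sub_cancel]
        · rcases hx with hx | ⟨i, rfl⟩
          · exact absurd (Or.inl hx) hxμ
          · rcases le_total μ i with h | h
            · exact absurd (Or.inr ⟨i, h, rfl⟩) hxμ
            · exact hle i (Finsupp.le_of_mem_support_single_add h fun j hj => h.trans (hμ j hj))
      intro x
      refine τ.induction_basis b x (fun x hx => hs x (Or.inl hx)) (fun i => hs _ (Or.inr ⟨i, rfl⟩))
        (fun x z hx hz => ?_) fun a x hx => ?_
      · rw [map_add, map_add, LinearMap.add_apply, map_add, hx, hz, add_smul]
      · rw [map_smul, map_smul, LinearMap.smul_apply, map_smul, hx, smul_assoc]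
    | zero => intro x; simp only [map_zero, smul_zero]
    | add p q _ _ hp hq => intro x; simp only [map_add, hp x, hq x, smul_add]
    | smul a p _ hp => intro x; simp only [map_smul, hp x, smul_comm a]

theorem orderedCls_pbwAction (x : 𝔤) (p : MvPolynomial C k) :
    τ.orderedCls b (τ.pbwAction b x p) =
      UniversalEnvelopingAlgebra.ι k x • τ.orderedCls b p := by
  obtain ⟨n, hn⟩ := exists_mem_degreeLT p
  exact τ.orderedCls_pbwAction_aux b n p hn x

/-- The inverse of `orderedCls`. -/
def pbwCoord : τ.Env →ₗ[k] MvPolynomial C k :=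
  τ.envLift (τ.pbwHom b) 1 fun x hx => by
    rw [pbwHom_apply, pbwAction_one, τ.symbol_of_mem_s b hx]

theorem pbwCoord_one : τ.pbwCoord b (τ.cls 1) = 1 := by
  rw [pbwCoord, envLift_cls, map_one (UniversalEnvelopingAlgebra.lift k _), Module.End.one_apply]

theorem pbwCoord_ι_smul (x : 𝔤) (e : τ.Env) :
    τ.pbwCoord b (UniversalEnvelopingAlgebra.ι k x • e) =
      τ.pbwAction b x (τ.pbwCoord b e) := by
  obtain ⟨u, rfl⟩ := τ.cls_surjective e
  rw [smul_cls, pbwCoord, envLift_cls, envLift_cls, map_mul,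
    UniversalEnvelopingAlgebra.lift_ι_apply]
  rfl

/-- Both maps commute with `𝔤` and match the class of `1` with the polynomial `1`; the class of `1`
generates `U_τ`. -/
theorem orderedCls_pbwCoord (e : τ.Env) : τ.orderedCls b (τ.pbwCoord b e) = e := by
  obtain ⟨u, rfl⟩ := τ.cls_surjective e
  induction u using UniversalEnvelopingAlgebra.induction with
  | hone => rw [pbwCoord_one, orderedCls_one]
  | hι x u hu => rw [← smul_cls, pbwCoord_ι_smul, orderedCls_pbwAction, hu]
  | hadd u v hu hv => rw [map_add, map_add, map_add, hu, hv]
  | hsmul a u hu => rw [map_smul, map_smul, map_smul, hu]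

/-- In a sorted word each letter acts on a monomial without smaller variables, hence by
multiplication. -/
theorem pbwCoord_orderedCls (p : MvPolynomial C k) : τ.pbwCoord b (τ.orderedCls b p) = p := by
  have hmon : ∀ n, ∀ M : C →₀ ℕ, M.degree ≤ n →
      τ.pbwCoord b (τ.orderedCls b (monomial M 1)) = monomial M 1 := by
    intro n
    induction n with
    | zero =>
      intro M hM
      rw [(Finsupp.degree_eq_zero_iff M).1 (by omega), monomial_zero', C_1, orderedCls_one,
        pbwCoord_one]
    | succ n ih =>
      intro M hM
      rcases eq_or_ne M 0 with rfl | h0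
      · rw [monomial_zero', C_1, orderedCls_one, pbwCoord_one]
      obtain ⟨μ, N, rfl, hμ⟩ := Finsupp.exists_eq_single_add h0
      rw [Finsupp.degree_single_add] at hM
      rw [← X_mul_monomial_one, τ.orderedCls_X_mul b hμ, pbwCoord_ι_smul, ih N (by omega),
        τ.pbwAction_of_le b hμ]
  have h : τ.pbwCoord b ∘ₗ τ.orderedCls b = LinearMap.id := by
    refine (basisMonomials C k).ext fun M => ?_
    rw [coe_basisMonomials]
    exact hmon _ M le_rfl
  exact congr($h p)

theorem pbwCoord_bijective : Function.Bijective (τ.pbwCoord b) :=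
  ⟨Function.LeftInverse.injective (τ.orderedCls_pbwCoord b),
    Function.RightInverse.surjective (τ.pbwCoord_orderedCls b)⟩

end

/-! ### Symmetrization -/

section

variable {k 𝔤 : Type*} [Field k] [CharZero k] [LieRing 𝔤] [LieAlgebra k 𝔤] (τ : Triple k 𝔤)

/-- Symmetrization is the convolution exponential of the projection `k[𝔠] → 𝔠 ⊆ U(𝔤)`. -/
theorem exists_symmetrize : ∃ f : SymmetricAlgebra k τ.c →ₗ[k] UniversalEnvelopingAlgebra k 𝔤,
    ∀ (c : τ.c) (n : ℕ), f (SymmetricAlgebra.ι k τ.c c ^ n) =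
      UniversalEnvelopingAlgebra.ι k (c : 𝔤) ^ n := by
  obtain ⟨π, hπ⟩ := SymmetricAlgebra.exists_projection (k := k) (V := τ.c)
  obtain ⟨f, hf⟩ := Coalgebra.exists_linearMap_apply_eq_pow
    (fun (c : τ.c) n => SymmetricAlgebra.ι k τ.c c ^ n)
    SymmetricAlgebra.isBinomial_ι_pow SymmetricAlgebra.span_ι_pow
    ((UniversalEnvelopingAlgebra.ι k : 𝔤 →ₗ⁅k⁆ UniversalEnvelopingAlgebra k 𝔤).toLinearMap ∘ₗ τ.c.subtype ∘ₗ π) (fun c n hn => by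
      rw [LinearMap.comp_apply, LinearMap.comp_apply, hπ, if_neg hn, map_zero, map_zero])
  refine ⟨f, fun c n => ?_⟩
  rw [hf, LinearMap.comp_apply, LinearMap.comp_apply, hπ, if_pos rfl]
  rfl

/-- The symmetrization map `k[𝔠] → U(𝔤)`. -/
def symmetrize : SymmetricAlgebra k τ.c →ₗ[k] UniversalEnvelopingAlgebra k 𝔤 :=
  τ.exists_symmetrize.choose

theorem symmetrize_ι_pow (c : τ.c) (n : ℕ) : τ.symmetrize (SymmetricAlgebra.ι k τ.c c ^ n) =
    UniversalEnvelopingAlgebra.ι k (c : 𝔤) ^ n := τ.exists_symmetrize.choose_spec c n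

/-- In polynomial coordinates the map fixes `n`-th powers of linear forms modulo lower degree. By
polarization the same holds for all monomials, so the map is unitriangular. -/
theorem cls_symmetrize_bijective : Function.Bijective (τ.cls ∘ₗ τ.symmetrize) := by
  let b := Module.Basis.ofVectorSpace k τ.c
  let _ : LinearOrder (Module.Basis.ofVectorSpaceIndex k τ.c) :=
    IsWellOrder.linearOrder WellOrderingRel
  let e := SymmetricAlgebra.equivMvPolynomial b
  have he : ∀ c, e (SymmetricAlgebra.ι k τ.c c) = τ.symbol b c := by
    have h : e.toLinearMap ∘ₗ SymmetricAlgebra.ι k τ.c = τ.symbol b ∘ₗ τ.c.subtype := by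
      refine b.ext fun i => ?_
      rw [LinearMap.comp_apply, LinearMap.comp_apply, Submodule.subtype_apply, symbol_basis]
      exact SymmetricAlgebra.equivMvPolynomial_ι_apply b i
    exact fun c => congr($h c)
  let F := τ.pbwCoord b ∘ₗ (τ.cls ∘ₗ τ.symmetrize) ∘ₗ e.symm.toLinearMap
  have hpow : ∀ (c : τ.c) n, F (τ.symbol b c ^ n) - τ.symbol b c ^ n ∈
      degreeLT k (Module.Basis.ofVectorSpaceIndex k τ.c) n := by
    intro c n
    have hF : ∀ n, F (τ.symbol b c ^ n) =
        τ.pbwCoord b (τ.cls (UniversalEnvelopingAlgebra.ι k (c : 𝔤) ^ n)) := by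
      intro n
      change τ.pbwCoord b (τ.cls (τ.symmetrize (e.symm _))) = _
      rw [← he, ← map_pow, AlgEquiv.symm_apply_apply, symmetrize_ι_pow]
    induction n with
    | zero => rw [hF, pow_zero, pow_zero, pbwCoord_one, sub_self]; exact zero_mem _
    | succ n ih =>
      have h1 := τ.symbol_mul_mem_degreeLT b (c : 𝔤) ih
      have hmem : F (τ.symbol b c ^ n) ∈
          degreeLT k (Module.Basis.ofVectorSpaceIndex k τ.c) (n + 1) := by
        have : ∀ n, τ.symbol b c ^ n ∈
            degreeLT k (Module.Basis.ofVectorSpaceIndex k τ.c) (n + 1) := by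
          intro n
          induction n with
          | zero =>
            rw [pow_zero, ← C_1, ← monomial_zero']
            exact monomial_mem_degreeLT (by simp)
          | succ n ih => rw [pow_succ']; exact τ.symbol_mul_mem_degreeLT b _ ih
        have h := add_mem (degreeLT_mono (Nat.le_succ n) ih) (this n)
        rwa [sub_add_cancel] at h
      have h2 := τ.pbwAction_sub_mem_degreeLT b (c : 𝔤) hmem
      have h3 := add_mem h1 h2
      rw [hF, ← pbwCoord_ι_smul, smul_cls, ← pow_succ', ← hF, ← hF, mul_sub, ← pow_succ',
        add_comm (_ - _), sub_add_sub_cancel] at h3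
      exact h3
  -- Polarization needs each monomial as a product of exactly as many linear forms as its degree.
  have hprod : ∀ n, ∀ M : Module.Basis.ofVectorSpaceIndex k τ.c →₀ ℕ, M.degree = n →
      ∃ c : Fin n → MvPolynomial (Module.Basis.ofVectorSpaceIndex k τ.c) k,
        (∀ i, c i ∈ LinearMap.range (τ.symbol b ∘ₗ τ.c.subtype)) ∧
        monomial M 1 = ∏ i, c i := by
    intro n
    induction n with
    | zero =>
      intro M hM
      refine ⟨fun _ => 0, fun _ => zero_mem _, ?_⟩
      rw [(Finsupp.degree_eq_zero_iff M).1 hM, monomial_zero', C_1]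
      simp
    | succ n ih =>
      intro M hM
      have h0 : M ≠ 0 := by
        rintro rfl
        simp at hM
      obtain ⟨μ, N, rfl, -⟩ := Finsupp.exists_eq_single_add h0
      rw [Finsupp.degree_single_add] at hM
      obtain ⟨c, hc, hN⟩ := ih N (by omega)
      refine ⟨Fin.cons (X μ) c, fun i => ?_, ?_⟩
      · refine Fin.cases ⟨b μ, ?_⟩ (fun i => by simpa using hc i) i
        rw [LinearMap.comp_apply, Submodule.subtype_apply, symbol_basis, Fin.cons_zero]
      · rw [Fin.prod_univ_succ, Fin.cons_zero, ← X_mul_monomial_one, hN]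
        simp
  have hF : Function.Bijective F := by
    refine bijective_of_sub_mem_degreeLT F fun M => ?_
    obtain ⟨c, hc, hM⟩ := hprod _ M rfl
    have hmem := prod_mem_span_pow _ c hc
    rw [← hM] at hmem
    generalize monomial M (1 : k) = p at hmem
    induction hmem using Submodule.span_induction with
    | mem p hp =>
      obtain ⟨_, ⟨v, rfl⟩, rfl⟩ := hp
      exact hpow v _
    | zero => rw [map_zero, sub_zero]; exact zero_mem _
    | add p q _ _ hp hq => rw [map_add, add_sub_add_comm]; exact add_mem hp hq
    | smul a p _ hp => rw [map_smul, ← smul_sub]; exact Submodule.smul_mem _ a hp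
  have h1 : Function.Bijective ((τ.cls ∘ₗ τ.symmetrize) ∘ e.symm) :=
    (Function.Bijective.of_comp_iff' (τ.pbwCoord_bijective b) _).1 hF
  exact (Function.Bijective.of_comp_iff _ e.symm.bijective).1 h1

end

end Triple


/-! ### Divisions as convolution inverses -/

namespace Coalgebra

section

variable {k C : Type*} [Field k] [AddCommGroup C] [Module k C] [Coalgebra k C]

theorem IsCoderivation.counit_pow {f : Module.End k C} (hf : IsCoderivation f) (n : ℕ) (x : C) :
    counit (R := k) ((f ^ n) x) = if n = 0 then counit (R := k) x else 0 := by
  rcases n with _ | n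
  · rfl
  · rw [pow_succ', Module.End.mul_apply, hf.counit_apply, if_neg n.succ_ne_zero]

-- Through this translation the two left division laws say that `ldiv` is a two-sided convolution
-- inverse of `mul`.
open WithConv in
theorem lift_compl₂_flip_comul (f g : C →ₗ[k] Module.End k C) (u v : C) :
    TensorProduct.lift (f.compl₂ (g.flip v)) (comul (R := k) u) =
      (toConv f * toConv g) u v := by
  rw [LinearMap.convMul_apply]
  generalize comul (R := k) u = t
  induction t with
  | zero => simp
  | tmul a b => rfl
  | add a b ha hb => rw [map_add, map_add, map_add, ha, hb, LinearMap.add_apply]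

-- Composition of right multiplications reverses the legs of the coproduct; cocommutativity restores
-- their order.
open WithConv in
theorem lift_comp_comul [IsCocomm k C] (f g : C →ₗ[k] Module.End k C) (u v : C) :
    TensorProduct.lift (f ∘ₗ g u) (comul (R := k) v) =
      (toConv f.flip * toConv g.flip) v u := by
  rw [LinearMap.convMul_apply]
  conv_rhs => rw [← comm_comul (R := k) v]
  generalize comul (R := k) v = t
  induction t with
  | zero => simp
  | tmul a b => rfl
  | add a b ha hb => rw [map_add, map_add, map_add, map_add, ha, hb, LinearMap.add_apply]

end

end Coalgebra

theorem List.reverse_ofFn {α : Type*} {n : ℕ} (f : Fin n → α) :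
    (List.ofFn f).reverse = List.ofFn fun i => f i.rev := by
  refine List.ext_getElem (by simp) fun i h1 h2 => ?_
  rw [List.getElem_reverse, List.getElem_ofFn, List.getElem_ofFn]
  congr 1
  ext
  simp [Fin.rev]
  omega

/-- The divisions are convolution inverses of left and right multiplication, and inverses are
unique. -/
theorem NonAssocHopfAlgebra.ext_of_mul_of_one {k U : Type*} [Field k] [AddCommGroup U] [Module k U]
    [Coalgebra k U] [Coalgebra.IsCocomm k U] {H H' : NonAssocHopfAlgebra k U}
    (hmul : H.mul = H'.mul) (hone : H.one = H'.one) : H = H' := by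
  have hl : H.ldiv = H'.ldiv := by
    refine WithConv.toConv_injective (left_inv_eq_right_inv (a := WithConv.toConv H.mul) ?_ ?_)
    · refine WithConv.ofConv_injective (LinearMap.ext fun u => LinearMap.ext fun v => ?_)
      exact (Coalgebra.lift_compl₂_flip_comul H.ldiv H.mul u v).symm.trans (H.ldiv_mul u v)
    · rw [hmul]
      refine WithConv.ofConv_injective (LinearMap.ext fun u => LinearMap.ext fun v => ?_)
      exact (Coalgebra.lift_compl₂_flip_comul H'.mul H'.ldiv u v).symm.trans (H'.mul_ldiv u v)
  have hr : H.rdiv = H'.rdiv := by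
    have : H.rdiv.flip = H'.rdiv.flip := by
      refine WithConv.toConv_injective
        (left_inv_eq_right_inv (a := WithConv.toConv H.mul.flip) ?_ ?_)
      · refine WithConv.ofConv_injective (LinearMap.ext fun v => LinearMap.ext fun u => ?_)
        exact (Coalgebra.lift_comp_comul H.rdiv H.mul u v).symm.trans (H.mul_rdiv u v)
      · rw [hmul]
        refine WithConv.ofConv_injective (LinearMap.ext fun v => LinearMap.ext fun u => ?_)
        exact (Coalgebra.lift_comp_comul H'.mul H'.rdiv u v).symm.trans (H'.rdiv_mul u v)
    rw [← LinearMap.flip_flip H.rdiv, this, LinearMap.flip_flip]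
  obtain ⟨⟨mul, one, _, _, _, _, _, _⟩, ldiv, rdiv, _, _, _, _⟩ := H
  obtain ⟨⟨mul', one', _, _, _, _, _, _⟩, ldiv', rdiv', _, _, _, _⟩ := H'
  subst hmul hone hl hr
  rfl

/-! ### The Hopf algebra structure on `U(𝔤) / U(𝔤)𝔰` -/

namespace Triple

open UniversalEnvelopingAlgebra

section

variable {k 𝔤 : Type*} [Field k] [LieRing 𝔤] [LieAlgebra k 𝔤] (τ : Triple k 𝔤)

/-- The left action of `𝔤` on `U(𝔤) / U(𝔤)𝔰`. -/
def leftAction : 𝔤 →ₗ⁅k⁆ Module.End k τ.Env :=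
  LieHom.comp (AlgHom.toLieHom (Algebra.lsmul k k τ.Env)) (ι k)

theorem leftAction_apply (x : 𝔤) (e : τ.Env) : τ.leftAction x e = ι k x • e := rfl

theorem leftAction_pow_apply (x : 𝔤) (n : ℕ) (e : τ.Env) :
    (τ.leftAction x ^ n) e = ι k x ^ n • e := by
  induction n with
  | zero => rw [pow_zero, pow_zero, one_smul]; rfl
  | succ n ih => rw [pow_succ', pow_succ', Module.End.mul_apply, ih, leftAction_apply, mul_smul]

theorem isCoderivation_leftAction (x : 𝔤) : Coalgebra.IsCoderivation (k := k) (τ.leftAction x) := by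
  intro e
  obtain ⟨u, rfl⟩ := τ.cls_surjective e
  rw [leftAction_apply, smul_cls, comul_cls, comul_cls, Bialgebra.comul_mul, comul_ι]
  generalize Coalgebra.comul (R := k) u = t
  induction t with
  | zero => simp
  | tmul a b =>
    rw [add_mul, Algebra.TensorProduct.tmul_mul_tmul, Algebra.TensorProduct.tmul_mul_tmul, map_add,
      one_mul, one_mul]
    rfl
  | add a b ha hb =>
    rw [mul_add, map_add, ha, hb]
    simp only [map_add]
    abel

theorem comul_cls_one : Coalgebra.comul (R := k) (τ.cls 1) = τ.cls 1 ⊗ₜ[k] τ.cls 1 := by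
  rw [comul_cls, Bialgebra.comul_one, Algebra.TensorProduct.one_def, TensorProduct.map_tmul]

theorem counit_cls_one : Coalgebra.counit (R := k) (τ.cls 1) = 1 := by
  rw [counit_cls, Bialgebra.counit_one]

theorem leftAction_pow_cls_one (x : 𝔤) (n : ℕ) :
    (τ.leftAction x ^ n) (τ.cls 1) = τ.cls (ι k x ^ n) := by
  rw [leftAction_pow_apply, smul_cls, mul_one]

theorem isBinomial_cls_pow (x : 𝔤) : Coalgebra.IsBinomial (k := k) fun n => τ.cls (ι k x ^ n) := by
  have h := (τ.isCoderivation_leftAction x).isBinomial τ.comul_cls_one τ.counit_cls_one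
  simpa only [leftAction_pow_cls_one] using h

theorem sum_perm_prod_ι {n : ℕ} (c : Fin n → τ.c) :
    ∑ σ : Equiv.Perm (Fin n), (List.ofFn fun i => ι k (c (σ i) : 𝔤)).prod =
      ∑ T : Finset (Fin n), (-1 : ℤ) ^ T.card • ι k ((∑ i ∈ Tᶜ, c i : τ.c) : 𝔤) ^ n := by
  rw [sum_perm_prod_ofFn fun i => ι k (c i : 𝔤)]
  refine Finset.sum_congr rfl fun T _ => ?_
  rw [AddSubmonoidClass.coe_finsetSum, map_sum]

variable [CharZero k]

theorem span_cls_pow :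
    Submodule.span k (Set.range fun x : τ.c × ℕ => τ.cls (ι k (x.1 : 𝔤) ^ x.2)) = ⊤ := by
  have h := congrArg (Submodule.map (τ.cls ∘ₗ τ.symmetrize))
    (SymmetricAlgebra.span_ι_pow (k := k) (V := τ.c))
  rw [Submodule.map_span, ← Set.range_comp, Submodule.map_top,
    LinearMap.range_eq_top.2 τ.cls_symmetrize_bijective.2] at h
  rw [← h]
  congr 2
  ext x
  exact congrArg τ.cls (τ.symmetrize_ι_pow x.1 x.2).symm

theorem linearMap_ext_cls_pow {M : Type*} [AddCommGroup M] [Module k M] {f g : τ.Env →ₗ[k] M}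
    (h : ∀ (c : τ.c) n, f (τ.cls (ι k (c : 𝔤) ^ n)) = g (τ.cls (ι k (c : 𝔤) ^ n))) : f = g :=
  LinearMap.ext_on τ.span_cls_pow (by rintro _ ⟨⟨c, n⟩, rfl⟩; exact h c n)

/-- The isomorphism of coalgebras `k[𝔠] ≅ U(𝔤) / U(𝔤)𝔰` induced by symmetrization. -/
def envEquiv : SymmetricAlgebra k τ.c ≃ₗc[k] τ.Env where
  __ := Coalgebra.coalgHomOfIsBinomial (fun (c : τ.c) n => SymmetricAlgebra.ι k τ.c c ^ n)
    (fun c n => τ.cls (ι k (c : 𝔤) ^ n)) SymmetricAlgebra.isBinomial_ι_pow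
    (fun c => τ.isBinomial_cls_pow c) SymmetricAlgebra.span_ι_pow
    (τ.cls ∘ₗ τ.symmetrize) (fun c n => congrArg τ.cls (τ.symmetrize_ι_pow c n))
  __ := LinearEquiv.ofBijective (τ.cls ∘ₗ τ.symmetrize) τ.cls_symmetrize_bijective

theorem envEquiv_ι_pow (c : τ.c) (n : ℕ) :
    τ.envEquiv (SymmetricAlgebra.ι k τ.c c ^ n) = τ.cls (ι k (c : 𝔤) ^ n) :=
  congrArg τ.cls (τ.symmetrize_ι_pow c n)

theorem envEquiv_ι (c : τ.c) : τ.envEquiv (SymmetricAlgebra.ι k τ.c c) = τ.cls (ι k (c : 𝔤)) := by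
  simpa using τ.envEquiv_ι_pow c 1

theorem envEquiv_one : τ.envEquiv 1 = τ.cls 1 := by
  simpa using τ.envEquiv_ι_pow 0 0

/-- The section of `U(𝔤) → U(𝔤) / U(𝔤)𝔰` whose image consists of the symmetrized elements. -/
def envSection : τ.Env →ₗ[k] UniversalEnvelopingAlgebra k 𝔤 :=
  τ.symmetrize ∘ₗ τ.envEquiv.toLinearEquiv.symm.toLinearMap

theorem envSection_cls_pow (c : τ.c) (n : ℕ) :
    τ.envSection (τ.cls (ι k (c : 𝔤) ^ n)) = ι k (c : 𝔤) ^ n := by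
  rw [← envEquiv_ι_pow, ← τ.symmetrize_ι_pow]
  exact congrArg τ.symmetrize (τ.envEquiv.toLinearEquiv.symm_apply_apply _)

/-- The product on `U(𝔤) / U(𝔤)𝔰`. -/
def envMul : τ.Env →ₗ[k] τ.Env →ₗ[k] τ.Env :=
  -- The second factor is lifted to its symmetrized representative in `U(𝔤)`, which acts from the
  -- left on the first factor.
  ((Algebra.lsmul k k τ.Env).toLinearMap ∘ₗ τ.envSection).flip

theorem envMul_cls_pow (e : τ.Env) (c : τ.c) (n : ℕ) :
    τ.envMul e (τ.cls (ι k (c : 𝔤) ^ n)) = ι k (c : 𝔤) ^ n • e := by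
  change τ.envSection _ • e = _
  rw [envSection_cls_pow]

theorem envMul_cls_pow' (e : τ.Env) (c : τ.c) (n : ℕ) :
    τ.envMul e (τ.cls (ι k (c : 𝔤) ^ n)) = (τ.leftAction c ^ n) e := by
  rw [envMul_cls_pow, leftAction_pow_apply]

theorem envMul_one (e : τ.Env) : τ.envMul e (τ.cls 1) = e := by
  simpa using τ.envMul_cls_pow e 0 0

theorem one_envMul (e : τ.Env) : τ.envMul (τ.cls 1) e = e := by
  have h : τ.envMul (τ.cls 1) = LinearMap.id := τ.linearMap_ext_cls_pow fun c n => by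
    rw [envMul_cls_pow, smul_cls, mul_one, LinearMap.id_apply]
  exact congr($h e)

/-- The bialgebra structure on `U(𝔤) / U(𝔤)𝔰`. -/
def envBialgebra : NonAssocBialgebra k τ.Env where
  mul := τ.envMul
  one := τ.cls 1
  one_mul := τ.one_envMul
  mul_one := τ.envMul_one
  comul_one := τ.comul_cls_one
  counit_one := τ.counit_cls_one
  counit_mul u v := by
    have h : Coalgebra.counit ∘ₗ τ.envMul u =
        Coalgebra.counit (R := k) u • Coalgebra.counit (R := k) (A := τ.Env) := by
      refine τ.linearMap_ext_cls_pow fun c n => ?_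
      rw [LinearMap.comp_apply, envMul_cls_pow', (τ.isCoderivation_leftAction _).counit_pow,
        LinearMap.smul_apply, (τ.isBinomial_cls_pow _).counit_apply]
      split_ifs <;> simp
    exact congr($h v)
  comul_mul u v := by
    have h : Coalgebra.comul ∘ₗ τ.envMul u =
        TensorProduct.map₂ τ.envMul τ.envMul (Coalgebra.comul u) ∘ₗ
          Coalgebra.comul (R := k) (A := τ.Env) := by
      -- For `v = [c ^ n]` the map `u ↦ u v` is a power of a coderivation, so both sides expand into
      -- the same binomial sum.
      refine τ.linearMap_ext_cls_pow fun c n => ?_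
      rw [LinearMap.comp_apply, LinearMap.comp_apply, envMul_cls_pow',
        (τ.isCoderivation_leftAction _).comul_pow, (τ.isBinomial_cls_pow _).comul_apply, map_sum]
      refine Finset.sum_congr rfl fun ij _ => ?_
      rw [map_nsmul]
      congr 1
      generalize Coalgebra.comul (R := k) u = t
      induction t with
      | zero => simp
      | tmul a b =>
        rw [TensorProduct.map_tmul, TensorProduct.map₂_apply_tmul, TensorProduct.map_tmul,
          envMul_cls_pow', envMul_cls_pow']
      | add a b ha hb => rw [map_add, map_add, LinearMap.add_apply, ha, hb]
    exact congr($h v)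

/-- All sequences `n ↦ [c ^ n]` start at the unit, and multiplication by the unit is the identity.
-/
theorem isUnit_envMul :
    IsUnit (WithConv.toConv τ.envMul : WithConv (τ.Env →ₗ[k] Module.End k τ.Env)) :=
  Coalgebra.isUnit_conv_of_isBinomial (fun (c : τ.c) n => τ.cls (ι k (c : 𝔤) ^ n))
    (fun c => τ.isBinomial_cls_pow c) τ.span_cls_pow _ fun c => LinearMap.ext fun e => by
      rw [pow_zero]
      exact τ.one_envMul e

theorem isUnit_envMul_flip :
    IsUnit (WithConv.toConv τ.envMul.flip : WithConv (τ.Env →ₗ[k] Module.End k τ.Env)) :=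
  Coalgebra.isUnit_conv_of_isBinomial (fun (c : τ.c) n => τ.cls (ι k (c : 𝔤) ^ n))
    (fun c => τ.isBinomial_cls_pow c) τ.span_cls_pow _ fun c => LinearMap.ext fun e => by
      rw [pow_zero]
      exact τ.envMul_one e

/-- The Hopf algebra structure on `U(𝔤) / U(𝔤)𝔰`. -/
def envHopf : NonAssocHopfAlgebra k τ.Env where
  __ := τ.envBialgebra
  ldiv := (↑τ.isUnit_envMul.unit⁻¹ : WithConv (τ.Env →ₗ[k] Module.End k τ.Env)).ofConv
  rdiv := (↑τ.isUnit_envMul_flip.unit⁻¹ : WithConv (τ.Env →ₗ[k] Module.End k τ.Env)).ofConv.flip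
  ldiv_mul u v := by
    exact (Coalgebra.lift_compl₂_flip_comul _ τ.envMul u v).trans
      congr((WithConv.ofConv $(τ.isUnit_envMul.val_inv_mul)) u v)
  mul_ldiv u v := by
    exact (Coalgebra.lift_compl₂_flip_comul τ.envMul _ u v).trans
      congr((WithConv.ofConv $(τ.isUnit_envMul.mul_val_inv)) u v)
  mul_rdiv u v := by
    exact (Coalgebra.lift_comp_comul _ τ.envMul u v).trans
      congr((WithConv.ofConv $(τ.isUnit_envMul_flip.val_inv_mul)) v u)
  rdiv_mul u v := by
    exact (Coalgebra.lift_comp_comul τ.envMul _ u v).trans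
      congr((WithConv.ofConv $(τ.isUnit_envMul_flip.mul_val_inv)) v u)

/-- Reversing words permutes the symmetric group, so the reversed sum is the same symmetrized
element of `U(𝔤)`; polarization then reduces the formula to powers. -/
theorem isProduct_envMul : τ.IsProduct τ.envMul := by
  intro n c u
  have hrev : ∑ σ : Equiv.Perm (Fin n), (List.ofFn fun i => ι k (c (σ i) : 𝔤)).reverse.prod =
      ∑ σ : Equiv.Perm (Fin n), (List.ofFn fun i => ι k (c (σ i) : 𝔤)).prod := by
    refine Fintype.sum_equiv (Equiv.mulRight Fin.revPerm) _ _ fun σ => ?_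
    rw [List.reverse_ofFn]
    rfl
  rw [← map_sum, ← map_sum, ← Finset.sum_mul, hrev, sum_perm_prod_ι, map_sum, map_sum,
    Finset.sum_mul, map_sum]
  refine Finset.sum_congr rfl fun T _ => ?_
  rw [map_zsmul, map_zsmul, envMul_cls_pow, smul_mul_assoc, map_zsmul, smul_cls]

/-- Equal entries `c₁ = ⋯ = cₙ = c` give `n!` times the value at `[c ^ n]`; dividing by `n!`
determines the product on a spanning set. -/
theorem IsProduct.eq_envMul {μ : τ.Env →ₗ[k] τ.Env →ₗ[k] τ.Env} (hμ : τ.IsProduct μ) :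
    μ = τ.envMul := by
  refine LinearMap.ext fun e => τ.linearMap_ext_cls_pow fun c n => ?_
  obtain ⟨u, rfl⟩ := τ.cls_surjective e
  have h := hμ n (fun _ => c) u
  simp only [List.ofFn_const, List.reverse_replicate, List.prod_replicate, Finset.sum_const,
    Finset.card_univ, Fintype.card_perm, Fintype.card_fin, map_nsmul] at h
  rw [← Nat.cast_smul_eq_nsmul k, ← Nat.cast_smul_eq_nsmul k] at h
  rw [envMul_cls_pow, smul_cls]
  exact smul_right_injective _ (Nat.cast_ne_zero.2 n.factorial_ne_zero : (n.factorial : k) ≠ 0) h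

theorem eq_envHopf {H : NonAssocHopfAlgebra k τ.Env} (hH : τ.IsProduct H.mul) : H = τ.envHopf := by
  have hmul := hH.eq_envMul
  refine NonAssocHopfAlgebra.ext_of_mul_of_one hmul ?_
  -- The product of the unit of `H` with `[1]` is `[1]` by the unit law of `H`, and the unit of `H`
  -- because `[1]` is a right unit.
  have h := H.one_mul (τ.cls 1)
  rwa [hmul, envMul_one] at h

end

end Triple


/-! ### Equivalence of triples -/

namespace Triple

section

variable {k 𝔤 𝔤' 𝔤'' : Type*} [Field k] [LieRing 𝔤] [LieAlgebra k 𝔤] [LieRing 𝔤']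
  [LieAlgebra k 𝔤'] [LieRing 𝔤''] [LieAlgebra k 𝔤'']
  {τ : Triple k 𝔤} {τ' : Triple k 𝔤'} {τ'' : Triple k 𝔤''}

/-- Composition of morphisms of triples. -/
def Hom.comp (ψ : Hom τ' τ'') (φ : Hom τ τ') : Hom τ τ'' where
  toLieHom := ψ.toLieHom.comp φ.toLieHom
  map_s x hx := ψ.map_s _ (φ.map_s x hx)
  map_c x hx := ψ.map_c _ (φ.map_c x hx)

/-- The inverse of an isomorphism of triples. -/
def Iso.symm (e : Iso τ τ') : Iso τ' τ where
  toLieEquiv := e.toLieEquiv.symm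
  mem_s_iff x := by
    rw [← e.mem_s_iff, LieEquiv.apply_symm_apply]
  mem_c_iff x := by
    rw [← e.mem_c_iff, LieEquiv.apply_symm_apply]

/-- Composition of isomorphisms of triples. -/
def Iso.trans (e : Iso τ τ') (e' : Iso τ' τ'') : Iso τ τ'' where
  toLieEquiv := e.toLieEquiv.trans e'.toLieEquiv
  mem_s_iff x := (e'.mem_s_iff _).trans (e.mem_s_iff x)
  mem_c_iff x := (e'.mem_c_iff _).trans (e.mem_c_iff x)

/-- The morphism underlying an isomorphism of triples. -/
def Iso.toHom (e : Iso τ τ') : Hom τ τ' where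
  toLieHom := e.toLieEquiv.toLieHom
  map_s x hx := (e.mem_s_iff x).2 hx
  map_c x hx := (e.mem_c_iff x).2 hx

theorem Equivalent.symm (h : Equivalent τ τ') : Equivalent τ' τ := h.map Iso.symm

theorem Equivalent.trans (h : Equivalent τ τ') (h' : Equivalent τ' τ'') : Equivalent τ τ'' :=
  h.map2 Iso.trans h'

/-- Morphisms of triples that are bijective on `𝔠`. -/
def Hom.BijectiveOnC (φ : Hom τ τ') : Prop := Set.BijOn φ.toLieHom τ.c τ'.c

theorem Hom.BijectiveOnC.comp {ψ : Hom τ' τ''} {φ : Hom τ τ'} (hψ : ψ.BijectiveOnC)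
    (hφ : φ.BijectiveOnC) : (ψ.comp φ).BijectiveOnC := by
  change Set.BijOn (ψ.toLieHom ∘ φ.toLieHom) _ _
  exact Set.BijOn.comp hψ hφ

theorem Iso.bijectiveOnC_toHom (e : Iso τ τ') : e.toHom.BijectiveOnC :=
  ⟨fun x hx => (e.mem_c_iff x).2 hx, e.toLieEquiv.injective.injOn, fun y hy =>
    ⟨e.toLieEquiv.symm y, e.symm.toHom.map_c y hy, e.toLieEquiv.apply_symm_apply y⟩⟩

/-- If the image lies in `𝔰'`, so does the image of the `𝔠`-component; it lies in `𝔠'` as well,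
hence is zero, and injectivity on `𝔠` kills the component. -/
theorem Hom.BijectiveOnC.mem_s_iff {φ : Hom τ τ'} (hφ : φ.BijectiveOnC) (x : 𝔤) :
    φ.toLieHom x ∈ τ'.s ↔ x ∈ τ.s := by
  refine ⟨fun h => ?_, φ.map_s x⟩
  obtain ⟨y, hy, z, hz, rfl⟩ := Submodule.mem_sup.1
    (τ.isCompl.codisjoint.eq_top ▸ Submodule.mem_top : x ∈ τ.s.toSubmodule ⊔ τ.c)
  rw [map_add] at h
  have hzs : φ.toLieHom z ∈ τ'.s := by
    have := sub_mem h (φ.map_s y hy)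
    rwa [add_sub_cancel_left] at this
  have hz0 : φ.toLieHom z = φ.toLieHom 0 := by
    rw [map_zero]
    exact Submodule.disjoint_def.1 τ'.isCompl.disjoint _ hzs (φ.map_c z hz)
  rw [hφ.injOn hz τ.c.zero_mem hz0, add_zero]
  exact hy

/-- The preimage of the core is an ideal inside `𝔰` by `mem_s_iff`; by surjectivity the image of the
core is an ideal, and it lies inside `𝔰'`. -/
theorem Hom.BijectiveOnC.mem_core_iff {φ : Hom τ τ'} (hφ : φ.BijectiveOnC)
    (hsurj : Function.Surjective φ.toLieHom) (x : 𝔤) :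
    φ.toLieHom x ∈ τ'.core ↔ x ∈ τ.core := by
  constructor
  · intro hx
    have hle : LieIdeal.comap φ.toLieHom τ'.core ≤ τ.core :=
      τ.isGreatest_core.2 fun y hy =>
        (hφ.mem_s_iff y).1 (τ'.isGreatest_core.1 (LieIdeal.mem_comap.1 hy))
    exact hle (LieIdeal.mem_comap.2 hx)
  · intro hx
    let I : LieIdeal k 𝔤' :=
      { τ.core.toSubmodule.map (φ.toLieHom : 𝔤 →ₗ[k] 𝔤') with
        lie_mem := by
          rintro y _ ⟨z, hz, rfl⟩
          obtain ⟨w, rfl⟩ := hsurj y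
          exact ⟨⁅w, z⁆, τ.core.lie_mem hz, LieHom.map_lie _ _ _⟩ }
    have hle : I ≤ τ'.core := τ'.isGreatest_core.2 (by
      rintro _ ⟨z, hz, rfl⟩
      exact φ.map_s z (τ.isGreatest_core.1 hz))
    exact hle ⟨x, hx, rfl⟩

/-- The morphism `τ_inn → τ`. -/
def innHom (τ : Triple k 𝔤) : Hom τ.inn τ where
  toLieHom := τ.gInn.incl
  map_s _ hx := hx
  map_c _ hx := hx

theorem bijectiveOnC_innHom (τ : Triple k 𝔤) : τ.innHom.BijectiveOnC :=
  ⟨fun _ hx => hx, Subtype.val_injective.injOn, fun x hx =>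
    ⟨⟨x, LieSubalgebra.subset_lieSpan hx⟩, hx, rfl⟩⟩

/-- The morphism from a triple to its quotient by the core. -/
def modCoreHom (τ : Triple k 𝔤) : Hom τ τ.modCore where
  toLieHom :=
    { τ.core.toSubmodule.mkQ with
      map_lie' := rfl }
  map_s x hx := ⟨x, hx, rfl⟩
  map_c x hx := ⟨x, hx, rfl⟩

theorem modCoreHom_surjective (τ : Triple k 𝔤) : Function.Surjective τ.modCoreHom.toLieHom :=
  Submodule.mkQ_surjective _

theorem modCoreHom_eq_iff (τ : Triple k 𝔤) (x y : 𝔤) :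
    τ.modCoreHom.toLieHom x = τ.modCoreHom.toLieHom y ↔ x - y ∈ τ.core :=
  Submodule.Quotient.eq _

theorem bijectiveOnC_modCoreHom (τ : Triple k 𝔤) : τ.modCoreHom.BijectiveOnC := by
  refine ⟨τ.modCoreHom.map_c, fun x hx y hy hxy => ?_, fun _ ⟨x, hx, h⟩ => ⟨x, hx, h⟩⟩
  have h := τ.isGreatest_core.1 ((τ.modCoreHom_eq_iff x y).1 hxy)
  exact sub_eq_zero.1 (Submodule.disjoint_def.1 τ.isCompl.disjoint _ h (sub_mem hx hy))

/-- A surjective morphism that is bijective on `𝔠` induces an isomorphism modulo the cores. -/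
theorem Hom.BijectiveOnC.nonempty_iso_modCore {φ : Hom τ τ'} (hφ : φ.BijectiveOnC)
    (hsurj : Function.Surjective φ.toLieHom) : Nonempty (Iso τ.modCore τ'.modCore) := by
  let f : 𝔤 ⧸ τ.core →ₗ⁅k⁆ 𝔤' ⧸ τ'.core :=
    { τ.core.toSubmodule.mapQ τ'.core.toSubmodule (φ.toLieHom : 𝔤 →ₗ[k] 𝔤')
        (fun x hx => (hφ.mem_core_iff hsurj x).2 hx) with
      map_lie' := by
        intro x y
        obtain ⟨x, rfl⟩ := τ.modCoreHom_surjective x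
        obtain ⟨y, rfl⟩ := τ.modCoreHom_surjective y
        rw [← LieHom.map_lie]
        change τ'.modCoreHom.toLieHom (φ.toLieHom ⁅x, y⁆) =
          ⁅τ'.modCoreHom.toLieHom (φ.toLieHom x), τ'.modCoreHom.toLieHom (φ.toLieHom y)⁆
        rw [LieHom.map_lie, LieHom.map_lie] }
  have hf : ∀ x, f (τ.modCoreHom.toLieHom x) = τ'.modCoreHom.toLieHom (φ.toLieHom x) :=
    fun _ => rfl
  have hbij : Function.Bijective f := by
    constructor
    · intro x y hxy
      obtain ⟨x, rfl⟩ := τ.modCoreHom_surjective x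
      obtain ⟨y, rfl⟩ := τ.modCoreHom_surjective y
      rw [hf, hf, modCoreHom_eq_iff, ← map_sub, hφ.mem_core_iff hsurj] at hxy
      exact (τ.modCoreHom_eq_iff x y).2 hxy
    · intro y
      obtain ⟨y, rfl⟩ := τ'.modCoreHom_surjective y
      obtain ⟨x, rfl⟩ := hsurj y
      exact ⟨_, hf x⟩
  refine ⟨⟨LieEquiv.ofBijective f hbij, fun x => ?_, fun x => ?_⟩⟩
  · obtain ⟨x, rfl⟩ := τ.modCoreHom_surjective x
    change f _ ∈ _ ↔ _
    rw [hf, τ'.bijectiveOnC_modCoreHom.mem_s_iff, hφ.mem_s_iff,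
      τ.bijectiveOnC_modCoreHom.mem_s_iff]
  · obtain ⟨x, rfl⟩ := τ.modCoreHom_surjective x
    change f _ ∈ _ ↔ _
    rw [hf]
    constructor
    · rintro ⟨y, hy, hxy⟩
      obtain ⟨z, hz, rfl⟩ := hφ.surjOn hy
      refine ⟨z, hz, (τ.modCoreHom_eq_iff z x).2 ?_⟩
      rw [← hφ.mem_core_iff hsurj, map_sub]
      exact (τ'.modCoreHom_eq_iff _ _).1 hxy
    · rintro ⟨y, hy, hxy⟩
      refine ⟨φ.toLieHom y, φ.map_c y hy, (τ'.modCoreHom_eq_iff _ _).2 ?_⟩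
      rw [← map_sub, hφ.mem_core_iff hsurj]
      exact (τ.modCoreHom_eq_iff _ _).1 hxy

theorem Hom.BijectiveOnC.map_gInn {φ : Hom τ τ'} (hφ : φ.BijectiveOnC) :
    τ.gInn.map φ.toLieHom = τ'.gInn := by
  apply le_antisymm
  · rw [LieSubalgebra.map_le_iff_le_comap, LieSubalgebra.lieSpan_le]
    exact fun x hx => LieSubalgebra.subset_lieSpan (φ.map_c x hx)
  · rw [LieSubalgebra.lieSpan_le]
    intro y hy
    obtain ⟨x, hx, rfl⟩ := hφ.surjOn hy
    exact ⟨x, LieSubalgebra.subset_lieSpan hx, rfl⟩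

/-- Triples related by a morphism that is bijective on `𝔠` are equivalent. -/
theorem Hom.BijectiveOnC.equivalent {φ : Hom τ τ'} (hφ : φ.BijectiveOnC) : Equivalent τ τ' := by
  have hmem : ∀ x ∈ τ.gInn, φ.toLieHom x ∈ τ'.gInn := fun x hx => hφ.map_gInn ▸ ⟨x, hx, rfl⟩
  let φ' : Hom τ.inn τ'.inn :=
    { toFun := fun x => ⟨φ.toLieHom x, hmem x x.2⟩
      map_add' := fun x y => Subtype.ext (map_add φ.toLieHom _ _)
      map_smul' := fun a x => Subtype.ext (map_smul φ.toLieHom _ _)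
      map_lie' := fun {x y} => Subtype.ext (LieHom.map_lie φ.toLieHom _ _)
      map_s := fun x hx => φ.map_s x hx
      map_c := fun x hx => φ.map_c x hx }
  have hφ' : φ'.BijectiveOnC := by
    refine ⟨φ'.map_c, fun x hx y hy hxy => ?_, fun y hy => ?_⟩
    · exact Subtype.ext (hφ.injOn hx hy congr(($hxy : 𝔤')))
    · obtain ⟨x, hx, hxy⟩ := hφ.surjOn hy
      exact ⟨⟨x, LieSubalgebra.subset_lieSpan hx⟩, hx, Subtype.ext hxy⟩
  -- Between the inner subalgebras the map is onto, since `𝔠' = φ(𝔠)` generates the target.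
  refine hφ'.nonempty_iso_modCore fun ⟨y, hy⟩ => ?_
  obtain ⟨x, hx, hxy⟩ := hφ.map_gInn.ge hy
  exact ⟨⟨x, hx⟩, Subtype.ext hxy⟩

end

end Triple

/-! ### Right monoalternative bialgebras -/

namespace NonAssocBialgebra

section

variable {k U U' : Type*} [Field k]
  [AddCommGroup U] [Module k U] [Coalgebra k U] [Coalgebra.IsCocomm k U]
  [AddCommGroup U'] [Module k U'] [Coalgebra k U'] [Coalgebra.IsCocomm k U']

theorem isBinomial_pow (B : NonAssocBialgebra k U) {f : Module.End k U} (hf : f ∈ B.g) :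
    Coalgebra.IsBinomial (k := k) fun n => (f ^ n) B.one :=
  Coalgebra.IsCoderivation.isBinomial hf B.comul_one B.counit_one

theorem iterMul_succ_apply (B : NonAssocBialgebra k U) {p : ℕ → U}
    (hp : Coalgebra.IsBinomial (k := k) p) (x : U) (n m : ℕ) :
    B.iterMul x (n + 1) (p m) = ∑ ij ∈ Finset.HasAntidiagonal.antidiagonal m,
      m.choose ij.1 • B.mul (B.iterMul x n (p ij.1)) (p ij.2) := by
  rw [iterMul, LinearMap.comp_apply, hp.comul_apply, map_sum]
  refine Finset.sum_congr rfl fun ij _ => ?_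
  rw [map_nsmul, TensorProduct.lift.tmul, LinearMap.comp_apply]

/-- In a right monoalternative bialgebra `((x a) ⋯) a = x ((a a) ⋯ a)` for primitive `a`. -/
theorem RightMonoalternative.pow_rightMul_apply [CharZero k] {B : NonAssocBialgebra k U}
    (hB : B.RightMonoalternative) {a : U} (ha : a ∈ B.prim) (n : ℕ) (x : U) :
    B.mul x ((B.rightMul a ^ n) B.one) = (B.rightMul a ^ n) x := by
  induction n using Nat.strong_induction_on generalizing x with
  | _ n ih =>
    rcases n with _ | _ | n
    · exact B.mul_one x
    · rw [zero_add, pow_one]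
      change B.mul x (B.mul B.one a) = B.mul x a
      rw [B.one_mul]
    have hp := B.isBinomial_pow (B.rightMul_mem_g ha)
    have hone : ∀ x m, B.iterMul x 1 ((B.rightMul a ^ m) B.one) =
        B.mul x ((B.rightMul a ^ m) B.one) := by
      intro x m
      rw [B.iterMul_succ_apply hp, Finset.sum_eq_single (0, m)]
      · rw [iterMul, LinearMap.smulRight_apply, hp.counit_apply, if_pos rfl, one_smul,
          Nat.choose_zero_right, one_smul]
      · rintro ⟨i, j⟩ hij hne
        rw [Finset.HasAntidiagonal.mem_antidiagonal] at hij
        rw [iterMul, LinearMap.smulRight_apply, hp.counit_apply, if_neg, zero_smul, map_zero,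
          LinearMap.zero_apply, smul_zero]
        rintro rfl
        exact hne (by simp_all)
      · intro h
        exact absurd (Finset.HasAntidiagonal.mem_antidiagonal.2 (zero_add m)) h
    -- By induction every term with both indices positive equals `R_a ^ (n + 2) x`. Only the two
    -- extreme terms contain the unknown product, and they are recorded by their deviation from this
    -- value.
    have htwo : ∀ x, B.iterMul x 2 ((B.rightMul a ^ (n + 2)) B.one) =
        ∑ ij ∈ Finset.HasAntidiagonal.antidiagonal (n + 2), (n + 2).choose ij.1 •
          ((B.rightMul a ^ (n + 2)) x + if ij.1 = 0 ∨ ij.2 = 0 then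
            B.mul x ((B.rightMul a ^ (n + 2)) B.one) - (B.rightMul a ^ (n + 2)) x else 0) := by
      intro x
      rw [B.iterMul_succ_apply hp]
      refine Finset.sum_congr rfl fun ij hij => ?_
      obtain ⟨i, j⟩ := ij
      rw [Finset.HasAntidiagonal.mem_antidiagonal] at hij
      change i + j = n + 2 at hij
      rw [hone]
      congr 1
      change B.mul (B.mul x ((B.rightMul a ^ i) B.one)) ((B.rightMul a ^ j) B.one) =
        _ + if i = 0 ∨ j = 0 then _ else _
      rcases Nat.eq_zero_or_pos i with rfl | hi
      · rw [zero_add] at hij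
        rw [if_pos (Or.inl rfl), pow_zero, Module.End.one_apply, B.mul_one, hij, add_sub_cancel]
      rcases Nat.eq_zero_or_pos j with rfl | hj
      · rw [add_zero] at hij
        rw [if_pos (Or.inr rfl), pow_zero, Module.End.one_apply, B.mul_one, hij, add_sub_cancel]
      rw [if_neg (by omega), ih i (by omega), ih j (by omega), add_zero, ← Module.End.mul_apply,
        ← pow_add, add_comm j i, hij]
    have hsum : ∀ y z : U, ∑ ij ∈ Finset.HasAntidiagonal.antidiagonal (n + 2),
        (n + 2).choose ij.1 • (y + if ij.1 = 0 ∨ ij.2 = 0 then z else 0) =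
          (2 : k) ^ (n + 2) • y + (2 : k) • z := by
      intro y z
      simp only [smul_add, Finset.sum_add_distrib]
      congr 1
      · rw [← Finset.sum_smul, Finset.Nat.sum_antidiagonal_eq_sum_range_succ_mk,
          Nat.sum_range_choose, ← Nat.cast_smul_eq_nsmul k, Nat.cast_pow, Nat.cast_ofNat]
      · rw [Finset.Nat.antidiagonal_succ_succ', Finset.sum_cons, Finset.sum_cons, Finset.sum_map]
        simp [two_smul]
    have h1 := htwo B.one
    rw [hsum, B.one_mul, sub_self, smul_zero, add_zero] at h1
    -- With `N = n + 2`, and `d` the difference of the two sides of the claim, monoalternativity for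
    -- two factors gives `(2 ^ N - 2) d = 0`; for `x = 1` the deviation vanishes, which evaluates
    -- the inner product.
    have h2 := hB 2 x ((B.rightMul a ^ (n + 2)) B.one)
    rw [htwo, hsum, h1, map_smul] at h2
    have h3 : ((2 : k) ^ (n + 2) - 2) •
        (B.mul x ((B.rightMul a ^ (n + 2)) B.one) - (B.rightMul a ^ (n + 2)) x) = 0 := by
      rw [sub_smul, smul_sub, ← h2]
      abel
    have h4 : (2 : k) ^ (n + 2) - 2 ≠ 0 := by
      intro h
      have h' : (2 : ℕ) ^ (n + 2) = 2 ^ 1 := by exact_mod_cast sub_eq_zero.1 h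
      have := Nat.pow_right_injective le_rfl h'
      omega
    exact sub_eq_zero.1 ((smul_eq_zero.1 h3).resolve_left h4)

end

end NonAssocBialgebra


/-! ### Transport along linear and bialgebra isomorphisms -/

namespace SymmetricAlgebra

/-- Linear isomorphisms induce isomorphisms of coalgebras between symmetric algebras. -/
def coalgEquivOfLinearEquiv {k V W : Type*} [Field k] [CharZero k] [AddCommGroup V] [Module k V]
    [AddCommGroup W] [Module k W] (κ : V ≃ₗ[k] W) :
    SymmetricAlgebra k V ≃ₗc[k] SymmetricAlgebra k W where
  __ := Coalgebra.coalgHomOfIsBinomial (fun v n => ι k V v ^ n) (fun v n => ι k W (κ v) ^ n)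
    isBinomial_ι_pow (fun v => isBinomial_ι_pow (κ v)) span_ι_pow
    (lift (ι k W ∘ₗ κ.toLinearMap)).toLinearMap (fun v n => by
      rw [AlgHom.toLinearMap_apply, map_pow, lift_ι_apply]
      rfl)
  __ := (AlgEquiv.ofAlgHom (lift (ι k W ∘ₗ κ.toLinearMap)) (lift (ι k V ∘ₗ κ.symm.toLinearMap))
    (algHom_ext (LinearMap.ext fun w => by simp)) (algHom_ext (LinearMap.ext fun v => by
      simp))).toLinearEquiv

theorem coalgEquivOfLinearEquiv_ι_pow {k V W : Type*} [Field k] [CharZero k] [AddCommGroup V]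
    [Module k V] [AddCommGroup W] [Module k W] (κ : V ≃ₗ[k] W) (v : V) (n : ℕ) :
    coalgEquivOfLinearEquiv κ (ι k V v ^ n) = ι k W (κ v) ^ n := by
  change lift (ι k W ∘ₗ κ.toLinearMap) (ι k V v ^ n) = _
  rw [map_pow, lift_ι_apply]
  rfl

end SymmetricAlgebra

namespace NonAssocBialgebra

section

variable {k U U' U'' : Type*} [Field k]
  [AddCommGroup U] [Module k U] [Coalgebra k U] [Coalgebra.IsCocomm k U]
  [AddCommGroup U'] [Module k U'] [Coalgebra k U'] [Coalgebra.IsCocomm k U']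
  [AddCommGroup U''] [Module k U''] [Coalgebra k U''] [Coalgebra.IsCocomm k U'']
  {B : NonAssocBialgebra k U} {B' : NonAssocBialgebra k U'} {B'' : NonAssocBialgebra k U''}

theorem Hom.ext_apply {ψ ψ' : Hom B B'} (h : ∀ u, ψ.toCoalgHom u = ψ'.toCoalgHom u) : ψ = ψ' := by
  obtain ⟨f, _, _⟩ := ψ
  obtain ⟨f', _, _⟩ := ψ'
  obtain rfl : f = f' := CoalgHom.ext h
  rfl

/-- The inverse of an isomorphism of bialgebras. -/
def Iso.symm (e : Iso B B') : Iso B' B where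
  toCoalgEquiv := e.toCoalgEquiv.symm
  map_mul u v := e.toCoalgEquiv.toLinearEquiv.injective (by
    change e.toCoalgEquiv (e.toCoalgEquiv.symm _) =
      e.toCoalgEquiv (B.mul (e.toCoalgEquiv.symm u) (e.toCoalgEquiv.symm v))
    rw [e.map_mul, CoalgEquiv.apply_symm_apply, CoalgEquiv.apply_symm_apply,
      CoalgEquiv.apply_symm_apply])
  map_one := e.toCoalgEquiv.toLinearEquiv.injective (by
    change e.toCoalgEquiv (e.toCoalgEquiv.symm _) = e.toCoalgEquiv B.one
    rw [e.map_one, CoalgEquiv.apply_symm_apply])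

/-- Composition of isomorphisms of bialgebras. -/
def Iso.trans (e : Iso B B') (e' : Iso B' B'') : Iso B B'' where
  toCoalgEquiv := e.toCoalgEquiv.trans e'.toCoalgEquiv
  map_mul u v := by
    change e'.toCoalgEquiv (e.toCoalgEquiv _) =
      B''.mul (e'.toCoalgEquiv (e.toCoalgEquiv u)) (e'.toCoalgEquiv (e.toCoalgEquiv v))
    rw [e.map_mul, e'.map_mul]
  map_one := by
    change e'.toCoalgEquiv (e.toCoalgEquiv _) = _
    rw [e.map_one, e'.map_one]

theorem Iso.comul_apply (e : Iso B B') (u : U) : Coalgebra.comul (R := k) (e.toCoalgEquiv u) =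
    TensorProduct.map e.toCoalgEquiv.toLinearEquiv.toLinearMap
      e.toCoalgEquiv.toLinearEquiv.toLinearMap (Coalgebra.comul u) :=
  (CoalgHomClass.map_comp_comul_apply e.toCoalgEquiv u).symm

/-- Isomorphisms of bialgebras transport primitive elements. -/
theorem Iso.map_prim (e : Iso B B') {a : U} (ha : a ∈ B.prim) : e.toCoalgEquiv a ∈ B'.prim := by
  have ha' : Coalgebra.comul (R := k) a = a ⊗ₜ[k] B.one + B.one ⊗ₜ[k] a := ha
  change Coalgebra.comul (R := k) (e.toCoalgEquiv a) = _
  rw [e.comul_apply, ha', map_add, TensorProduct.map_tmul, TensorProduct.map_tmul, ← e.map_one]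
  rfl

theorem Iso.conj_mem_g (e : Iso B B') {f : Module.End k U} (hf : f ∈ B.g) :
    e.toCoalgEquiv.toLinearEquiv.conj f ∈ B'.g := by
  intro u
  obtain ⟨u, rfl⟩ := e.toCoalgEquiv.toLinearEquiv.surjective u
  rw [LinearEquiv.conj_apply_apply, LinearEquiv.symm_apply_apply]
  refine (e.comul_apply (f u)).trans ?_
  have hu : Coalgebra.comul (R := k) (e.toCoalgEquiv.toLinearEquiv u) = _ := e.comul_apply u
  rw [hu, hf u]
  generalize Coalgebra.comul (R := k) u = t
  induction t with
  | zero => simp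
  | tmul a b => simp [LinearEquiv.conj_apply_apply]
  | add a b ha hb =>
    simp only [map_add] at ha hb ⊢
    rw [add_add_add_comm, ha, hb]
    abel

/-- Conjugation by an isomorphism of bialgebras, as a morphism of triples. -/
def Iso.tripleHom (e : Iso B B') : Triple.Hom B.triple B'.triple where
  toFun f := ⟨e.toCoalgEquiv.toLinearEquiv.conj f.1, e.conj_mem_g f.2⟩
  map_add' f g := Subtype.ext (map_add _ _ _)
  map_smul' a f := Subtype.ext (map_smul _ _ _)
  map_lie' {f g} := Subtype.ext (LieEquiv.map_lie e.toCoalgEquiv.toLinearEquiv.lieConj f.1 g.1)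
  map_s f hf := by
    change e.toCoalgEquiv (f.1 (e.toCoalgEquiv.symm B'.one)) = 0
    have hf' : f.1 B.one = 0 := hf
    have hone : e.toCoalgEquiv.symm B'.one = B.one := e.symm.map_one
    rw [hone, hf', map_zero]
  map_c := by
    rintro f ⟨a, ha, hf⟩
    refine ⟨e.toCoalgEquiv a, e.map_prim ha, LinearMap.ext fun u => ?_⟩
    change e.toCoalgEquiv (f.1 (e.toCoalgEquiv.symm u)) = B'.mul u (e.toCoalgEquiv a)
    rw [hf]
    change e.toCoalgEquiv (B.mul _ a) = _
    rw [e.map_mul, CoalgEquiv.apply_symm_apply]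

theorem Iso.bijectiveOnC_tripleHom (e : Iso B B') : e.tripleHom.BijectiveOnC := by
  refine ⟨e.tripleHom.map_c, fun f _ g _ hfg => ?_, ?_⟩
  · exact Subtype.ext (e.toCoalgEquiv.toLinearEquiv.conj.injective congr(($hfg).1))
  · rintro f ⟨a, ha, hf⟩
    refine ⟨⟨B.rightMul (e.toCoalgEquiv.symm a), B.rightMul_mem_g (e.symm.map_prim ha)⟩,
      ⟨_, e.symm.map_prim ha, rfl⟩, Subtype.ext (LinearMap.ext fun u => ?_)⟩
    rw [hf]
    change e.toCoalgEquiv (B.mul (e.toCoalgEquiv.symm u) (e.toCoalgEquiv.symm a)) = B'.mul u a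
    rw [e.map_mul, CoalgEquiv.apply_symm_apply, CoalgEquiv.apply_symm_apply]

end

end NonAssocBialgebra

/-! ### Primitive elements, universal property and classification of `U_τ` -/

namespace Triple

open UniversalEnvelopingAlgebra

section

variable {k 𝔤 : Type*} [Field k] [CharZero k] [LieRing 𝔤] [LieAlgebra k 𝔤] (τ : Triple k 𝔤)

theorem isCoalgHom_symm_envEquiv (e : τ.Env) :
    Coalgebra.comul (R := k) (τ.envEquiv.symm e) =
      TensorProduct.map τ.envEquiv.symm.toLinearEquiv.toLinearMap
        τ.envEquiv.symm.toLinearEquiv.toLinearMap (Coalgebra.comul e) :=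
  (CoalgHomClass.map_comp_comul_apply τ.envEquiv.symm e).symm

theorem cls_ι_mem_prim (x : 𝔤) : τ.cls (ι k x) ∈ τ.envBialgebra.prim := by
  have h := τ.envBialgebra.apply_one_mem_prim (τ.isCoderivation_leftAction x)
  change τ.leftAction x (τ.cls 1) ∈ _ at h
  rwa [leftAction_apply, smul_cls, mul_one] at h

/-- The isomorphism `envEquiv` preserves the distinguished element, so the question moves to `k[𝔠]`,
whose primitive elements have degree one. -/
theorem mem_prim_iff (e : τ.Env) :
    e ∈ τ.envBialgebra.prim ↔ ∃ c : τ.c, τ.cls (ι k (c : 𝔤)) = e := by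
  constructor
  · intro he
    have he' : Coalgebra.comul (R := k) e = e ⊗ₜ[k] τ.cls 1 + τ.cls 1 ⊗ₜ[k] e := he
    have hone : τ.envEquiv.symm (τ.cls 1) = 1 := by
      rw [← envEquiv_one, CoalgEquiv.symm_apply_apply]
    have h := τ.isCoalgHom_symm_envEquiv e
    rw [he', map_add, TensorProduct.map_tmul, TensorProduct.map_tmul] at h
    change _ = τ.envEquiv.symm e ⊗ₜ[k] τ.envEquiv.symm (τ.cls 1) +
      τ.envEquiv.symm (τ.cls 1) ⊗ₜ[k] τ.envEquiv.symm e at h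
    rw [hone] at h
    obtain ⟨c, hc⟩ := SymmetricAlgebra.mem_range_ι_of_comul_eq h
    exact ⟨c, by rw [← envEquiv_ι, hc, CoalgEquiv.apply_symm_apply]⟩
  · rintro ⟨c, rfl⟩
    exact τ.cls_ι_mem_prim c

theorem cls_ι_injective : Function.Injective fun c : τ.c => τ.cls (ι k (c : 𝔤)) := by
  intro c d h
  simp only [← envEquiv_ι] at h
  obtain ⟨π, hπ⟩ := SymmetricAlgebra.exists_projection (k := k) (V := τ.c)
  have h' := congrArg π (τ.envEquiv.toLinearEquiv.injective h)
  simpa [hπ] using (congrArg₂ Eq (hπ c 1) (hπ d 1)).mp (by simpa using h')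

/-- The space `𝔠` is the space of primitive elements of `U(𝔤) / U(𝔤)𝔰`. -/
def primEquiv : τ.c ≃ₗ[k] τ.envBialgebra.prim :=
  LinearEquiv.ofBijective
    ((τ.cls ∘ₗ (ι k : 𝔤 →ₗ⁅k⁆ UniversalEnvelopingAlgebra k 𝔤).toLinearMap ∘ₗ
      τ.c.subtype).codRestrict τ.envBialgebra.prim fun c => τ.cls_ι_mem_prim c)
    ⟨fun _ _ h => τ.cls_ι_injective congr(($h : τ.Env)), fun ⟨e, he⟩ => by
      obtain ⟨c, hc⟩ := (τ.mem_prim_iff e).1 he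
      exact ⟨c, Subtype.ext hc⟩⟩

/-- Connectedness asks for the symmetric algebra on the primitive elements rather than on `𝔠`, hence
the relabelling by `primEquiv`. -/
theorem isConnected_envBialgebra : τ.envBialgebra.IsConnected := by
  refine ⟨(SymmetricAlgebra.coalgEquivOfLinearEquiv τ.primEquiv.symm).trans τ.envEquiv, ?_⟩
  rw [CoalgEquiv.trans_apply, ← pow_zero (SymmetricAlgebra.ι k _ 0),
    SymmetricAlgebra.coalgEquivOfLinearEquiv_ι_pow, pow_zero, envEquiv_one]
  rfl

/-- All factors are powers of the same `c`, so every term equals `c ^ m • e`, and the coefficients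
sum to `n ^ m` by repeated use of the binomial theorem. For `n = 0` the value `0 ^ m` is the counit.
-/
theorem iterMul_cls_pow (e : τ.Env) (n : ℕ) (c : τ.c) (m : ℕ) :
    τ.envBialgebra.iterMul e n (τ.cls (ι k (c : 𝔤) ^ m)) =
      (n : k) ^ m • (ι k (c : 𝔤) ^ m • e) := by
  induction n generalizing m with
  | zero =>
    rw [NonAssocBialgebra.iterMul, LinearMap.smulRight_apply,
      (τ.isBinomial_cls_pow _).counit_apply]
    rcases m with _ | m <;> simp
  | succ n ih =>
    rw [NonAssocBialgebra.iterMul_succ_apply _ (τ.isBinomial_cls_pow _)]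
    -- The factor `1 ^ ij.2` puts the coefficient into the shape of the expansion of `(n + 1) ^ m`.
    have h : ∀ ij ∈ Finset.HasAntidiagonal.antidiagonal m, m.choose ij.1 •
        τ.envBialgebra.mul (τ.envBialgebra.iterMul e n (τ.cls (ι k (c : 𝔤) ^ ij.1)))
          (τ.cls (ι k (c : 𝔤) ^ ij.2)) =
        (m.choose ij.1 • ((n : k) ^ ij.1 * 1 ^ ij.2)) • (ι k (c : 𝔤) ^ m • e) := by
      intro ij hij
      rw [ih]
      change _ • τ.envMul _ _ = _
      rw [map_smul, LinearMap.smul_apply, envMul_cls_pow, ← mul_smul, ← pow_add, add_comm,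
        Finset.HasAntidiagonal.mem_antidiagonal.1 hij, one_pow, mul_one, smul_assoc]
    rw [Finset.sum_congr rfl h, ← Finset.sum_smul, ← (Commute.one_right (n : k)).add_pow',
      Nat.cast_succ]

/-- At `[c ^ m]` both sides are `n ^ m • (c ^ m • e)`, since multiplication by `[c ^ m]` is the
action of `c ^ m`. -/
theorem rightMonoalternative_envBialgebra :
    NonAssocBialgebra.RightMonoalternative τ.envBialgebra := by
  intro n e y
  have h : τ.envBialgebra.iterMul e n =
      τ.envBialgebra.mul e ∘ₗ τ.envBialgebra.iterMul τ.envBialgebra.one n := by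
    refine τ.linearMap_ext_cls_pow fun c m => ?_
    rw [LinearMap.comp_apply, iterMul_cls_pow, iterMul_cls_pow, map_smul]
    congr 1
    change _ = τ.envMul e (ι k (c : 𝔤) ^ m • τ.cls 1)
    rw [smul_cls, mul_one, envMul_cls_pow]
  exact congr($h y)

theorem leftAction_eq_rightMul (c : τ.c) :
    τ.leftAction c = τ.envBialgebra.rightMul (τ.cls (ι k (c : 𝔤))) := by
  refine LinearMap.ext fun e => ?_
  have h := τ.envMul_cls_pow e c 1
  rw [pow_one] at h
  exact h.symm

/-- The morphism `τ → T(U_τ)`. -/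
def envHom : Hom τ τ.envBialgebra.triple where
  toFun x := ⟨τ.leftAction x, τ.isCoderivation_leftAction x⟩
  map_add' x y := Subtype.ext (map_add _ _ _)
  map_smul' a x := Subtype.ext (map_smul _ _ _)
  map_lie' {x y} := Subtype.ext (LieHom.map_lie _ _ _)
  map_s x hx := by
    change ι k x • τ.cls 1 = 0
    rw [smul_cls, mul_one, τ.cls_ι_of_mem_s hx]
  map_c x hx := ⟨_, τ.cls_ι_mem_prim x, τ.leftAction_eq_rightMul ⟨x, hx⟩⟩

theorem envHom_apply (x : 𝔤) (e : τ.Env) :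
    (τ.envHom.toLieHom x : Module.End k τ.Env) e = ι k x • e := rfl

theorem bijectiveOnC_envHom : τ.envHom.BijectiveOnC := by
  refine ⟨τ.envHom.map_c, fun x hx y hy hxy => ?_, ?_⟩
  · have h : ι k x • τ.cls 1 = ι k y • τ.cls 1 := congr(($hxy).1 (τ.cls 1))
    rw [smul_cls, smul_cls, mul_one, mul_one] at h
    exact congrArg Subtype.val (τ.cls_ι_injective (a₁ := ⟨x, hx⟩) (a₂ := ⟨y, hy⟩) h)
  · rintro f ⟨a, ha, hf⟩
    obtain ⟨c, rfl⟩ := (τ.mem_prim_iff a).1 ha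
    exact ⟨c, c.2, Subtype.ext ((τ.leftAction_eq_rightMul c).trans hf.symm)⟩

theorem exists_linearEquiv_envHom : ∃ e : τ.c ≃ₗ[k] τ.envBialgebra.triple.c,
    ∀ c : τ.c, (e c : τ.envBialgebra.g) = τ.envHom.toLieHom c := by
  refine ⟨LinearEquiv.ofBijective
    ((τ.envHom.toLieHom : 𝔤 →ₗ[k] τ.envBialgebra.g).restrict τ.envHom.map_c) ?_, fun _ => rfl⟩
  exact τ.bijectiveOnC_envHom.bijective

omit [CharZero k] in
theorem Hom.apply_one_of_mem_s {U' : Type*} [AddCommGroup U'] [Module k U'] [Coalgebra k U']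
    [Coalgebra.IsCocomm k U'] {B' : NonAssocBialgebra k U'} {τ : Triple k 𝔤} (φ : Hom τ B'.triple) :
    ∀ x ∈ τ.s, (B'.g.incl.comp φ.toLieHom) x B'.one = 0 := φ.map_s

/-- The homomorphism of bialgebras induced by a morphism to the triple of a right monoalternative
bialgebra. -/
def bialgebraHom {U' : Type*} [AddCommGroup U'] [Module k U'] [Coalgebra k U']
    [Coalgebra.IsCocomm k U'] {B' : NonAssocBialgebra k U'} (hB' : B'.RightMonoalternative)
    (φ : Hom τ B'.triple) : NonAssocBialgebra.Hom τ.envBialgebra B' where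
  toCoalgHom := Coalgebra.coalgHomOfIsBinomial (fun (c : τ.c) n => τ.cls (ι k (c : 𝔤) ^ n))
    (fun c n => ((φ.toLieHom c).1 ^ n) B'.one) (fun c => τ.isBinomial_cls_pow c)
    (fun c => B'.isBinomial_pow (φ.toLieHom c).2) τ.span_cls_pow
    (τ.envLift (B'.g.incl.comp φ.toLieHom) B'.one φ.apply_one_of_mem_s)
    (fun c n => τ.envLift_cls_pow _ _ _ _ n)
  map_one := by
    change τ.envLift (B'.g.incl.comp φ.toLieHom) B'.one φ.apply_one_of_mem_s (τ.cls 1) = _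
    rw [envLift_cls, map_one (UniversalEnvelopingAlgebra.lift k _), Module.End.one_apply]
  map_mul u v := by
    have h : τ.envLift (B'.g.incl.comp φ.toLieHom) B'.one φ.apply_one_of_mem_s ∘ₗ τ.envMul u =
        B'.mul (τ.envLift (B'.g.incl.comp φ.toLieHom) B'.one φ.apply_one_of_mem_s u) ∘ₗ
          τ.envLift (B'.g.incl.comp φ.toLieHom) B'.one φ.apply_one_of_mem_s := by
      refine τ.linearMap_ext_cls_pow fun c n => ?_
      -- Since `c` acts on `U'` as `R_a` with `a` primitive, multiplicativity at `[c ^ n]` is the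
      -- identity `R_a ^ n (x) = x · R_a ^ n (1)`, the one use of right monoalternativity.
      obtain ⟨a, ha, hc⟩ := φ.map_c c c.2
      have hρ : (B'.g.incl.comp φ.toLieHom) c = B'.rightMul a := hc
      rw [LinearMap.comp_apply, LinearMap.comp_apply, envMul_cls_pow, envLift_smul,
        envLift_cls_pow, hρ, hB'.pow_rightMul_apply ha]
    exact congr($h v)

theorem bialgebraHom_cls {U' : Type*} [AddCommGroup U'] [Module k U'] [Coalgebra k U']
    [Coalgebra.IsCocomm k U'] {B' : NonAssocBialgebra k U'} (hB' : B'.RightMonoalternative)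
    (φ : Hom τ B'.triple) (x : 𝔤) :
    (τ.bialgebraHom hB' φ).toCoalgHom (τ.cls (ι k x)) = (φ.toLieHom x).1 B'.one := by
  have h := τ.envLift_cls_pow (B'.g.incl.comp φ.toLieHom) B'.one φ.apply_one_of_mem_s x 1
  rwa [pow_one, pow_one] at h

/-- Homomorphisms of bialgebras are determined by the images of the primitive elements. -/
theorem bialgebraHom_ext {U' : Type*} [AddCommGroup U'] [Module k U'] [Coalgebra k U']
    [Coalgebra.IsCocomm k U'] {B' : NonAssocBialgebra k U'}
    {ψ ψ' : NonAssocBialgebra.Hom τ.envBialgebra B'}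
    (h : ∀ c : τ.c, ψ.toCoalgHom (τ.cls (ι k (c : 𝔤))) = ψ'.toCoalgHom (τ.cls (ι k (c : 𝔤)))) :
    ψ = ψ' := by
  refine NonAssocBialgebra.Hom.ext_apply fun u => ?_
  have hlin : ψ.toCoalgHom.toLinearMap = ψ'.toCoalgHom.toLinearMap := by
    refine τ.linearMap_ext_cls_pow fun c n => ?_
    change ψ.toCoalgHom _ = ψ'.toCoalgHom _
    induction n with
    | zero =>
      rw [pow_zero]
      exact ψ.map_one.trans ψ'.map_one.symm
    | succ n ih =>
      -- Since `[c ^ (n + 1)] = [c ^ n] [c]`, the values on primitive elements propagate to all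
      -- powers.
      have hs : τ.cls (ι k (c : 𝔤) ^ (n + 1)) = τ.envBialgebra.mul (τ.cls (ι k (c : 𝔤) ^ n))
          (τ.cls (ι k (c : 𝔤))) := by
        have := τ.envMul_cls_pow (τ.cls (ι k (c : 𝔤) ^ n)) c 1
        rw [pow_one, smul_cls, ← pow_succ'] at this
        exact this.symm
      rw [hs, ψ.map_mul, ψ'.map_mul, ih, h]
  exact congr($hlin u)

variable {τ} {𝔤' : Type*} [LieRing 𝔤'] [LieAlgebra k 𝔤'] {τ' : Triple k 𝔤'}

/-- A morphism of triples that is bijective on `𝔠` induces an isomorphism of bialgebras. -/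
theorem Hom.BijectiveOnC.nonempty_iso {φ : Hom τ τ'} (hφ : φ.BijectiveOnC) :
    Nonempty (NonAssocBialgebra.Iso τ.envBialgebra τ'.envBialgebra) := by
  let ψ := τ.bialgebraHom τ'.rightMonoalternative_envBialgebra (τ'.envHom.comp φ)
  let κ : τ.c ≃ₗ[k] τ'.c := LinearEquiv.ofBijective
    ((φ.toLieHom : 𝔤 →ₗ[k] 𝔤').restrict φ.map_c) hφ.bijective
  -- Under the two symmetrizations `ψ` becomes the map `k[𝔠] → k[𝔠']` induced by `κ`, and so is
  -- bijective.
  have hψ : ψ.toCoalgHom.toLinearMap ∘ₗ τ.envEquiv.toLinearEquiv.toLinearMap =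
      τ'.envEquiv.toLinearEquiv.toLinearMap ∘ₗ
        (SymmetricAlgebra.coalgEquivOfLinearEquiv κ).toLinearEquiv.toLinearMap := by
    refine SymmetricAlgebra.linearMap_ext_pow fun c n => ?_
    change ψ.toCoalgHom (τ.envEquiv _) =
      τ'.envEquiv (SymmetricAlgebra.coalgEquivOfLinearEquiv κ _)
    rw [SymmetricAlgebra.coalgEquivOfLinearEquiv_ι_pow, envEquiv_ι_pow, envEquiv_ι_pow]
    exact (τ.envLift_cls_pow _ _ (τ'.envHom.comp φ).apply_one_of_mem_s _ n).trans (τ'.leftAction_pow_cls_one _ n)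
  have hbij : Function.Bijective ψ.toCoalgHom := by
    have h : Function.Bijective (ψ.toCoalgHom ∘ τ.envEquiv) := by
      have h' : (ψ.toCoalgHom ∘ τ.envEquiv : _ → _) =
          τ'.envEquiv ∘ SymmetricAlgebra.coalgEquivOfLinearEquiv κ :=
        funext fun x => congr($hψ x)
      rw [h']
      exact τ'.envEquiv.toLinearEquiv.bijective.comp
        (SymmetricAlgebra.coalgEquivOfLinearEquiv κ).toLinearEquiv.bijective
    exact (Function.Bijective.of_comp_iff _ τ.envEquiv.toLinearEquiv.bijective).1 h
  exact ⟨{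
    toCoalgEquiv :=
      { ψ.toCoalgHom, LinearEquiv.ofBijective ψ.toCoalgHom.toLinearMap hbij with }
    map_mul := ψ.map_mul
    map_one := ψ.map_one }⟩

/-- An isomorphism of bialgebras conjugates `T(U_τ)` into `T(U_τ')`, and each triple is equivalent
to the triple of its bialgebra. Conversely, `τ` and `τ_red` are joined through `τ_inn` by morphisms
bijective on `𝔠`, each of which induces an isomorphism of bialgebras. -/
theorem nonempty_iso_iff_equivalent :
    Nonempty (NonAssocBialgebra.Iso τ.envBialgebra τ'.envBialgebra) ↔ Equivalent τ τ' := by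
  constructor
  · rintro ⟨e⟩
    exact (e.bijectiveOnC_tripleHom.comp τ.bijectiveOnC_envHom).equivalent.trans
      τ'.bijectiveOnC_envHom.equivalent.symm
  · rintro ⟨e⟩
    obtain ⟨e₁⟩ := τ.bijectiveOnC_innHom.nonempty_iso
    obtain ⟨e₂⟩ := (e.bijectiveOnC_toHom.comp τ.inn.bijectiveOnC_modCoreHom).nonempty_iso
    obtain ⟨e₃⟩ := τ'.inn.bijectiveOnC_modCoreHom.nonempty_iso
    obtain ⟨e₄⟩ := τ'.bijectiveOnC_innHom.nonempty_iso
    exact ⟨((e₁.symm.trans e₂).trans e₃.symm).trans e₄⟩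

end

end Triple

end
/-- Formal integration of triples. -/
theorem mainTheorem1 {k : Type*} [Field k] [CharZero k]
    {𝔤 : Type*} [LieRing 𝔤] [LieAlgebra k 𝔤] (τ : Triple k 𝔤) :
    (∃! H : NonAssocHopfAlgebra k τ.Env, τ.IsProduct H.mul) ∧
    ∀ H : NonAssocHopfAlgebra k τ.Env, τ.IsProduct H.mul →
      H.RightMonoalternative ∧ H.IsConnected ∧
      (∃ ι : Triple.Hom τ H.triple,
        (∀ (x : 𝔤) (u : UniversalEnvelopingAlgebra k 𝔤),
          (ι.toLieHom x : Module.End k τ.Env) (τ.cls u) =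
            τ.cls (UniversalEnvelopingAlgebra.ι k x * u)) ∧
        (∃ e : τ.c ≃ₗ[k] H.triple.c, ∀ c : τ.c, (e c : H.g) = ι.toLieHom c) ∧
        (∀ {U' : Type*} [AddCommGroup U'] [Module k U'] [Coalgebra k U'] [Coalgebra.IsCocomm k U']
          (B' : NonAssocBialgebra k U'), B'.RightMonoalternative →
          ∀ ι' : Triple.Hom τ B'.triple,
            ∃! ψ : NonAssocBialgebra.Hom H.toNonAssocBialgebra B', ∀ c ∈ τ.c,
              (ι'.toLieHom c : Module.End k U') B'.one =
                ψ.toCoalgHom ((ι.toLieHom c : Module.End k τ.Env) H.one))) ∧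
      Triple.Equivalent τ H.triple ∧
      (∀ {𝔤' : Type*} [LieRing 𝔤'] [LieAlgebra k 𝔤'] (τ' : Triple k 𝔤')
        (H' : NonAssocHopfAlgebra k τ'.Env), τ'.IsProduct H'.mul →
        (Nonempty (NonAssocBialgebra.Iso H.toNonAssocBialgebra H'.toNonAssocBialgebra) ↔
          Triple.Equivalent τ τ')) := by
  refine ⟨⟨τ.envHopf, τ.isProduct_envMul, fun H hH => τ.eq_envHopf hH⟩, fun H hH => ?_⟩
  -- By uniqueness it suffices to treat the structure already constructed.
  obtain rfl := τ.eq_envHopf hH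
  refine ⟨τ.rightMonoalternative_envBialgebra, τ.isConnected_envBialgebra,
    ⟨τ.envHom, fun x u => rfl, τ.exists_linearEquiv_envHom, fun B' hB' φ => ?_⟩,
    τ.bijectiveOnC_envHom.equivalent, fun τ' H' hH' => ?_⟩
  · have hone : ∀ x, (τ.envHom.toLieHom x : Module.End k τ.Env) (τ.cls 1) =
        τ.cls (UniversalEnvelopingAlgebra.ι k x) := fun x => by
      rw [Triple.envHom_apply, Triple.smul_cls, mul_one]
    refine ⟨τ.bialgebraHom hB' φ, fun c _ => ?_, fun ψ hψ => τ.bialgebraHom_ext fun c => ?_⟩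
    · change _ = (τ.bialgebraHom hB' φ).toCoalgHom ((τ.envHom.toLieHom c).1 (τ.cls 1))
      rw [hone, Triple.bialgebraHom_cls]
    · have h : _ = ψ.toCoalgHom ((τ.envHom.toLieHom c).1 (τ.cls 1)) := hψ c c.2
      rw [hone] at h
      rw [Triple.bialgebraHom_cls]
      exact h.symm
  · obtain rfl := τ'.eq_envHopf hH'
    exact Triple.nonempty_iso_iff_equivalent
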